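/- Conventions. A 2-category (bicategory) $\mathcal C$ has categories of 1-morphisms $\mathrm{Hom}_1(A,B)$; for 1-morphisms $V,W\in\mathrm{Hom}_1(A,B)$ write $\mathrm{Hom}_2(V,W)$ for the set of 2-morphisms, $V\otimes W$ for the composition of $V\in\mathrm{Hom}_1(A,B)$ with $W\in\mathrm{Hom}_1(B,C)$, and $I_A$ for the 1-identity of $A$. $\mathcal C$ is *semisimple* if each $\mathrm{Hom}_1(A,B)$ is an abelian category in which every object is a direct sum of finitely many simple objects, and the horizontal composition of 2-morphisms is biadditive. It is *linear* over a field $k$ if each $\mathrm{Hom}_1(A,B)$ is a $k$-linear category (for its given additive structure) and the horizontal composition of 2-morphisms is $k$-bilinear. It is *rigid* if every 1-morphism has a left and a right dual (adjoint). It is *connected* if any two simple summands of 1-identities are joined by a finite zigzag of links, where $I\subseteq I_A$ and $J\subseteq I_B$ are linked if $I\otimes V\otimes J\neq0$ for some $V\in\mathrm{Hom}_1(A,B)$. A 1-morphism $V$ of a $k$-linear semisimple 2-category is *strongly simple* if it is simple and $\mathrm{End}_2(V)=k$, and the 2-category is *strongly semisimple* if it is semisimple and all its simple 1-morphisms are strongly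 simple. For a field extension $K/k$, the base change $K\otimes\mathcal C$ has the objects of $\mathcal C$, and its category of 1-morphisms from $A$ to $B$ is the idempotent completion of the category with the objects of $\mathrm{Hom}_1(A,B)$ and with morphisms $K\otimes_k\mathrm{Hom}_2(V,W)$. A $K$-linear 2-category $\mathcal D$ is a *folded form* of a $K$-linear 2-category $\mathcal E$ if it arises from $\mathcal E$ by combining finitely many objects at a time into one: the objects of $\mathcal E$ are partitioned into finite (possibly empty) sets $S_A$ indexed by the objects $A$ of $\mathcal D$, and there are fully faithful $K$-linear functors $\mathrm{Hom}_{\mathcal E}(a,b)\to\mathrm{Hom}_{\mathcal D}(A,B)$ for $a\in S_A$, $b\in S_B$, coherently compatible with composition, such that $I_A$ is the direct sum of the images of the $I_a$, $a\in S_A$, compatibly with the unit isomorphisms, and the essential image of $\mathrm{Hom}_{\mathcal E}(a,b)$ consists of those $V$ for which the canonical maps $I_a\otimes V\to V$ and $V\otimes I_b\to V$ are isomorphisms. Theorem. Let $\mathcal C$ be a connected, semisimple, rigid 2-category with finitely many isomorphism types of simple 1-morphisms. Then there is a field $k$ over which $\mathcal C$ is linear, with the following properties, where $k_s$ denotes the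 separable closure of $k$. 1. $\mathrm{Hom}_2(V,W)$ is finite-dimensional over $k$ for all objects $A,B$ and all $V,W\in\mathrm{Hom}_1(A,B)$. 2. $k_s\otimes\mathcal C$ is a folded form of a semisimple $k_s$-linear 2-category all of whose 1-identities are strongly simple. 3. If $\mathcal C$ has no inseparable extensions of $k$, that is, if for every simple 1-morphism $V$ of $\mathcal C$ the center of the division ring $\mathrm{End}_2(V)$ is a separable extension of $k$, then $k_s\otimes\mathcal C$ is strongly semisimple. -/

import Mathlib

open CategoryTheory CategoryTheory.Limits CategoryTheory.Bicategory CategoryTheory.Idempotents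
open scoped TensorProduct

universe w v u

noncomputable section

/-! ### Semisimple and linear categories -/

/-- A preadditive category is semisimple if it is abelian and every object is a direct sum
of finitely many simple objects. -/
structure IsSemisimpleCategory (A : Type*) [Category A] [Preadditive A] : Prop where
  abelian : ∃ h : Abelian A, h.toPreadditive = ‹Preadditive A›
  exists_decomposition : ∀ X : A, ∃ (n : ℕ) (S : Fin n → A) (b : Bicone S),
    (∀ i, Simple (S i)) ∧ Nonempty b.IsBilimit ∧ Nonempty (b.pt ≅ X)

/-- An object `V` of a `k`-linear category is strongly simple if it is simple and
`End(V) = k`. -/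
def IsStronglySimple (k : Type*) [Field k] {A : Type*} [Category A] [Preadditive A] [Linear k A]
    (V : A) : Prop :=
  Simple V ∧ Function.Bijective (fun c : k => c • 𝟙 V)

/-! ### Additive and linear 2-categories -/

/-- A 2-category whose categories of 1-morphisms are preadditive and whose horizontal
composition of 2-morphisms is biadditive. -/
class PreadditiveBicategory (C : Type u) [Bicategory.{w, v} C] where
  homPreadditive (a b : C) : Preadditive (a ⟶ b)
  whiskerLeft_add {a b c : C} (f : a ⟶ b) {g h : b ⟶ c} (η θ : g ⟶ h) :
    f ◁ (η + θ) = f ◁ η + f ◁ θ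
  add_whiskerRight {a b c : C} {f g : a ⟶ b} (η θ : f ⟶ g) (h : b ⟶ c) :
    (η + θ) ▷ h = η ▷ h + θ ▷ h

attribute [reducible, instance] PreadditiveBicategory.homPreadditive

/-- A 2-category whose categories of 1-morphisms are `k`-linear and whose horizontal
composition of 2-morphisms is `k`-bilinear. -/
class LinearBicategory (k : Type*) [CommRing k] (C : Type u) [Bicategory.{w, v} C]
    [PreadditiveBicategory C] where
  homLinear (a b : C) : Linear k (a ⟶ b)
  whiskerLeft_smul {a b c : C} (f : a ⟶ b) {g h : b ⟶ c} (r : k) (η : g ⟶ h) :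
    f ◁ (r • η) = r • f ◁ η
  smul_whiskerRight {a b c : C} {f g : a ⟶ b} (r : k) (η : f ⟶ g) (h : b ⟶ c) :
    (r • η) ▷ h = r • η ▷ h

attribute [reducible, instance] LinearBicategory.homLinear

/-- A 2-category is semisimple if all its categories of 1-morphisms are semisimple. -/
def IsSemisimpleBicategory (C : Type u) [Bicategory.{w, v} C] [PreadditiveBicategory C] : Prop :=
  ∀ a b : C, IsSemisimpleCategory (a ⟶ b)

/-- A `k`-linear 2-category is strongly semisimple if it is semisimple and all its simple
1-morphisms are strongly simple. -/
def IsStronglySemisimpleBicategory (k : Type*) [Field k] (C : Type u) [Bicategory.{w, v} C]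
    [PreadditiveBicategory C] [LinearBicategory k C] : Prop :=
  IsSemisimpleBicategory C ∧ ∀ (a b : C) (V : a ⟶ b), Simple V → IsStronglySimple k V

/-- A 2-category is rigid if every 1-morphism has a right dual and a left dual. -/
def IsRigidBicategory (C : Type u) [Bicategory.{w, v} C] : Prop :=
  ∀ (a b : C) (V : a ⟶ b),
    (∃ W : b ⟶ a, Nonempty (Bicategory.Adjunction V W)) ∧
    (∃ W : b ⟶ a, Nonempty (Bicategory.Adjunction W V))

/-- There are finitely many isomorphism types of simple 1-morphisms. -/
def HasFinitelyManySimples (C : Type u) [Bicategory.{w, v} C] [PreadditiveBicategory C] : Prop :=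
  Set.Finite {x : Σ p : C × C, Quotient (isIsomorphicSetoid (p.1 ⟶ p.2)) |
    ∃ (a b : C) (V : a ⟶ b), Simple V ∧
      x = ⟨(a, b), Quotient.mk (isIsomorphicSetoid (a ⟶ b)) V⟩}

/-- A simple summand of a 1-identity of `C` (a simple subobject of it); in a semisimple
2-category these are the objects of the unfolded form of `C`, up to equivalence. -/
structure SimpleUnitSummand (C : Type u) [Bicategory.{w, v} C] [PreadditiveBicategory C] where
  pt : C
  obj : pt ⟶ pt
  ι : obj ⟶ 𝟙 pt
  simple : Simple obj
  mono : Mono ι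

/-- Two simple summands `I ⊆ 𝟙 a` and `J ⊆ 𝟙 b` are linked if `I ⊗ V ⊗ J ≠ 0` for some
1-morphism `V : a ⟶ b`. -/
def SimpleUnitSummand.Linked {C : Type u} [Bicategory.{w, v} C] [PreadditiveBicategory C]
    (x y : SimpleUnitSummand C) : Prop :=
  ∃ V : x.pt ⟶ y.pt, ¬ IsZero (x.obj ≫ V ≫ y.obj)

/-- A (semisimple) 2-category is connected if any two simple summands of 1-identities are
connected by a finite zigzag of links. If all 1-identities are simple, this means
that any two objects are connected by a zigzag of nonzero 1-morphisms. -/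
def IsConnectedBicategory (C : Type u) [Bicategory.{w, v} C] [PreadditiveBicategory C] : Prop :=
  ∀ x y : SimpleUnitSummand C, Relation.EqvGen SimpleUnitSummand.Linked x y

/-- The `k`-linear 2-category `C` has no inseparable extensions of `k`: for every simple
1-morphism `V`, the center of the division ring `End(V)` is a separable extension of `k`. -/
def HasNoInseparableExtensions (k : Type*) [Field k] (C : Type u) [Bicategory.{w, v} C]
    [PreadditiveBicategory C] [LinearBicategory k C] : Prop :=
  ∀ (a b : C) (V : a ⟶ b), Simple V → Algebra.IsSeparable k (Subalgebra.center k (End V))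

/-! ### Extension of scalars -/

namespace ScalarExt

variable {k K : Type w} [CommRing k] [CommRing K] [Algebra k K]

section Category

variable {A : Type v} [Category.{w} A] [Preadditive A] [Linear k A]

/-- Composition in `K ⊗ A`: `(c ⊗ f) (d ⊗ g) = cd ⊗ fg`. -/
def comp {X Y Z : A} :
    K ⊗[k] (X ⟶ Y) →ₗ[k] K ⊗[k] (Y ⟶ Z) →ₗ[k] K ⊗[k] (X ⟶ Z) :=
  TensorProduct.map₂ (LinearMap.mul k K) (Linear.comp X Y Z)

@[simp]
theorem comp_tmul {X Y Z : A} (c d : K) (f : X ⟶ Y) (g : Y ⟶ Z) :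
    comp (c ⊗ₜ[k] f) (d ⊗ₜ[k] g) = (c * d) ⊗ₜ[k] (f ≫ g) := rfl

theorem id_comp {X Y : A} (f : K ⊗[k] (X ⟶ Y)) : comp ((1 : K) ⊗ₜ[k] 𝟙 X) f = f := by
  induction f using TensorProduct.induction_on with
  | zero => simp
  | tmul c f => simp
  | add x y hx hy => rw [map_add, hx, hy]

theorem comp_id {X Y : A} (f : K ⊗[k] (X ⟶ Y)) : comp f ((1 : K) ⊗ₜ[k] 𝟙 Y) = f := by
  induction f using TensorProduct.induction_on with
  | zero => simp
  | tmul c f => simp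
  | add x y hx hy => rw [map_add, LinearMap.add_apply, hx, hy]

theorem assoc {X Y Z T : A} (f : K ⊗[k] (X ⟶ Y)) (g : K ⊗[k] (Y ⟶ Z)) (h : K ⊗[k] (Z ⟶ T)) :
    comp (comp f g) h = comp f (comp g h) := by
  induction f using TensorProduct.induction_on with
  | zero => simp
  | add x y hx hy => simp only [map_add, LinearMap.add_apply, hx, hy]
  | tmul c f =>
    induction g using TensorProduct.induction_on with
    | zero => simp
    | add x y hx hy => simp only [map_add, LinearMap.add_apply, hx, hy]
    | tmul d g =>
      induction h using TensorProduct.induction_on with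
      | zero => simp
      | add x y hx hy => simp only [map_add, hx, hy]
      | tmul e h => simp [mul_assoc]

theorem smul_comp {X Y Z : A} (r : K) (f : K ⊗[k] (X ⟶ Y)) (g : K ⊗[k] (Y ⟶ Z)) :
    comp (r • f) g = r • comp f g := by
  induction f using TensorProduct.induction_on with
  | zero => simp
  | add x y hx hy => simp only [smul_add, map_add, LinearMap.add_apply, hx, hy]
  | tmul c f =>
    induction g using TensorProduct.induction_on with
    | zero => simp
    | add x y hx hy => simp only [smul_add, map_add, hx, hy]
    | tmul d g => simp [TensorProduct.smul_tmul', mul_assoc]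

theorem comp_smul {X Y Z : A} (f : K ⊗[k] (X ⟶ Y)) (r : K) (g : K ⊗[k] (Y ⟶ Z)) :
    comp f (r • g) = r • comp f g := by
  induction f using TensorProduct.induction_on with
  | zero => simp
  | add x y hx hy => simp only [smul_add, map_add, LinearMap.add_apply, hx, hy]
  | tmul c f =>
    induction g using TensorProduct.induction_on with
    | zero => simp
    | add x y hx hy => simp only [smul_add, map_add, hx, hy]
    | tmul d g => simp [TensorProduct.smul_tmul', mul_left_comm]

theorem add_comp {X Y Z : A} (f f' : K ⊗[k] (X ⟶ Y)) (g : K ⊗[k] (Y ⟶ Z)) :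
    comp (f + f') g = comp f g + comp f' g :=
  LinearMap.map_add₂ comp f f' g

theorem comp_add {X Y Z : A} (f : K ⊗[k] (X ⟶ Y)) (g g' : K ⊗[k] (Y ⟶ Z)) :
    comp f (g + g') = comp f g + comp f g' :=
  map_add (comp f) g g'

end Category

section Bicategory

variable {C : Type u} [Bicategory.{w, v} C] [PreadditiveBicategory C] [LinearBicategory k C]

/-- Left whiskering in `C` as a linear map. -/
def whiskerLeftLin (k : Type w) [CommRing k] [LinearBicategory k C] {a b c : C} (f : a ⟶ b)
    (g h : b ⟶ c) : (g ⟶ h) →ₗ[k] (f ≫ g ⟶ f ≫ h) where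
  toFun η := f ◁ η
  map_add' η θ := PreadditiveBicategory.whiskerLeft_add f η θ
  map_smul' r η := LinearBicategory.whiskerLeft_smul f r η

/-- Right whiskering in `C` as a linear map. -/
def whiskerRightLin (k : Type w) [CommRing k] [LinearBicategory k C] {a b c : C} (f g : a ⟶ b)
    (h : b ⟶ c) : (f ⟶ g) →ₗ[k] (f ≫ h ⟶ g ≫ h) where
  toFun η := η ▷ h
  map_add' η θ := PreadditiveBicategory.add_whiskerRight η θ h
  map_smul' r η := LinearBicategory.smul_whiskerRight r η h

/-- `f ◁ (c ⊗ η) = c ⊗ (f ◁ η)`. -/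
def wL {a b c : C} (f : a ⟶ b) {g h : b ⟶ c} :
    K ⊗[k] (g ⟶ h) →ₗ[K] K ⊗[k] (f ≫ g ⟶ f ≫ h) :=
  (whiskerLeftLin k f g h).baseChange K

/-- `(c ⊗ η) ▷ h = c ⊗ (η ▷ h)`. -/
def wR {a b c : C} {f g : a ⟶ b} (h : b ⟶ c) :
    K ⊗[k] (f ⟶ g) →ₗ[K] K ⊗[k] (f ≫ h ⟶ g ≫ h) :=
  (whiskerRightLin k f g h).baseChange K

@[simp]
theorem wL_tmul {a b c : C} (f : a ⟶ b) {g h : b ⟶ c} (r : K) (η : g ⟶ h) :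
    wL f (r ⊗ₜ[k] η) = r ⊗ₜ[k] (f ◁ η) := rfl

@[simp]
theorem wR_tmul {a b c : C} {f g : a ⟶ b} (h : b ⟶ c) (r : K) (η : f ⟶ g) :
    wR h (r ⊗ₜ[k] η) = r ⊗ₜ[k] (η ▷ h) := rfl

theorem wL_comp {a b c : C} (f : a ⟶ b) {g h i : b ⟶ c} (η : K ⊗[k] (g ⟶ h))
    (θ : K ⊗[k] (h ⟶ i)) : wL f (comp η θ) = comp (wL f η) (wL f θ) := by
  induction η using TensorProduct.induction_on with
  | zero => simp
  | add x y hx hy => simp_all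
  | tmul c η =>
    induction θ using TensorProduct.induction_on with
    | zero => simp
    | add x y hx hy => simp_all
    | tmul d θ => simp

theorem wR_comp {a b c : C} {f g h : a ⟶ b} (η : K ⊗[k] (f ⟶ g)) (θ : K ⊗[k] (g ⟶ h))
    (i : b ⟶ c) : wR i (comp η θ) = comp (wR i η) (wR i θ) := by
  induction η using TensorProduct.induction_on with
  | zero => simp
  | add x y hx hy => simp_all
  | tmul c η =>
    induction θ using TensorProduct.induction_on with
    | zero => simp
    | add x y hx hy => simp_all
    | tmul d θ => simp

theorem wL_id {a b : C} {f g : a ⟶ b} (η : K ⊗[k] (f ⟶ g)) :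
    wL (𝟙 a) η = comp ((1 : K) ⊗ₜ[k] (λ_ f).hom) (comp η ((1 : K) ⊗ₜ[k] (λ_ g).inv)) := by
  induction η using TensorProduct.induction_on with
  | zero => simp
  | add x y hx hy => simp_all
  | tmul c η => simp

theorem wR_id {a b : C} {f g : a ⟶ b} (η : K ⊗[k] (f ⟶ g)) :
    wR (𝟙 b) η = comp ((1 : K) ⊗ₜ[k] (ρ_ f).hom) (comp η ((1 : K) ⊗ₜ[k] (ρ_ g).inv)) := by
  induction η using TensorProduct.induction_on with
  | zero => simp
  | add x y hx hy => simp_all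
  | tmul c η => simp

theorem comp_wL {a b c d : C} (f : a ⟶ b) (g : b ⟶ c) {h h' : c ⟶ d} (η : K ⊗[k] (h ⟶ h')) :
    wL (f ≫ g) η = comp ((1 : K) ⊗ₜ[k] (α_ f g h).hom)
      (comp (wL f (wL g η)) ((1 : K) ⊗ₜ[k] (α_ f g h').inv)) := by
  induction η using TensorProduct.induction_on with
  | zero => simp
  | add x y hx hy => simp_all
  | tmul c η => simp

theorem comp_wR {a b c d : C} {f f' : a ⟶ b} (η : K ⊗[k] (f ⟶ f')) (g : b ⟶ c) (h : c ⟶ d) :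
    wR (g ≫ h) η = comp ((1 : K) ⊗ₜ[k] (α_ f g h).inv)
      (comp (wR h (wR g η)) ((1 : K) ⊗ₜ[k] (α_ f' g h).hom)) := by
  induction η using TensorProduct.induction_on with
  | zero => simp
  | add x y hx hy => simp_all
  | tmul c η => simp

theorem wR_wL {a b c d : C} (f : a ⟶ b) {g g' : b ⟶ c} (η : K ⊗[k] (g ⟶ g')) (h : c ⟶ d) :
    wR h (wL f η) = comp ((1 : K) ⊗ₜ[k] (α_ f g h).hom)
      (comp (wL f (wR h η)) ((1 : K) ⊗ₜ[k] (α_ f g' h).inv)) := by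
  induction η using TensorProduct.induction_on with
  | zero => simp
  | add x y hx hy => simp_all
  | tmul c η => simp

theorem wL_wR_exchange {a b c : C} {f g : a ⟶ b} {h i : b ⟶ c} (η : K ⊗[k] (f ⟶ g))
    (θ : K ⊗[k] (h ⟶ i)) : comp (wL f θ) (wR i η) = comp (wR h η) (wL g θ) := by
  induction η using TensorProduct.induction_on with
  | zero => simp
  | add x y hx hy => simp_all
  | tmul c η =>
    induction θ using TensorProduct.induction_on with
    | zero => simp
    | add x y hx hy => simp_all
    | tmul d θ => simp [mul_comm, whisker_exchange]

theorem pentagon {a b c d e : C} (f : a ⟶ b) (g : b ⟶ c) (h : c ⟶ d) (i : d ⟶ e) :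
    comp (wR i ((1 : K) ⊗ₜ[k] (α_ f g h).hom)) (comp ((1 : K) ⊗ₜ[k] (α_ f (g ≫ h) i).hom)
      (wL f ((1 : K) ⊗ₜ[k] (α_ g h i).hom))) =
    comp ((1 : K) ⊗ₜ[k] (α_ (f ≫ g) h i).hom) ((1 : K) ⊗ₜ[k] (α_ f g (h ≫ i)).hom) := by
  simp

theorem triangle {a b c : C} (f : a ⟶ b) (g : b ⟶ c) :
    comp ((1 : K) ⊗ₜ[k] (α_ f (𝟙 b) g).hom) (wL f ((1 : K) ⊗ₜ[k] (λ_ g).hom)) =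
    wR g ((1 : K) ⊗ₜ[k] (ρ_ f).hom) := by
  simp

theorem wL_add {a b c : C} (f : a ⟶ b) {g h : b ⟶ c} (η θ : K ⊗[k] (g ⟶ h)) :
    wL f (η + θ) = wL f η + wL f θ := map_add _ _ _

theorem wR_add {a b c : C} {f g : a ⟶ b} (η θ : K ⊗[k] (f ⟶ g)) (h : b ⟶ c) :
    wR h (η + θ) = wR h η + wR h θ := map_add _ _ _

theorem wL_smul {a b c : C} (f : a ⟶ b) {g h : b ⟶ c} (r : K) (η : K ⊗[k] (g ⟶ h)) :
    wL f (r • η) = r • wL f η := map_smul _ _ _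

theorem wR_smul {a b c : C} {f g : a ⟶ b} (r : K) (η : K ⊗[k] (f ⟶ g)) (h : b ⟶ c) :
    wR h (r • η) = r • wR h η := map_smul _ _ _

end Bicategory

end ScalarExt

/-- The category with the objects of a `k`-linear category `A`, and with
`Hom(X, Y) = K ⊗ Hom_A(X, Y)`. -/
structure ScalarExtCategory (k K : Type w) (A : Type v) where
  as : A

namespace ScalarExtCategory

variable {k K : Type w} [CommRing k] [CommRing K] [Algebra k K]
variable {A : Type v} [Category.{w} A] [Preadditive A] [Linear k A]

instance : Category.{w} (ScalarExtCategory k K A) where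
  Hom X Y := K ⊗[k] (X.as ⟶ Y.as)
  id X := (1 : K) ⊗ₜ[k] 𝟙 X.as
  comp f g := ScalarExt.comp f g
  id_comp f := ScalarExt.id_comp f
  comp_id f := ScalarExt.comp_id f
  assoc f g h := ScalarExt.assoc f g h

instance : Preadditive (ScalarExtCategory k K A) where
  homGroup X Y := inferInstanceAs (AddCommGroup (K ⊗[k] (X.as ⟶ Y.as)))
  add_comp _ _ _ f f' g := ScalarExt.add_comp f f' g
  comp_add _ _ _ f g g' := ScalarExt.comp_add f g g'

instance : Linear K (ScalarExtCategory k K A) where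
  homModule X Y := inferInstanceAs (Module K (K ⊗[k] (X.as ⟶ Y.as)))
  smul_comp _ _ _ r f g := ScalarExt.smul_comp r f g
  comp_smul _ _ _ f r g := ScalarExt.comp_smul f r g

/-- The isomorphism `1 ⊗ e`. -/
def mkIso {X Y : ScalarExtCategory k K A} (e : X.as ≅ Y.as) : X ≅ Y where
  hom := (1 : K) ⊗ₜ[k] e.hom
  inv := (1 : K) ⊗ₜ[k] e.inv
  hom_inv_id := (ScalarExt.comp_tmul _ _ _ _).trans (by rw [mul_one, e.hom_inv_id]; rfl)
  inv_hom_id := (ScalarExt.comp_tmul _ _ _ _).trans (by rw [mul_one, e.inv_hom_id]; rfl)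

end ScalarExtCategory

/-- The 2-category with the objects and 1-morphisms of a `k`-linear 2-category `C`, and with
2-morphisms `K ⊗ Hom_C(V, W)`. -/
structure ScalarExtBicategory (k K : Type w) (C : Type u) where
  as : C

namespace ScalarExtBicategory

variable {k K : Type w} [CommRing k] [CommRing K] [Algebra k K]
variable {C : Type u} [Bicategory.{w, v} C] [PreadditiveBicategory C] [LinearBicategory k C]

instance : Bicategory.{w, v} (ScalarExtBicategory k K C) where
  Hom a b := ScalarExtCategory k K (a.as ⟶ b.as)
  id a := ⟨𝟙 a.as⟩
  comp f g := ⟨f.as ≫ g.as⟩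
  homCategory a b := inferInstanceAs (Category.{w} (ScalarExtCategory k K (a.as ⟶ b.as)))
  whiskerLeft f _ _ η := ScalarExt.wL f.as η
  whiskerRight η h := ScalarExt.wR h.as η
  associator f g h := ScalarExtCategory.mkIso (α_ f.as g.as h.as)
  leftUnitor f := ScalarExtCategory.mkIso (λ_ f.as)
  rightUnitor f := ScalarExtCategory.mkIso (ρ_ f.as)
  whiskerLeft_id f g := congrArg (fun x => (1 : K) ⊗ₜ[k] x) (whiskerLeft_id f.as g.as)
  whiskerLeft_comp f _ _ _ η θ := ScalarExt.wL_comp f.as η θ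
  id_whiskerLeft η := ScalarExt.wL_id η
  comp_whiskerLeft f g _ _ η := ScalarExt.comp_wL f.as g.as η
  id_whiskerRight f g := congrArg (fun x => (1 : K) ⊗ₜ[k] x) (id_whiskerRight f.as g.as)
  comp_whiskerRight η θ i := ScalarExt.wR_comp η θ i.as
  whiskerRight_id η := ScalarExt.wR_id η
  whiskerRight_comp η g h := ScalarExt.comp_wR η g.as h.as
  whisker_assoc f _ _ η h := ScalarExt.wR_wL f.as η h.as
  whisker_exchange η θ := ScalarExt.wL_wR_exchange η θ
  pentagon f g h i := ScalarExt.pentagon f.as g.as h.as i.as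
  triangle f g := ScalarExt.triangle f.as g.as

instance : PreadditiveBicategory (ScalarExtBicategory k K C) where
  homPreadditive a b := inferInstanceAs (Preadditive (ScalarExtCategory k K (a.as ⟶ b.as)))
  whiskerLeft_add f _ _ η θ := ScalarExt.wL_add f.as η θ
  add_whiskerRight η θ h := ScalarExt.wR_add η θ h.as

instance : LinearBicategory K (ScalarExtBicategory k K C) where
  homLinear a b := inferInstanceAs (Linear K (ScalarExtCategory k K (a.as ⟶ b.as)))
  whiskerLeft_smul f _ _ r η := ScalarExt.wL_smul f.as r η
  smul_whiskerRight r η h := ScalarExt.wR_smul r η h.as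

end ScalarExtBicategory

/-! ### Idempotent completion of the categories of 1-morphisms -/

/-- The 2-category obtained from `C` by replacing each category of 1-morphisms `Hom(a, b)` by its
idempotent completion (Karoubi envelope). -/
structure LocalKaroubi (C : Type u) where
  as : C

namespace LocalKaroubi

section

variable {C : Type u} [Bicategory.{w, v} C]

/-- Horizontal composition of 2-morphisms. -/
def hcomp {a b c : C} {f f' : a ⟶ b} {g g' : b ⟶ c} (η : f ⟶ f') (θ : g ⟶ g') :
    f ≫ g ⟶ f' ≫ g' :=
  η ▷ g ≫ f' ◁ θ

theorem hcomp_comp {a b c : C} {f f' f'' : a ⟶ b} {g g' g'' : b ⟶ c} (η : f ⟶ f')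
    (η' : f' ⟶ f'') (θ : g ⟶ g') (θ' : g' ⟶ g'') :
    hcomp η θ ≫ hcomp η' θ' = hcomp (η ≫ η') (θ ≫ θ') := by
  simp only [hcomp, Category.assoc, comp_whiskerRight, whiskerLeft_comp]
  rw [whisker_exchange_assoc]

@[simp]
theorem hcomp_comp_assoc {a b c : C} {f f' f'' : a ⟶ b} {g g' g'' : b ⟶ c} (η : f ⟶ f')
    (η' : f' ⟶ f'') (θ : g ⟶ g') (θ' : g' ⟶ g'') {h : a ⟶ c} (ξ : f'' ≫ g'' ⟶ h) :
    hcomp η θ ≫ hcomp η' θ' ≫ ξ = hcomp (η ≫ η') (θ ≫ θ') ≫ ξ := by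
  rw [← hcomp_comp, Category.assoc]

theorem hcomp_whiskerRight {a b c : C} {f f' f'' : a ⟶ b} {g g' : b ⟶ c} (η : f ⟶ f')
    (η' : f' ⟶ f'') (θ : g ⟶ g') : hcomp (η ≫ η') θ = hcomp η θ ≫ η' ▷ g' := by
  simp [hcomp, whisker_exchange]

theorem hcomp_whiskerLeft {a b c : C} {f f' : a ⟶ b} {g g' g'' : b ⟶ c} (η : f ⟶ f')
    (θ : g ⟶ g') (θ' : g' ⟶ g'') : hcomp η (θ ≫ θ') = hcomp η θ ≫ f' ◁ θ' := by
  simp [hcomp]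

theorem whiskerRight_hcomp {a b c : C} {f f' f'' : a ⟶ b} {g g' : b ⟶ c} (η : f ⟶ f')
    (η' : f' ⟶ f'') (θ : g ⟶ g') : η ▷ g ≫ hcomp η' θ = hcomp (η ≫ η') θ := by
  simp [hcomp]

theorem hcomp_associator {a b c d : C} {f f' : a ⟶ b} {g g' : b ⟶ c} {h h' : c ⟶ d}
    (η : f ⟶ f') (θ : g ⟶ g') (ξ : h ⟶ h') :
    hcomp (hcomp η θ) ξ ≫ (α_ f' g' h').hom = (α_ f g h).hom ≫ hcomp η (hcomp θ ξ) := by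
  simp [hcomp]

@[simp]
theorem hcomp_associator_assoc {a b c d : C} {f f' : a ⟶ b} {g g' : b ⟶ c} {h h' : c ⟶ d}
    (η : f ⟶ f') (θ : g ⟶ g') (ξ : h ⟶ h') {k : a ⟶ d} (ζ : f' ≫ g' ≫ h' ⟶ k) :
    hcomp (hcomp η θ) ξ ≫ (α_ f' g' h').hom ≫ ζ =
      (α_ f g h).hom ≫ hcomp η (hcomp θ ξ) ≫ ζ := by
  rw [← Category.assoc, hcomp_associator, Category.assoc]

theorem hcomp_leftUnitor {a b : C} {f f' : a ⟶ b} (η : f ⟶ f') :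
    hcomp (𝟙 (𝟙 a)) η ≫ (λ_ f').hom = (λ_ f).hom ≫ η := by
  simp [hcomp]

theorem hcomp_rightUnitor {a b : C} {f f' : a ⟶ b} (η : f ⟶ f') :
    hcomp η (𝟙 (𝟙 b)) ≫ (ρ_ f').hom = (ρ_ f).hom ≫ η := by
  simp [hcomp]

/-- Composition of 1-morphisms. -/
abbrev comp {a b c : C} (F : Karoubi (a ⟶ b)) (G : Karoubi (b ⟶ c)) : Karoubi (a ⟶ c) where
  X := F.X ≫ G.X
  p := hcomp F.p G.p
  idem := by rw [hcomp_comp, F.idem, G.idem]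

/-- The 1-identity. -/
abbrev one (a : C) : Karoubi (a ⟶ a) where
  X := 𝟙 a
  p := 𝟙 _
  idem := Category.comp_id _

/-- Horizontal composition of 2-morphisms. -/
abbrev hor {a b c : C} {F F' : Karoubi (a ⟶ b)} {G G' : Karoubi (b ⟶ c)} (η : F ⟶ F')
    (θ : G ⟶ G') : comp F G ⟶ comp F' G' where
  f := hcomp η.f θ.f
  comm := by simp [hcomp_comp]

/-- The associator. -/
abbrev assoc {a b c d : C} (F : Karoubi (a ⟶ b)) (G : Karoubi (b ⟶ c)) (H : Karoubi (c ⟶ d)) :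
    comp (comp F G) H ≅ comp F (comp G H) where
  hom :=
    { f := hcomp (hcomp F.p G.p) H.p ≫ (α_ F.X G.X H.X).hom
      comm := by simp [hcomp_associator, hcomp_comp] }
  inv :=
    { f := hcomp F.p (hcomp G.p H.p) ≫ (α_ F.X G.X H.X).inv
      comm := by
        rw [← cancel_mono (α_ F.X G.X H.X).hom]
        simp [hcomp_associator, hcomp_comp] }
  hom_inv_id := by
    ext
    rw [← cancel_mono (α_ F.X G.X H.X).hom]
    simp [hcomp_associator, hcomp_comp]
  inv_hom_id := by
    ext
    simp [hcomp_associator, hcomp_comp]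

/-- The left unitor. -/
abbrev left {a b : C} (F : Karoubi (a ⟶ b)) : comp (one a) F ≅ F where
  hom :=
    { f := (λ_ F.X).hom ≫ F.p
      comm := by simp [← hcomp_leftUnitor] }
  inv :=
    { f := F.p ≫ (λ_ F.X).inv
      comm := by
        rw [← cancel_mono (λ_ F.X).hom]
        simp [hcomp_leftUnitor] }
  hom_inv_id := by
    ext
    rw [← cancel_mono (λ_ F.X).hom]
    simp [hcomp_leftUnitor]
  inv_hom_id := by
    ext
    simp

/-- The right unitor. -/
abbrev right {a b : C} (F : Karoubi (a ⟶ b)) : comp F (one b) ≅ F where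
  hom :=
    { f := (ρ_ F.X).hom ≫ F.p
      comm := by simp [← hcomp_rightUnitor] }
  inv :=
    { f := F.p ≫ (ρ_ F.X).inv
      comm := by
        rw [← cancel_mono (ρ_ F.X).hom]
        simp [hcomp_rightUnitor] }
  hom_inv_id := by
    ext
    rw [← cancel_mono (ρ_ F.X).hom]
    simp [hcomp_rightUnitor]
  inv_hom_id := by
    ext
    simp

theorem hor_id {a b c : C} (F : Karoubi (a ⟶ b)) (G : Karoubi (b ⟶ c)) :
    hor (𝟙 F) (𝟙 G) = 𝟙 (comp F G) := rfl

theorem hor_comp {a b c : C} {F F' F'' : Karoubi (a ⟶ b)} {G G' G'' : Karoubi (b ⟶ c)}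
    (η : F ⟶ F') (η' : F' ⟶ F'') (θ : G ⟶ G') (θ' : G' ⟶ G'') :
    hor (η ≫ η') (θ ≫ θ') = hor η θ ≫ hor η' θ' := by
  ext
  simp [hcomp_comp]

theorem one_hor {a b : C} {F G : Karoubi (a ⟶ b)} (η : F ⟶ G) :
    hor (𝟙 (one a)) η = (left F).hom ≫ η ≫ (left G).inv := by
  ext
  rw [← cancel_mono (λ_ G.X).hom]
  simp [hcomp_leftUnitor]

theorem hor_one {a b : C} {F G : Karoubi (a ⟶ b)} (η : F ⟶ G) :
    hor η (𝟙 (one b)) = (right F).hom ≫ η ≫ (right G).inv := by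
  ext
  rw [← cancel_mono (ρ_ G.X).hom]
  simp [hcomp_rightUnitor]

theorem hor_assoc {a b c d : C} {F F' : Karoubi (a ⟶ b)} {G G' : Karoubi (b ⟶ c)}
    {H H' : Karoubi (c ⟶ d)} (η : F ⟶ F') (θ : G ⟶ G') (ξ : H ⟶ H') :
    hor (hor η θ) ξ = (assoc F G H).hom ≫ hor η (hor θ ξ) ≫ (assoc F' G' H').inv := by
  ext
  rw [← cancel_mono (α_ F'.X G'.X H'.X).hom]
  dsimp only [Karoubi.comp_f]
  simp only [Category.assoc, Iso.inv_hom_id, Category.comp_id, hcomp_comp_assoc,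
    Karoubi.comp_p, hcomp_associator, hcomp_comp, Karoubi.p_comp]

theorem hor_assoc' {a b c d : C} {F F' : Karoubi (a ⟶ b)} {G G' : Karoubi (b ⟶ c)}
    {H H' : Karoubi (c ⟶ d)} (η : F ⟶ F') (θ : G ⟶ G') (ξ : H ⟶ H') :
    hor η (hor θ ξ) = (assoc F G H).inv ≫ hor (hor η θ) ξ ≫ (assoc F' G' H').hom := by
  rw [hor_assoc, Category.assoc, Category.assoc, Iso.inv_hom_id, Category.comp_id,
    Iso.inv_hom_id_assoc]

theorem hor_pentagon {a b c d e : C} (F : Karoubi (a ⟶ b)) (G : Karoubi (b ⟶ c))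
    (H : Karoubi (c ⟶ d)) (I : Karoubi (d ⟶ e)) :
    hor (assoc F G H).hom (𝟙 I) ≫ (assoc F (comp G H) I).hom ≫ hor (𝟙 F) (assoc G H I).hom =
      (assoc (comp F G) H I).hom ≫ (assoc F G (comp H I)).hom := by
  ext
  simp only [Karoubi.comp_f, Karoubi.id_f]
  have h : hcomp (hcomp (hcomp F.p G.p) H.p ≫ (α_ F.X G.X H.X).hom) I.p ≫
      hcomp (hcomp F.p (hcomp G.p H.p)) I.p =
        hcomp (hcomp (hcomp F.p G.p) H.p) I.p ≫ (α_ F.X G.X H.X).hom ▷ I.X := by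
    rw [hcomp_comp, ← hcomp_whiskerRight, Category.assoc, ← hcomp_associator, hcomp_comp_assoc]
    simp only [Karoubi.idem, hcomp_comp]
  have h' : hcomp (hcomp F.p (hcomp G.p H.p)) I.p ≫ (α_ F.X (G.X ≫ H.X) I.X).hom ≫
      hcomp F.p (hcomp (hcomp G.p H.p) I.p ≫ (α_ G.X H.X I.X).hom) =
        hcomp (hcomp F.p (hcomp G.p H.p)) I.p ≫ (α_ F.X (G.X ≫ H.X) I.X).hom ≫
          F.X ◁ (α_ G.X H.X I.X).hom := by
    rw [hcomp_whiskerLeft, ← hcomp_associator_assoc, hcomp_comp_assoc]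
    simp only [Karoubi.idem, hcomp_comp]
  have h'' : hcomp (hcomp (hcomp F.p G.p) H.p) I.p ≫ (α_ (F.X ≫ G.X) H.X I.X).hom ≫
      hcomp (hcomp F.p G.p) (hcomp H.p I.p) =
        hcomp (hcomp (hcomp F.p G.p) H.p) I.p ≫ (α_ (F.X ≫ G.X) H.X I.X).hom := by
    rw [← hcomp_associator, hcomp_comp_assoc]
    simp only [Karoubi.idem, hcomp_comp]
  simp only [Category.assoc]
  rw [h', reassoc_of% h, reassoc_of% h'', pentagon]

theorem hor_triangle {a b c : C} (F : Karoubi (a ⟶ b)) (G : Karoubi (b ⟶ c)) :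
    (assoc F (one b) G).hom ≫ hor (𝟙 F) (left G).hom = hor (right F).hom (𝟙 G) := by
  ext
  simp only [Karoubi.comp_f, Karoubi.id_f]
  rw [Category.assoc, ← hcomp_leftUnitor, ← hcomp_rightUnitor, hcomp_whiskerRight,
    hcomp_whiskerLeft, ← hcomp_associator_assoc, hcomp_comp_assoc, Bicategory.triangle]
  simp only [Karoubi.idem, hcomp_comp, Category.comp_id]

instance : Bicategory.{w, max v w} (LocalKaroubi C) where
  Hom a b := Karoubi (a.as ⟶ b.as)
  id a := one a.as
  comp F G := comp F G
  homCategory a b := inferInstanceAs (Category (Karoubi (a.as ⟶ b.as)))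
  whiskerLeft F _ _ η := hor (𝟙 F) η
  whiskerRight η H := hor η (𝟙 H)
  associator F G H := assoc F G H
  leftUnitor F := left F
  rightUnitor F := right F
  whiskerLeft_id F G := hor_id F G
  whiskerLeft_comp F _ _ _ η θ := by
    simpa only [Category.comp_id] using hor_comp (𝟙 F) (𝟙 F) η θ
  id_whiskerLeft η := one_hor η
  comp_whiskerLeft F G _ _ η := hor_assoc (𝟙 F) (𝟙 G) η
  id_whiskerRight F G := hor_id F G
  comp_whiskerRight η θ I := by
    simpa only [Category.comp_id] using hor_comp η θ (𝟙 I) (𝟙 I)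
  whiskerRight_id η := hor_one η
  whiskerRight_comp η G H := hor_assoc' η (𝟙 G) (𝟙 H)
  whisker_assoc F _ _ η H := hor_assoc (𝟙 F) η (𝟙 H)
  whisker_exchange {_ _ _ F G H I} η θ := by
    exact (hor_comp (𝟙 F) η θ (𝟙 I)).symm.trans
      ((by simp only [Category.comp_id, Category.id_comp] :
        hor (𝟙 F ≫ η) (θ ≫ 𝟙 I) = hor (η ≫ 𝟙 G) (𝟙 H ≫ θ)).trans (hor_comp η (𝟙 G) (𝟙 H) θ))
  pentagon F G H I := hor_pentagon F G H I
  triangle F G := hor_triangle F G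

end

section Linear

variable {C : Type u} [Bicategory.{w, v} C] [PreadditiveBicategory C]

theorem add_hcomp {a b c : C} {f f' : a ⟶ b} {g g' : b ⟶ c} (η η' : f ⟶ f') (θ : g ⟶ g') :
    hcomp (η + η') θ = hcomp η θ + hcomp η' θ := by
  simp [hcomp, PreadditiveBicategory.add_whiskerRight]

theorem hcomp_add {a b c : C} {f f' : a ⟶ b} {g g' : b ⟶ c} (η : f ⟶ f') (θ θ' : g ⟶ g') :
    hcomp η (θ + θ') = hcomp η θ + hcomp η θ' := by
  simp [hcomp, PreadditiveBicategory.whiskerLeft_add]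

instance : PreadditiveBicategory (LocalKaroubi C) where
  homPreadditive a b := inferInstanceAs (Preadditive (Karoubi (a.as ⟶ b.as)))
  whiskerLeft_add F _ _ η θ := Karoubi.hom_ext _ _ (hcomp_add F.p η.f θ.f)
  add_whiskerRight η θ H := Karoubi.hom_ext _ _ (add_hcomp η.f θ.f H.p)

variable {K : Type*} [CommRing K]

/-- The `K`-linear structure on the idempotent completion of a `K`-linear category. -/
instance (A : Type*) [Category A] [Preadditive A] [Linear K A] : Linear K (Karoubi A) where
  homModule P Q :=
    { smul r f := ⟨r • f.f, by simp⟩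
      one_smul f := Karoubi.hom_ext _ _ (one_smul K f.f)
      mul_smul r s f := Karoubi.hom_ext _ _ (mul_smul r s f.f)
      smul_zero r := Karoubi.hom_ext _ _ (smul_zero r)
      smul_add r f g := Karoubi.hom_ext _ _ (smul_add r f.f g.f)
      add_smul r s f := Karoubi.hom_ext _ _ (add_smul r s f.f)
      zero_smul f := Karoubi.hom_ext _ _ (zero_smul K f.f) }
  smul_comp _ _ _ r f g := Karoubi.hom_ext _ _ (Linear.smul_comp _ _ _ r f.f g.f)
  comp_smul _ _ _ f r g := Karoubi.hom_ext _ _ (Linear.comp_smul _ _ _ f.f r g.f)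

variable [LinearBicategory K C]

theorem smul_hcomp {a b c : C} {f f' : a ⟶ b} {g g' : b ⟶ c} (r : K) (η : f ⟶ f')
    (θ : g ⟶ g') : hcomp (r • η) θ = r • hcomp η θ := by
  simp [hcomp, LinearBicategory.smul_whiskerRight]

theorem hcomp_smul {a b c : C} {f f' : a ⟶ b} {g g' : b ⟶ c} (η : f ⟶ f') (r : K)
    (θ : g ⟶ g') : hcomp η (r • θ) = r • hcomp η θ := by
  simp [hcomp, LinearBicategory.whiskerLeft_smul]

instance : LinearBicategory K (LocalKaroubi C) where
  homLinear a b := inferInstanceAs (Linear K (Karoubi (a.as ⟶ b.as)))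
  whiskerLeft_smul F _ _ r η := Karoubi.hom_ext _ _ (hcomp_smul F.p r η.f)
  smul_whiskerRight r η H := Karoubi.hom_ext _ _ (smul_hcomp r η.f H.p)

end Linear

end LocalKaroubi

/-- The base change `K ⊗ C` of a `k`-linear 2-category `C`: the objects are those of `C`, and
the category of 1-morphisms from `a` to `b` is the idempotent completion of `K ⊗ Hom_C(a, b)`. -/
abbrev BaseChange (k K : Type w) [CommRing k] [CommRing K] [Algebra k K] (C : Type u)
    [Bicategory.{w, v} C] [PreadditiveBicategory C] [LinearBicategory k C] : Type u :=
  LocalKaroubi (ScalarExtBicategory k K C)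

/-! ### Folding -/

/-- The data exhibiting the `k`-linear 2-category `D` as a folded form of the `k`-linear
2-category `E`: for every object `A` of `D`, finitely many objects `pt A s` of `E` are combined
into the one object `A`, every object of `E` being used exactly once. The 1-identity of `A` is
the direct sum of (the images of) the 1-identities of the `pt A s`, and `Hom_E(pt A s, pt B t)`
is the full subcategory of those `V` in `Hom_D(A, B)` for which the canonical maps
`𝟙 (pt A s) ⊗ V ⟶ V` and `V ⊗ 𝟙 (pt B t) ⟶ V` are isomorphisms. -/
structure Folding (k : Type*) [Field k]
    (E : Type*) [Bicategory E] [PreadditiveBicategory E] [LinearBicategory k E]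
    (D : Type*) [Bicategory D] [PreadditiveBicategory D] [LinearBicategory k D] where
  /-- the number of objects of `E` that are combined into `A` -/
  num : D → ℕ
  pt (A : D) : Fin (num A) → E
  bijective : Function.Bijective fun x : Σ A, Fin (num A) => pt x.1 x.2
  /-- the embedding of the categories of 1-morphisms -/
  map {A B : D} (s : Fin (num A)) (t : Fin (num B)) : (pt A s ⟶ pt B t) ⥤ (A ⟶ B)
  full {A B : D} (s : Fin (num A)) (t : Fin (num B)) : (map s t).Full
  faithful {A B : D} (s : Fin (num A)) (t : Fin (num B)) : (map s t).Faithful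
  additive {A B : D} (s : Fin (num A)) (t : Fin (num B)) : (map s t).Additive
  linear {A B : D} (s : Fin (num A)) (t : Fin (num B)) : (map s t).Linear k
  /-- compatibility with the composition of 1-morphisms -/
  mapComp {A B C : D} {s : Fin (num A)} {t : Fin (num B)} {r : Fin (num C)}
    (f : pt A s ⟶ pt B t) (g : pt B t ⟶ pt C r) :
    (map s r).obj (f ≫ g) ≅ (map s t).obj f ≫ (map t r).obj g
  /-- the inclusion of the 1-identity of `pt A s` in the 1-identity of `A` -/
  ι {A : D} (s : Fin (num A)) : (map s s).obj (𝟙 (pt A s)) ⟶ 𝟙 A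
  mapComp_naturality_left {A B C : D} {s : Fin (num A)} {t : Fin (num B)} {r : Fin (num C)}
    {f f' : pt A s ⟶ pt B t} (η : f ⟶ f') (g : pt B t ⟶ pt C r) :
    (map s r).map (η ▷ g) ≫ (mapComp f' g).hom =
      (mapComp f g).hom ≫ (map s t).map η ▷ (map t r).obj g
  mapComp_naturality_right {A B C : D} {s : Fin (num A)} {t : Fin (num B)} {r : Fin (num C)}
    (f : pt A s ⟶ pt B t) {g g' : pt B t ⟶ pt C r} (η : g ⟶ g') :
    (map s r).map (f ◁ η) ≫ (mapComp f g').hom =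
      (mapComp f g).hom ≫ (map s t).obj f ◁ (map t r).map η
  map_associator {A B C C' : D} {s : Fin (num A)} {t : Fin (num B)} {r : Fin (num C)}
    {q : Fin (num C')} (f : pt A s ⟶ pt B t) (g : pt B t ⟶ pt C r) (h : pt C r ⟶ pt C' q) :
    (map s q).map (α_ f g h).hom ≫ (mapComp f (g ≫ h)).hom ≫
        (map s t).obj f ◁ (mapComp g h).hom =
      (mapComp (f ≫ g) h).hom ≫ (mapComp f g).hom ▷ (map r q).obj h ≫
        (α_ ((map s t).obj f) ((map t r).obj g) ((map r q).obj h)).hom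
  map_leftUnitor {A B : D} {s : Fin (num A)} {t : Fin (num B)} (f : pt A s ⟶ pt B t) :
    (map s t).map (λ_ f).hom =
      (mapComp (𝟙 _) f).hom ≫ ι s ▷ (map s t).obj f ≫ (λ_ ((map s t).obj f)).hom
  map_rightUnitor {A B : D} {s : Fin (num A)} {t : Fin (num B)} (f : pt A s ⟶ pt B t) :
    (map s t).map (ρ_ f).hom =
      (mapComp f (𝟙 _)).hom ≫ (map s t).obj f ◁ ι t ≫ (ρ_ ((map s t).obj f)).hom
  /-- the 1-identity of `A` is the direct sum of the 1-identities of the `pt A s` -/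
  isColimit (A : D) :
    Nonempty (IsColimit (Cofan.mk (𝟙 A) fun s : Fin (num A) => ι s))
  mem_essImage {A B : D} (s : Fin (num A)) (t : Fin (num B)) (V : A ⟶ B) :
    IsIso (ι s ▷ V ≫ (λ_ V).hom) → IsIso (V ◁ ι t ≫ (ρ_ V).hom) → (map s t).essImage V

/-- `D` is a folded form of `E`. -/
def IsFoldedForm (k : Type*) [Field k]
    (D : Type*) [Bicategory D] [PreadditiveBicategory D] [LinearBicategory k D]
    (E : Type*) [Bicategory E] [PreadditiveBicategory E] [LinearBicategory k E] : Prop :=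
  Nonempty (Folding k E D)

end

/-!
The ground field `k` is the center of `C`: the families of endomorphisms `z a` of the 1-identities
that act on every 1-morphism `V : a ⟶ b` in the same way from the left and from the right. A
central element that is nonzero at one simple summand of a 1-identity is nonzero at all linked
ones, so that connectedness makes the center a field (`bicategoryCenter.isField`).

*Finiteness.* By rigidity, `Hom(V, W)` is finitely generated over `End(𝟙 a)`, as it is
`Hom(𝟙 a, W ⊗ V*)`. It remains to bound `End(𝟙 b)` over `k`. The key is an independence theorem in
the style of Artin (`IsUnitRelation.comp_eq_zero`): if `x s ∈ End(𝟙 b)` are linearly independent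
over `k`, then no `∑ c s ⊗ x s ≠ 0` in `End(𝟙 d) ⊗ End(𝟙 b)` acts as zero on all 1-morphisms from
`d` to `b`. The coefficients of a normalized shortest relation are unique, can be transported along
links by means of duals, and hence glue to central elements, that is, to scalars. The tensor
product therefore acts faithfully on the finitely many simple 1-morphisms. This bounds the size of
a linearly independent family, and as the endomorphism rings of simple objects are division rings,
it also shows that `End(𝟙 b) ⊗ End(𝟙 b)` is reduced, so that `End(𝟙 b)` is unramified over `k`
(`formallyUnramified_unit_end`).

*Semisimplicity of the base change.* Among the finite-dimensional idempotent complete additive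
categories, the semisimple ones are those that are von Neumann regular: every morphism `f` admits
a `g` with `f ≫ g ≫ f = f`. For a separable extension `K / k` and a semisimple ring `R`, the ring
`K ⊗ R` is again von Neumann regular, because `R`-linear projections can be averaged with a
separability idempotent; the idempotent completion keeps the property.

*Folding.* Given decompositions of the 1-identities of a 2-category into summands, the
2-category whose objects are these summands, and whose 1-morphisms are those fixed by the two
projections, has the given one as a folded form (`UnitDecomposition.Unfolding.folding`). For
`K = k_s` and simple summands `S`, the unramified `K`-algebra `K ⊗ End(𝟙 a)` maps onto the division
ring `End(S)`, which is thus a separable extension of `K`, hence equal to `K`.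

*Strong semisimplicity.* A simple 1-morphism `V` of `k_s ⊗ C` is a direct summand of some simple
`X` of `C`. A central endomorphism of `V` extends to a central one of `X`, which lies in
`k_s ⊗ Z(End X)`. If `Z(End X)` is separable over `k`, this acts on `V` by scalars, so that `End(V)`
is a central division algebra over `k_s`; by the Jacobson–Noether theorem it equals `k_s`.
-/

/-! ### Von Neumann regular categories -/

section Regular

/-- A category is von Neumann regular if every morphism `f` has a quasi-inverse: a morphism `g`
in the opposite direction with `f ≫ g ≫ f = f`. -/
def IsRegularCategory (A : Type*) [Category A] : Prop :=
  ∀ ⦃X Y : A⦄ (f : X ⟶ Y), ∃ g : Y ⟶ X, f ≫ g ≫ f = f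

/-- `X` is a direct sum of finitely many simple objects. In contrast to a bicone, the
orthogonality relations are stated without transport along equalities of indices. -/
def IsFiniteSumOfSimples {A : Type*} [Category A] [Preadditive A] (X : A) : Prop :=
  ∃ (J : Type) (_ : Fintype J) (S : J → A) (i : ∀ j, S j ⟶ X) (r : ∀ j, X ⟶ S j),
    (∀ j, Simple (S j)) ∧ (∀ j, i j ≫ r j = 𝟙 (S j)) ∧ (∀ j l, j ≠ l → i j ≫ r l = 0) ∧
      ∑ j, r j ≫ i j = 𝟙 X

variable {A : Type*} [Category A]

namespace IsRegularCategory

theorem exists_retraction (h : IsRegularCategory A) {X Y : A} (f : X ⟶ Y) [Mono f] :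
    ∃ g : Y ⟶ X, f ≫ g = 𝟙 X := by
  obtain ⟨g, hg⟩ := h f
  exact ⟨g, by rw [← cancel_mono f]; simpa using hg⟩

theorem exists_section (h : IsRegularCategory A) {X Y : A} (f : X ⟶ Y) [Epi f] :
    ∃ g : Y ⟶ X, g ≫ f = 𝟙 Y := by
  obtain ⟨g, hg⟩ := h f
  exact ⟨g, by rw [← cancel_epi f]; simpa using hg⟩

variable [Preadditive A]

theorem eq_zero_of_comp_eq_zero (h : IsRegularCategory A) {X Y : A} (f : X ⟶ Y)
    (hf : ∀ g : Y ⟶ X, f ≫ g = 0) : f = 0 := by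
  obtain ⟨g, hg⟩ := h f
  rw [← hg, ← Category.assoc, hf, zero_comp]

/-- An object whose nonzero endomorphisms are all invertible is simple in a von Neumann regular
category, because every subobject is a direct summand. -/
theorem simple_of_isIso (h : IsRegularCategory A) {X : A} (hX : 𝟙 X ≠ 0)
    (hf : ∀ f : X ⟶ X, f ≠ 0 → IsIso f) : Simple X where
  mono_isIso_iff_nonzero {Y} f _ := by
    obtain ⟨g, hg⟩ := h.exists_retraction f
    constructor
    · intro _ h0
      apply hX
      rw [← cancel_epi f, h0, zero_comp, zero_comp]
    · intro h0
      have hgf : g ≫ f ≠ 0 := fun h1 => h0 <| by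
        rw [← Category.id_comp f, ← hg, Category.assoc, h1, comp_zero]
      have := hf _ hgf
      have h2 : g ≫ f = 𝟙 X := by
        rw [← cancel_epi (g ≫ f)]
        simp [reassoc_of% hg]
      exact ⟨g, hg, h2⟩

end IsRegularCategory

/-! ### Semisimple categories are von Neumann regular -/

namespace IsFiniteSumOfSimples

/-- Splitting a monomorphism `f : Y ⟶ X` into an extension of a simple object `S` by `X'`, where
monomorphisms into `X'` split: either `Y` lies in `X'`, or `Y` is an extension of `S` by the
intersection of `Y` and `X'`. -/
theorem exists_retraction_of_extension {A : Type*} [Category A] [Abelian A] {X X' S Y : A}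
    [Simple S] (i : X' ⟶ X) (r : X ⟶ X') (j : S ⟶ X) (p : X ⟶ S)
    (htot : r ≫ i + p ≫ j = 𝟙 X)
    (hX' : ∀ {Z : A} (g : Z ⟶ X') [Mono g], ∃ q, g ≫ q = 𝟙 Z) (f : Y ⟶ X) [Mono f] :
    ∃ q, f ≫ q = 𝟙 Y := by
  by_cases hg : f ≫ p = 0
  · have hf : f = (f ≫ r) ≫ i := by
      conv_lhs => rw [← Category.comp_id f, ← htot, Preadditive.comp_add, reassoc_of% hg,
        zero_comp, add_zero, ← Category.assoc]
    have : Mono (f ≫ r) := by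
      have : Mono ((f ≫ r) ≫ i) := hf ▸ inferInstance
      exact mono_of_mono (f ≫ r) i
    obtain ⟨q, hq⟩ := hX' (f ≫ r)
    exact ⟨r ≫ q, by rw [← Category.assoc, hq]⟩
  · have : Epi (f ≫ p) := epi_of_nonzero_to_simple hg
    have hκ : kernel.ι (f ≫ p) ≫ f = (kernel.ι (f ≫ p) ≫ f ≫ r) ≫ i := by
      have h0 := kernel.condition (f ≫ p)
      rw [← Category.comp_id (kernel.ι (f ≫ p) ≫ f), ← htot]
      simp only [Preadditive.comp_add, Category.assoc]
      rw [reassoc_of% h0, zero_comp, add_zero]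
    have : Mono (kernel.ι (f ≫ p) ≫ f ≫ r) := by
      have : Mono ((kernel.ι (f ≫ p) ≫ f ≫ r) ≫ i) := hκ ▸ inferInstance
      exact mono_of_mono _ i
    obtain ⟨q, hq⟩ := hX' (kernel.ι (f ≫ p) ≫ f ≫ r)
    simp only [Category.assoc] at hq
    -- `Y` is the direct sum of the intersection with `X'` and a copy of `S`
    let φ : Y ⟶ kernel (f ≫ p) ⊞ S := biprod.lift (f ≫ r ≫ q) (f ≫ p)
    have hφ : kernel.ι (f ≫ p) ≫ φ = biprod.inl := by
      apply biprod.hom_ext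
      · simp [φ, hq]
      · simp [φ]
    have : Mono φ := by
      refine Preadditive.mono_of_cancel_zero _ fun t ht => ?_
      have h1 : t ≫ f ≫ p = 0 := by simpa [φ] using ht =≫ biprod.snd
      have h2 : t = kernel.lift _ t h1 ≫ kernel.ι (f ≫ p) := (kernel.lift_ι _ _ _).symm
      have h3 : kernel.lift _ t h1 ≫ biprod.inl (Y := S) = 0 := by
        rw [← hφ, ← Category.assoc, kernel.lift_ι, ht]
      have h4 : kernel.lift _ t h1 = 0 := by
        simpa using h3 =≫ biprod.fst
      rw [h2, h4, zero_comp]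
    have : Epi φ := by
      refine Preadditive.epi_of_cancel_zero _ fun t ht => ?_
      have h1 : biprod.inl ≫ t = 0 := by rw [← hφ, Category.assoc, ht, comp_zero]
      have h2 : (f ≫ p) ≫ biprod.inr ≫ t = 0 := by
        have h3 : t = biprod.snd ≫ biprod.inr ≫ t := by
          conv_lhs => rw [← Category.id_comp t, ← biprod.total]
          rw [Preadditive.add_comp, Category.assoc, h1, comp_zero, zero_add, Category.assoc]
        rw [h3] at ht
        simpa [φ] using ht
      have h3 : biprod.inr ≫ t = 0 := zero_of_epi_comp _ h2
      apply biprod.hom_ext'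
      · simpa using h1
      · simpa using h3
    have : IsIso φ := isIso_of_mono_of_epi φ
    refine ⟨biprod.lift (r ≫ q) p ≫ inv φ, ?_⟩
    have h5 : f ≫ biprod.lift (r ≫ q) p = φ := by
      apply biprod.hom_ext <;> simp [φ]
    rw [← Category.assoc, h5, IsIso.hom_inv_id]

/-- Monomorphisms into a finite direct sum of simple objects split, by induction on the number of
summands. -/
theorem exists_retraction {A : Type*} [Category A] [Abelian A] {X Y : A}
    (hX : IsFiniteSumOfSimples X) (f : Y ⟶ X) [Mono f] : ∃ q, f ≫ q = 𝟙 Y := by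
  classical
  obtain ⟨J, _, S, i, r, hS, hir, hir', htot⟩ := hX
  -- partial sums, over finite sets `T` of indices
  suffices H : ∀ (T : Finset J) (X' : A) (a : ∀ j, S j ⟶ X') (b : ∀ j, X' ⟶ S j),
      (∀ j ∈ T, a j ≫ b j = 𝟙 (S j)) → (∀ j ∈ T, ∀ l ∈ T, j ≠ l → a j ≫ b l = 0) →
      ∑ j ∈ T, b j ≫ a j = 𝟙 X' → ∀ {Y : A} (f : Y ⟶ X') [Mono f], ∃ q, f ≫ q = 𝟙 Y from
    H Finset.univ X i r (fun j _ => hir j) (fun j _ l _ => hir' j l) htot f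
  intro T
  induction T using Finset.induction_on with
  | empty =>
    intro X' a b _ _ h0 Y f _
    have h0 : 𝟙 X' = 0 := by simpa using h0.symm
    have hf : f = 0 := by rw [← Category.comp_id f, h0, comp_zero]
    exact ⟨0, by rw [← cancel_mono f, hf]; simp⟩
  | insert t T ht ih =>
    intro X' a b hab hab' htot Y f _
    rw [Finset.sum_insert ht] at htot
    have htt : a t ≫ b t = 𝟙 _ := hab t (Finset.mem_insert_self _ _)
    have hidem : (∑ j ∈ T, b j ≫ a j) = 𝟙 X' - b t ≫ a t := by rw [← htot]; abel
    have hat : ∀ j ∈ T, a t ≫ b j = 0 := fun j hj =>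
      hab' t (Finset.mem_insert_self _ _) j (Finset.mem_insert_of_mem hj)
        (fun h => ht (h ▸ hj))
    have hbt : ∀ j ∈ T, a j ≫ b t = 0 := fun j hj =>
      hab' j (Finset.mem_insert_of_mem hj) t (Finset.mem_insert_self _ _)
        (fun h => ht (h ▸ hj))
    let κ := kernel.ι (b t)
    let ρ : X' ⟶ kernel (b t) := kernel.lift (b t) (𝟙 X' - b t ≫ a t) (by simp [htt])
    have hρ : ρ ≫ κ = 𝟙 X' - b t ≫ a t := kernel.lift_ι _ _ _
    have hκρ : κ ≫ ρ = 𝟙 _ := by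
      have h0 : κ ≫ b t = 0 := kernel.condition _
      rw [← cancel_mono (kernel.ι (b t))]
      change (κ ≫ ρ) ≫ κ = 𝟙 _ ≫ κ
      rw [Category.assoc, hρ, Preadditive.comp_sub, reassoc_of% h0, zero_comp]
      simp
    have hS' := hS t
    have haκ : ∀ j ∈ T, a j ≫ ρ ≫ κ = a j := fun j hj => by
      rw [hρ, Preadditive.comp_sub, reassoc_of% (hbt j hj), zero_comp]
      simp
    refine exists_retraction_of_extension κ ρ (a t) (b t)
      (by rw [hρ]; abel) (fun g _ => ?_) f
    refine ih _ (fun j => a j ≫ ρ) (fun j => κ ≫ b j) (fun j hj => ?_) (fun j hj l hl hjl => ?_)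
      ?_ g
    · rw [Category.assoc, ← Category.assoc ρ, ← Category.assoc, haκ j hj,
        hab j (Finset.mem_insert_of_mem hj)]
    · rw [Category.assoc, ← Category.assoc ρ, ← Category.assoc, haκ j hj,
        hab' j (Finset.mem_insert_of_mem hj) l (Finset.mem_insert_of_mem hl) hjl]
    · have h1 : ∑ j ∈ T, (κ ≫ b j) ≫ a j ≫ ρ = κ ≫ (∑ j ∈ T, b j ≫ a j) ≫ ρ := by
        simp [Preadditive.comp_sum, Preadditive.sum_comp]
      rw [h1, hidem, ← hρ, Category.assoc, hκρ, Category.comp_id, hκρ]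

end IsFiniteSumOfSimples

namespace IsSemisimpleCategory

variable [Preadditive A]

theorem isFiniteSumOfSimples (h : IsSemisimpleCategory A) (X : A) : IsFiniteSumOfSimples X := by
  obtain ⟨n, S, b, hS, ⟨hb⟩, ⟨e⟩⟩ := h.exists_decomposition X
  refine ⟨Fin n, inferInstance, S, fun j => b.ι j ≫ e.hom, fun j => e.inv ≫ b.π j, hS,
    fun j => by simp, fun j l hjl => by simp [b.ι_π, hjl], ?_⟩
  have h1 : ∑ j, (e.inv ≫ b.π j) ≫ b.ι j ≫ e.hom = e.inv ≫ (∑ j, b.π j ≫ b.ι j) ≫ e.hom := by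
    simp [Preadditive.comp_sum, Preadditive.sum_comp]
  rw [h1, IsBilimit.total hb]
  simp

theorem isRegularCategory (h : IsSemisimpleCategory A) : IsRegularCategory A := by
  obtain ⟨hab, rfl⟩ := h.abelian
  have key : ∀ {X Y : A} (f : X ⟶ Y) [Mono f], ∃ g : Y ⟶ X, f ≫ g = 𝟙 X := fun {_ Y} f _ =>
    (h.isFiniteSumOfSimples Y).exists_retraction f
  intro X Y f
  -- the image factorization `f = e ≫ m`; `e` splits because its kernel does
  obtain ⟨m', hm'⟩ := key (image.ι f)
  let e := factorThruImage f
  obtain ⟨q, hq⟩ := key (kernel.ι e)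
  have hc : kernel.ι e ≫ (𝟙 X - q ≫ kernel.ι e) = 0 := by
    rw [Preadditive.comp_sub, reassoc_of% hq]
    simp
  obtain ⟨s, hs⟩ : ∃ s, e ≫ s = 𝟙 X - q ≫ kernel.ι e :=
    ⟨_, (Abelian.epiIsCokernelOfKernel (KernelFork.ofι _ (kernel.condition e))
      (kernelIsKernel e)).fac (CokernelCofork.ofπ _ hc) WalkingParallelPair.one⟩
  refine ⟨m' ≫ s, ?_⟩
  have hfe : e ≫ image.ι f = f := image.fac f
  have hse : e ≫ s ≫ e = e := by
    rw [← Category.assoc, hs]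
    simp
  calc f ≫ (m' ≫ s) ≫ f = (e ≫ image.ι f) ≫ (m' ≫ s) ≫ e ≫ image.ι f := by rw [hfe]
    _ = (e ≫ s ≫ e) ≫ image.ι f := by simp only [Category.assoc, reassoc_of% hm']
    _ = f := by rw [hse, hfe]

theorem hasKernels (h : IsSemisimpleCategory A) : HasKernels A := by
  obtain ⟨hab, rfl⟩ := h.abelian
  infer_instance

theorem hasFiniteBiproducts (h : IsSemisimpleCategory A) : HasFiniteBiproducts A := by
  obtain ⟨hab, rfl⟩ := h.abelian
  exact HasFiniteBiproducts.of_hasFiniteProducts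

end IsSemisimpleCategory

/-! ### A criterion for semisimplicity -/

theorem IsFiniteSumOfSimples.exists_bicone [Preadditive A] {X : A} (h : IsFiniteSumOfSimples X) :
    ∃ (n : ℕ) (S : Fin n → A) (b : Bicone S),
      (∀ i, Simple (S i)) ∧ Nonempty b.IsBilimit ∧ Nonempty (b.pt ≅ X) := by
  obtain ⟨J, _, S, i, r, hS, hir, hir', htot⟩ := h
  let e := (Fintype.equivFin J).symm
  refine ⟨Fintype.card J, fun j => S (e j), ⟨X, fun j => r (e j), fun j => i (e j), ?_⟩,
    fun j => hS _, ⟨isBilimitOfTotal _ ?_⟩, ⟨Iso.refl _⟩⟩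
  · intro j l
    split_ifs with hjl
    · subst hjl
      simp [hir]
    · exact hir' _ _ fun h => hjl (e.injective h)
  · rw [← htot]
    exact Fintype.sum_equiv e _ _ fun _ => rfl

namespace IsRegularCategory

variable [Preadditive A]

theorem hasKernels [IsIdempotentComplete A] (h : IsRegularCategory A) : HasKernels A where
  has_limit {X Y} f := by
    obtain ⟨g, hg⟩ := h f
    obtain ⟨K, i, e, hie, hei⟩ := IsIdempotentComplete.idempotents_split X (𝟙 X - f ≫ g)
      (by simp [reassoc_of% hg])
    have hif : i ≫ f = 0 := by
      have h1 : i = i ≫ (𝟙 X - f ≫ g) := by rw [← hei, reassoc_of% hie]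
      rw [h1]
      simp [hg]
    refine HasLimit.mk ⟨_, KernelFork.IsLimit.ofι i hif (fun t _ => t ≫ e) (fun t ht => ?_)
      fun t ht m hm => ?_⟩
    · rw [Category.assoc, hei, Preadditive.comp_sub, reassoc_of% ht]
      simp
    · rw [← hm, Category.assoc, hie, Category.comp_id]

theorem hasCokernels [IsIdempotentComplete A] (h : IsRegularCategory A) : HasCokernels A where
  has_colimit {X Y} f := by
    obtain ⟨g, hg⟩ := h f
    obtain ⟨K, i, e, hie, hei⟩ := IsIdempotentComplete.idempotents_split Y (𝟙 Y - g ≫ f)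
      (by simp [hg])
    have hfe : f ≫ e = 0 := by
      have h1 : e = (𝟙 Y - g ≫ f) ≫ e := by rw [← hei, Category.assoc, hie, Category.comp_id]
      rw [h1]
      simp [reassoc_of% hg]
    refine HasColimit.mk ⟨_, CokernelCofork.IsColimit.ofπ e hfe (fun t _ => i ≫ t)
      (fun t ht => ?_) fun t ht m hm => ?_⟩
    · rw [← Category.assoc, hei, Preadditive.sub_comp, Category.assoc, ht]
      simp
    · rw [← hm, ← Category.assoc, hie, Category.id_comp]

theorem isNormalMonoCategory (h : IsRegularCategory A) : IsNormalMonoCategory A where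
  normalMonoOfMono {X Y} f _ := by
    obtain ⟨g, hg⟩ := h.exists_retraction f
    refine ⟨⟨Y, 𝟙 Y - g ≫ f, by simp [reassoc_of% hg],
      KernelFork.IsLimit.ofι f _ (fun t _ => t ≫ g) (fun t ht => ?_) fun t ht m hm => ?_⟩⟩
    · rw [Preadditive.comp_sub, sub_eq_zero] at ht
      simpa using ht.symm
    · rw [← hm, Category.assoc, hg, Category.comp_id]

theorem isNormalEpiCategory (h : IsRegularCategory A) : IsNormalEpiCategory A where
  normalEpiOfEpi {X Y} f _ := by
    obtain ⟨g, hg⟩ := h.exists_section f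
    refine ⟨⟨X, 𝟙 X - f ≫ g, by simp [hg],
      CokernelCofork.IsColimit.ofπ f _ (fun t _ => g ≫ t) (fun t ht => ?_) fun t ht m hm => ?_⟩⟩
    · rw [Preadditive.sub_comp, sub_eq_zero] at ht
      simpa using ht.symm
    · rw [← hm, ← Category.assoc, hg, Category.id_comp]

theorem isSemisimpleCategory [IsIdempotentComplete A] (h : IsRegularCategory A)
    [HasFiniteBiproducts A] (hdec : ∀ X : A, IsFiniteSumOfSimples X) : IsSemisimpleCategory A where
  abelian := by
    have := h.hasKernels
    have := h.hasCokernels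
    have := h.isNormalMonoCategory
    have := h.isNormalEpiCategory
    exact ⟨Abelian.mk, rfl⟩
  exists_decomposition X := (hdec X).exists_bicone

/-- In a regular idempotent complete linear category an object whose endomorphism algebra is
finite-dimensional is a finite direct sum of simple objects: an object that is not simple splits
into two parts with smaller endomorphism algebras. -/
theorem isFiniteSumOfSimples [IsIdempotentComplete A] (h : IsRegularCategory A) (K : Type*)
    [Field K] [Linear K A] (X : A) (hX : ∀ Y : A, Module.Finite K (Y ⟶ Y)) :
    IsFiniteSumOfSimples X := by
  induction hn : Module.finrank K (X ⟶ X) using Nat.strong_induction_on generalizing X with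
  | _ n ih =>
    by_cases h0 : 𝟙 X = 0
    · exact ⟨PEmpty, inferInstance, PEmpty.elim, fun j => j.elim, fun j => j.elim,
        fun j => j.elim, fun j => j.elim, fun j => j.elim, by simp [h0]⟩
    by_cases hs : ∀ f : X ⟶ X, f ≠ 0 → IsIso f
    · have := h.simple_of_isIso h0 hs
      exact ⟨Unit, inferInstance, fun _ => X, fun _ => 𝟙 X, fun _ => 𝟙 X, fun _ => this,
        by simp, by simp, by simp⟩
    push Not at hs
    obtain ⟨f, hf, hiso⟩ := hs
    obtain ⟨g, hg⟩ := h f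
    -- `f ≫ g` or `g ≫ f` is a nontrivial idempotent
    obtain ⟨p, hp, hp0, hp1⟩ : ∃ p : X ⟶ X, p ≫ p = p ∧ p ≠ 0 ∧ p ≠ 𝟙 X := by
      by_cases hfg : f ≫ g = 𝟙 X
      · refine ⟨g ≫ f, by simp [hg], fun h1 => hf ?_, fun h1 => hiso ⟨g, hfg, h1⟩⟩
        rw [← hg, h1, comp_zero]
      · refine ⟨f ≫ g, by simp [reassoc_of% hg], fun h1 => hf ?_, hfg⟩
        rw [← hg, ← Category.assoc, h1, zero_comp]
    obtain ⟨Y, i, e, hie, hei⟩ := IsIdempotentComplete.idempotents_split X p hp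
    obtain ⟨Z, i', e', hie', hei'⟩ := IsIdempotentComplete.idempotents_split X (𝟙 X - p)
      (by simp [hp])
    have hpi' : i' ≫ p = 0 := by
      have h1 : i' = i' ≫ (𝟙 X - p) := by rw [← hei', reassoc_of% hie']
      rw [h1]; simp [hp]
    have hpi : i ≫ p = i := by rw [← hei, reassoc_of% hie]
    have hpe : p ≫ e = e := by rw [← hei, Category.assoc, hie, Category.comp_id]
    have hpe' : p ≫ e' = 0 := by
      have h1 : e' = (𝟙 X - p) ≫ e' := by rw [← hei', Category.assoc, hie', Category.comp_id]
      rw [h1]; simp [reassoc_of% hp]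
    have hie1 : i ≫ e' = 0 := by rw [← hpi, Category.assoc, hpe', comp_zero]
    have hie2 : i' ≫ e = 0 := by rw [← hpe, reassoc_of% hpi', zero_comp]
    have hY0 : 𝟙 Y ≠ 0 := fun h1 => hp0 <| by
      rw [← hei, ← Category.id_comp i, h1, zero_comp, comp_zero]
    have hZ0 : 𝟙 Z ≠ 0 := fun h1 => hp1 <| by
      rw [eq_comm, ← sub_eq_zero, ← hei', ← Category.id_comp i', h1, zero_comp, comp_zero]
    -- the endomorphism algebras of the two parts embed jointly
    let φ : ((Y ⟶ Y) × (Z ⟶ Z)) →ₗ[K] (X ⟶ X) :=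
      { toFun x := e ≫ x.1 ≫ i + e' ≫ x.2 ≫ i'
        map_add' x y := by simp; abel
        map_smul' c x := by simp }
    have hφ : Function.Injective φ := by
      rw [injective_iff_map_eq_zero]
      rintro ⟨x, y⟩ hxy
      replace hxy : e ≫ x ≫ i + e' ≫ y ≫ i' = 0 := hxy
      have hx := i ≫= hxy =≫ e
      have hy := i' ≫= hxy =≫ e'
      simp only [Preadditive.comp_add, Preadditive.add_comp, Category.assoc, hie, hie',
        reassoc_of% hie, reassoc_of% hie', reassoc_of% hie1, reassoc_of% hie2, zero_comp,
        comp_zero, Category.comp_id, add_zero, zero_add] at hx hy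
      rw [hx, hy]; rfl
    have := hX X
    have := hX Y
    have := hX Z
    have hle : Module.finrank K (Y ⟶ Y) + Module.finrank K (Z ⟶ Z) ≤ n := by
      rw [← Module.finrank_prod, ← hn]
      exact LinearMap.finrank_le_finrank_of_injective hφ
    have hYp : 0 < Module.finrank K (Y ⟶ Y) :=
      Module.finrank_pos_iff_exists_ne_zero.2 ⟨_, hY0⟩
    have hZp : 0 < Module.finrank K (Z ⟶ Z) :=
      Module.finrank_pos_iff_exists_ne_zero.2 ⟨_, hZ0⟩
    obtain ⟨J, _, S, a, r, hS, har, har', htot⟩ := ih _ (by omega) Y rfl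
    obtain ⟨J', _, S', a', r', hS', har1, har1', htot'⟩ := ih _ (by omega) Z rfl
    refine ⟨J ⊕ J', inferInstance, Sum.elim S S',
      Sum.rec (fun j => a j ≫ i) (fun j => a' j ≫ i'),
      Sum.rec (fun j => e ≫ r j) (fun j => e' ≫ r' j), Sum.rec hS hS', ?_, ?_, ?_⟩
    · rintro (j | j)
      · simp [reassoc_of% hie, har]
      · simp [reassoc_of% hie', har1]
    · rintro (j | j) (l | l) hjl
      · simp [reassoc_of% hie, har' j l (by simpa using hjl)]
        rfl
      · simp [reassoc_of% hie1]
        rfl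
      · simp [reassoc_of% hie2]
        rfl
      · simp [reassoc_of% hie', har1' j l (by simpa using hjl)]
        rfl
    · have h1 : ∑ j, (e ≫ r j) ≫ a j ≫ i = e ≫ (∑ j, r j ≫ a j) ≫ i := by
        simp [Preadditive.comp_sum, Preadditive.sum_comp]
      have h2 : ∑ j, (e' ≫ r' j) ≫ a' j ≫ i' = e' ≫ (∑ j, r' j ≫ a' j) ≫ i' := by
        simp [Preadditive.comp_sum, Preadditive.sum_comp]
      rw [Fintype.sum_sum_type]
      change ∑ j, (e ≫ r j) ≫ a j ≫ i + ∑ j, (e' ≫ r' j) ≫ a' j ≫ i' = _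
      rw [h1, h2, htot, htot', Category.id_comp, Category.id_comp, hei, hei']
      abel

end IsRegularCategory

end Regular

/-! ### Separable base change of semisimple rings and categories -/

section Ring

/-- An Artinian ring in which every element has a quasi-inverse is semisimple, as its Jacobson
radical vanishes. -/
theorem isSemisimpleRing_of_forall_exists_mul_mul_eq {R : Type*} [Ring R] [IsArtinianRing R]
    (h : ∀ x : R, ∃ y, x * y * x = x) : IsSemisimpleRing R := by
  rw [IsArtinianRing.isSemisimpleRing_iff_jacobson, eq_bot_iff]
  intro x hx
  obtain ⟨y, hy⟩ := h x
  rw [Ring.jacobson_eq_sInf_isMaximal] at hx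
  have hx' : x ∈ Ideal.jacobson (⊥ : Ideal R) := by
    rw [Ideal.jacobson_bot, Ring.jacobson_eq_sInf_isMaximal]
    exact hx
  obtain ⟨z, hz⟩ := Ideal.mem_jacobson_iff.1 hx' (-y)
  -- `z * (1 - y * x) = 1`, and `1 - y * x` kills `x` from the right
  have hz' : z * (1 - y * x) = 1 := by
    have : z * -y * x + z - 1 = 0 := by simpa using hz
    rw [mul_sub, mul_one, ← sub_eq_zero, ← this]
    noncomm_ring
  have h2 : y * x = 0 := by
    have h3 : (1 - y * x) * (y * x) = 0 := by
      rw [sub_mul, one_mul, mul_assoc, ← mul_assoc x, hy, sub_self]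
    rw [← one_mul (y * x), ← hz', mul_assoc, h3, mul_zero]
  have : x = 0 := by rw [← hy, mul_assoc, h2, mul_zero]
  simp [this]

variable {k F R : Type*} [Field k] [Field F] [Algebra k F] [Ring R] [Algebra k R]

/-- If `R` is semisimple and `F / k` is finite separable, then every `f : F ⊗ R` has a
quasi-inverse: an `R`-linear projection onto the left ideal generated by `f` becomes
`F ⊗ R`-linear when averaged with the separability idempotent of `F / k`. -/
theorem exists_mul_mul_eq_of_finite_isSeparable [IsSemisimpleRing R] [Module.Finite k F]
    [Algebra.IsSeparable k F] (f : F ⊗[k] R) : ∃ g, f * g * f = f := by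
  have hu : Algebra.FormallyUnramified k F := Algebra.FormallyUnramified.of_isSeparable k F
  let _ : Module R (F ⊗[k] R) :=
    Module.compHom _ (Algebra.TensorProduct.includeRight : R →ₐ[k] F ⊗[k] R).toRingHom
  have hsmul : ∀ (r : R) (s : F ⊗[k] R), r • s = (1 ⊗ₜ r) * s := fun _ _ => rfl
  have : IsScalarTower R (F ⊗[k] R) (F ⊗[k] R) := ⟨fun r s t => by
    rw [hsmul, hsmul, smul_eq_mul, smul_eq_mul, mul_assoc]⟩
  let N : Submodule R (F ⊗[k] R) := (Submodule.span (F ⊗[k] R) {f}).restrictScalars R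
  obtain ⟨N', hN'⟩ := exists_isCompl N
  let p : (F ⊗[k] R) →ₗ[R] (F ⊗[k] R) := N.subtype ∘ₗ N.projectionOnto N' hN'
  have hpN : ∀ s, p s ∈ N := fun s => (N.projectionOnto N' hN' s).2
  have hpf : ∀ s, p (s * f) = s * f := fun s => by
    have hs : s * f ∈ N := Submodule.smul_mem (Submodule.span (F ⊗[k] R) {f}) s
      (Submodule.mem_span_singleton_self f)
    exact congrArg Subtype.val (Submodule.projectionOnto_apply_left hN' ⟨_, hs⟩)
  have hpr : ∀ (r : R) s, p ((1 ⊗ₜ r) * s) = (1 ⊗ₜ r) * p s := fun r s => p.map_smul r s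
  have hpk : ∀ (a : k) s, p (a • s) = a • p s := fun a s => by
    have h1 : ∀ s : F ⊗[k] R, a • s = (1 ⊗ₜ algebraMap k R a) * s := fun s => by
      rw [← Algebra.TensorProduct.algebraMap_apply', Algebra.smul_def]
    rw [h1, h1, hpr]
  -- the averaged projection
  let Φ (s : F ⊗[k] R) : F ⊗[k] F →ₗ[k] F ⊗[k] R :=
    TensorProduct.lift (LinearMap.mk₂ k (fun x y => x • p (y • s))
      (fun x x' y => add_smul _ _ _) (fun a x y => smul_assoc _ _ _)
      (fun x y y' => by rw [add_smul, map_add, smul_add])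
      (fun a x y => by rw [smul_assoc, hpk, smul_comm]))
  have hΦ : ∀ s x y, Φ s (x ⊗ₜ y) = x • p (y • s) := fun s x y => rfl
  let e := Algebra.FormallyUnramified.elem k F
  have hΦadd : ∀ s s' t, Φ (s + s') t = Φ s t + Φ s' t := fun s s' t => by
    induction t using TensorProduct.induction_on with
    | zero => simp
    | tmul x y => simp [hΦ]
    | add x y hx hy => rw [map_add, hx, hy, map_add, map_add]; abel
  have hΦr : ∀ (r : R) s t, Φ ((1 ⊗ₜ r) * s) t = (1 ⊗ₜ r) * Φ s t := fun r s t => by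
    induction t using TensorProduct.induction_on with
    | zero => simp
    | tmul x y => rw [hΦ, hΦ, ← mul_smul_comm, hpr, mul_smul_comm]
    | add x y hx hy => rw [map_add, hx, hy, map_add, mul_add]
  have hΦ1 : ∀ (c : F) s t, Φ (c • s) t = Φ s ((1 ⊗ₜ c) * t) := fun c s t => by
    induction t using TensorProduct.induction_on with
    | zero => simp
    | tmul x y => simp [hΦ, smul_smul, mul_comm]
    | add x y hx hy => rw [map_add, hx, hy, mul_add, map_add]
  have hΦ2 : ∀ (c : F) s t, Φ s ((c ⊗ₜ 1) * t) = c • Φ s t := fun c s t => by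
    induction t using TensorProduct.induction_on with
    | zero => simp
    | tmul x y => simp [hΦ, smul_smul]
    | add x y hx hy => rw [mul_add, map_add, hx, hy, map_add, smul_add]
  have hlin : ∀ s : F ⊗[k] R, Φ s e = s * Φ 1 e := fun s => by
    induction s using TensorProduct.induction_on with
    | zero =>
      have := hΦadd 0 0 e
      rw [add_zero] at this
      rw [zero_mul]
      simpa using this
    | tmul c r =>
      have h1 : (c ⊗ₜ[k] r : F ⊗[k] R) = c • ((1 ⊗ₜ r) * 1) := by
        simp [TensorProduct.smul_tmul']
      rw [h1, hΦ1, Algebra.FormallyUnramified.one_tmul_mul_elem, hΦ2, hΦr, mul_one,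
        smul_mul_assoc]
    | add x y hx hy => rw [hΦadd, hx, hy, add_mul]
  have hΦf : Φ f e = f := by
    have h1 : ∀ t : F ⊗[k] F, Φ f t = Algebra.TensorProduct.lmul' k t • f := fun t => by
      induction t using TensorProduct.induction_on with
      | zero => simp
      | tmul x y =>
        have h2 : y • f = (y ⊗ₜ[k] (1 : R)) * f := by
          rw [← one_mul f, ← smul_mul_assoc, one_mul]
          congr 1
          rw [Algebra.TensorProduct.one_def, TensorProduct.smul_tmul', smul_eq_mul, mul_one]
        rw [hΦ, h2, hpf, ← h2, smul_smul, Algebra.TensorProduct.lmul'_apply_tmul]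
      | add x y hx hy => rw [map_add, hx, hy, map_add, add_smul]
    rw [h1, Algebra.FormallyUnramified.lmul_elem, one_smul]
  have hmem : Φ 1 e ∈ Submodule.span (F ⊗[k] R) {f} := by
    have h1 : ∀ t, Φ 1 t ∈ Submodule.span (F ⊗[k] R) {f} := fun t => by
      induction t using TensorProduct.induction_on with
      | zero => simp
      | tmul x y =>
        have h2 : x • p (y • 1) = (x ⊗ₜ[k] (1 : R)) • p (y • 1) := by
          rw [smul_eq_mul, ← one_mul (p _), ← smul_mul_assoc, one_mul]
          congr 1
          rw [Algebra.TensorProduct.one_def, TensorProduct.smul_tmul', smul_eq_mul, mul_one]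
        rw [hΦ, h2]
        exact Submodule.smul_mem _ _ (hpN _)
      | add x y hx hy => rw [map_add]; exact add_mem hx hy
    exact h1 e
  obtain ⟨g, hg⟩ := Submodule.mem_span_singleton.1 hmem
  refine ⟨g, ?_⟩
  rw [mul_assoc, ← smul_eq_mul g, hg, ← hlin, hΦf]

/-- The case of an arbitrary separable extension follows, since an element of the tensor product
lies in the tensor product with a finite subextension. -/
theorem exists_mul_mul_eq_of_isSeparable [IsSemisimpleRing R] [Algebra.IsSeparable k F]
    (f : F ⊗[k] R) : ∃ g, f * g * f = f := by
  obtain ⟨s, hs⟩ := TensorProduct.exists_finset f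
  let L : IntermediateField k F := IntermediateField.adjoin k (Prod.fst '' (s : Set (F × R)))
  have hL : Module.Finite k L :=
    have := (s.finite_toSet.image Prod.fst).to_subtype
    IntermediateField.finiteDimensional_adjoin fun x _ => Algebra.IsIntegral.isIntegral x
  have : Algebra.IsSeparable k L := inferInstance
  let φ : L ⊗[k] R →ₐ[k] F ⊗[k] R := Algebra.TensorProduct.map L.val (AlgHom.id k R)
  obtain ⟨f', hf'⟩ : ∃ f', φ f' = f := by
    refine ⟨∑ i : s, (⟨i.1.1, IntermediateField.subset_adjoin k _ ⟨_, i.2, rfl⟩⟩ : L) ⊗ₜ i.1.2, ?_⟩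
    rw [map_sum, hs, ← Finset.sum_coe_sort s]
    rfl
  obtain ⟨g, hg⟩ := exists_mul_mul_eq_of_finite_isSeparable f'
  exact ⟨φ g, by rw [← hf', ← map_mul, ← map_mul, hg]⟩

end Ring

namespace IsRegularCategory

theorem isSemisimpleRing_end {A : Type*} [Category A] [Preadditive A] (h : IsRegularCategory A)
    (k : Type*) [Field k] [Linear k A] (X : A) [hX : Module.Finite k (X ⟶ X)] :
    IsSemisimpleRing (End X) := by
  have : Module.Finite k (End X) := hX
  have : IsArtinianRing (End X) := IsArtinianRing.of_finite k (End X)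
  refine isSemisimpleRing_of_forall_exists_mul_mul_eq fun x => ?_
  obtain ⟨y, hy⟩ := h x
  exact ⟨y, hy⟩

end IsRegularCategory

namespace ScalarExtCategory

section
variable {k K : Type w} [CommRing k] [CommRing K] [Algebra k K]
variable {A : Type v} [Category.{w} A] [Preadditive A] [Linear k A]

/-- The composition of endomorphisms in `K ⊗ A` is the opposite of the multiplication of
`K ⊗ End X`, just as for `End X` itself. -/
theorem comp_eq_mul {X : A} (f g : K ⊗[k] End X) :
    ScalarExt.comp (X := X) (Y := X) (Z := X) f g = g * f := by
  induction f using TensorProduct.induction_on with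
  | zero => exact (LinearMap.map_zero₂ _ _).trans (mul_zero g).symm
  | add x y hx hy => exact (LinearMap.map_add₂ _ _ _ _).trans (by rw [hx, hy, mul_add])
  | tmul c f =>
    induction g using TensorProduct.induction_on with
    | zero => exact (map_zero _).trans (zero_mul (c ⊗ₜ[k] f : K ⊗[k] End X)).symm
    | add x y hx hy => exact (map_add _ _ _).trans (by rw [hx, hy, add_mul])
    | tmul d g =>
      rw [Algebra.TensorProduct.tmul_mul_tmul, mul_comm d c]
      rfl

variable (k K A) in
/-- The functor `f ↦ 1 ⊗ f` from `A` to `K ⊗ A`. -/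
noncomputable def baseChangeFunctor : A ⥤ ScalarExtCategory k K A where
  obj X := ⟨X⟩
  map f := (1 : K) ⊗ₜ[k] f
  map_id _ := rfl
  map_comp f g := ((ScalarExt.comp_tmul _ _ _ _).trans (by rw [mul_one])).symm

instance : (baseChangeFunctor k K A).Additive where
  map_add := TensorProduct.tmul_add _ _ _

instance [HasFiniteBiproducts A] : HasFiniteBiproducts (ScalarExtCategory k K A) where
  out n :=
    { has_biproduct f := by
        refine hasBiproduct_of_total
          ((baseChangeFunctor k K A).mapBicone (biproduct.bicone fun j => (f j).as)) ?_
        have h := congrArg (baseChangeFunctor k K A).map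
          (biproduct.total (f := fun j => (f j).as))
        rw [Functor.map_sum, CategoryTheory.Functor.map_id] at h
        simp only [Functor.map_comp] at h
        exact h }

instance (X Y : ScalarExtCategory k K A) [h : Module.Finite k (X.as ⟶ Y.as)] :
    Module.Finite K (X ⟶ Y) :=
  inferInstanceAs (Module.Finite K (K ⊗[k] (X.as ⟶ Y.as)))

end

variable {k K : Type w} [Field k] [Field K] [Algebra k K]
variable {A : Type v} [Category.{w} A] [Preadditive A] [Linear k A]

theorem isRegularCategory [Algebra.IsSeparable k K] [HasFiniteBiproducts A]
    (h : IsRegularCategory A) (hfin : ∀ X Y : A, Module.Finite k (X ⟶ Y)) :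
    IsRegularCategory (ScalarExtCategory k K A) := by
  intro X Y f
  have : HasBinaryBiproducts A := hasBinaryBiproducts_of_finite_biproducts A
  let Z : A := X.as ⊞ Y.as
  have hZ : IsSemisimpleRing (End Z) := by
    have := hfin Z Z
    exact h.isSemisimpleRing_end k Z
  let Z' : ScalarExtCategory k K A := ⟨Z⟩
  let F := baseChangeFunctor k K A
  let i : X ⟶ Z' := F.map (biprod.inl : X.as ⟶ Z)
  let r : Z' ⟶ X := F.map (biprod.fst : Z ⟶ X.as)
  let j : Y ⟶ Z' := F.map (biprod.inr : Y.as ⟶ Z)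
  let s : Z' ⟶ Y := F.map (biprod.snd : Z ⟶ Y.as)
  have hir : i ≫ r = 𝟙 X := (F.map_comp _ _).symm.trans (by simp only [biprod.inl_fst, Z]; rfl)
  have hjs : j ≫ s = 𝟙 Y := (F.map_comp _ _).symm.trans (by simp only [biprod.inr_snd, Z]; rfl)
  -- a quasi-inverse of the endomorphism of `X ⊕ Y` given by `f`
  obtain ⟨g, hg⟩ := exists_mul_mul_eq_of_isSeparable (k := k) (F := K) (R := End Z) (r ≫ f ≫ j)
  have hg' : (r ≫ f ≫ j) ≫ (show Z' ⟶ Z' from g) ≫ (r ≫ f ≫ j) = r ≫ f ≫ j := by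
    conv_rhs => rw [← hg]
    rw [mul_assoc, ← comp_eq_mul, ← comp_eq_mul]
    exact (Category.assoc _ _ _).symm
  refine ⟨j ≫ (show Z' ⟶ Z' from g) ≫ r, ?_⟩
  have h1 := i ≫= hg' =≫ s
  simpa [reassoc_of% hir, hjs] using h1

end ScalarExtCategory

namespace Karoubi

variable {A : Type*} [Category A]

theorem isRegularCategory (h : IsRegularCategory A) : IsRegularCategory (Karoubi A) := by
  intro P Q f
  obtain ⟨g, hg⟩ := h f.f
  refine ⟨⟨Q.p ≫ g ≫ P.p, by simp⟩, ?_⟩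
  ext
  simp [hg]

instance [Preadditive A] {K : Type*} [Field K] [Linear K A] (P Q : Karoubi A)
    [Module.Finite K (P.X ⟶ Q.X)] : Module.Finite K (P ⟶ Q) :=
  Module.Finite.of_injective
    ({ toFun f := f.f, map_add' _ _ := rfl, map_smul' _ _ := rfl } : (P ⟶ Q) →ₗ[K] (P.X ⟶ Q.X))
    fun _ _ hfg => Karoubi.hom_ext _ _ hfg

end Karoubi

section BaseChange

variable {k K : Type w} [Field k] [Field K] [Algebra k K]
variable {C : Type u} [Bicategory.{w, v} C] [PreadditiveBicategory C] [LinearBicategory k C]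

theorem IsSemisimpleBicategory.isRegularCategory_baseChange [Algebra.IsSeparable k K]
    (h : IsSemisimpleBicategory C)
    (hfin : ∀ (a b : C) (V W : a ⟶ b), Module.Finite k (V ⟶ W)) (a b : BaseChange k K C) :
    IsRegularCategory (a ⟶ b) :=
  have := (h a.as.as b.as.as).hasFiniteBiproducts
  Karoubi.isRegularCategory (ScalarExtCategory.isRegularCategory (k := k) (K := K)
    (h a.as.as b.as.as).isRegularCategory (hfin _ _))

theorem BaseChange.finite_hom
    (hfin : ∀ (a b : C) (V W : a ⟶ b), Module.Finite k (V ⟶ W)) {a b : BaseChange k K C}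
    (V W : a ⟶ b) : Module.Finite K (V ⟶ W) :=
  have := hfin _ _ V.X.as W.X.as
  have : Module.Finite K (V.X ⟶ W.X) := inferInstanceAs (Module.Finite K
    ((⟨V.X.as⟩ : ScalarExtCategory k K (a.as.as ⟶ b.as.as)) ⟶ ⟨W.X.as⟩))
  inferInstanceAs (Module.Finite K ((show Karoubi (a.as ⟶ b.as) from V) ⟶ W))

theorem BaseChange.isIdempotentComplete (a b : BaseChange k K C) : IsIdempotentComplete (a ⟶ b) :=
  inferInstanceAs (IsIdempotentComplete (Karoubi (a.as ⟶ b.as)))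

theorem IsSemisimpleBicategory.baseChange [Algebra.IsSeparable k K] (h : IsSemisimpleBicategory C)
    (hfin : ∀ (a b : C) (V W : a ⟶ b), Module.Finite k (V ⟶ W)) :
    IsSemisimpleBicategory (BaseChange k K C) := fun a b =>
  have hr := h.isRegularCategory_baseChange (K := K) hfin a b
  have := BaseChange.isIdempotentComplete a b
  have := (h a.as.as b.as.as).hasFiniteBiproducts
  have : HasFiniteBiproducts (a.as ⟶ b.as) :=
    inferInstanceAs (HasFiniteBiproducts (ScalarExtCategory k K (a.as.as ⟶ b.as.as)))
  have : HasFiniteBiproducts (a ⟶ b) :=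
    inferInstanceAs (HasFiniteBiproducts (Karoubi (a.as ⟶ b.as)))
  hr.isSemisimpleCategory fun X => hr.isFiniteSumOfSimples K X fun Y =>
    BaseChange.finite_hom hfin Y Y

end BaseChange

/-! ### The actions of the endomorphisms of 1-identities -/

section UnitAction

variable {C : Type u} [Bicategory.{w, v} C]

/-- The action of an endomorphism `z` of the 1-identity of `a` on a 1-morphism `V : a ⟶ b`
from the left. -/
def unitActLeft {a b : C} (z : 𝟙 a ⟶ 𝟙 a) (V : a ⟶ b) : V ⟶ V :=
  (λ_ V).inv ≫ z ▷ V ≫ (λ_ V).hom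

/-- The action of an endomorphism `z` of the 1-identity of `b` on a 1-morphism `V : a ⟶ b`
from the right. -/
def unitActRight {a b : C} (V : a ⟶ b) (z : 𝟙 b ⟶ 𝟙 b) : V ⟶ V :=
  (ρ_ V).inv ≫ V ◁ z ≫ (ρ_ V).hom

variable {a b c : C}

@[simp]
theorem unitActLeft_id (V : a ⟶ b) : unitActLeft (𝟙 _) V = 𝟙 V := by simp [unitActLeft]

@[simp]
theorem unitActRight_id (V : a ⟶ b) : unitActRight V (𝟙 _) = 𝟙 V := by simp [unitActRight]

theorem unitActLeft_comp (z z' : 𝟙 a ⟶ 𝟙 a) (V : a ⟶ b) :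
    unitActLeft (z ≫ z') V = unitActLeft z V ≫ unitActLeft z' V := by
  simp [unitActLeft]

theorem unitActRight_comp (V : a ⟶ b) (z z' : 𝟙 b ⟶ 𝟙 b) :
    unitActRight V (z ≫ z') = unitActRight V z ≫ unitActRight V z' := by
  simp [unitActRight]

theorem unitActLeft_naturality (z : 𝟙 a ⟶ 𝟙 a) {V W : a ⟶ b} (f : V ⟶ W) :
    unitActLeft z V ≫ f = f ≫ unitActLeft z W := by
  simp only [unitActLeft, Category.assoc, ← leftUnitor_naturality]
  rw [← whisker_exchange_assoc, leftUnitor_inv_naturality_assoc]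

theorem unitActRight_naturality {V W : a ⟶ b} (f : V ⟶ W) (z : 𝟙 b ⟶ 𝟙 b) :
    unitActRight V z ≫ f = f ≫ unitActRight W z := by
  simp only [unitActRight, Category.assoc, ← rightUnitor_naturality]
  rw [whisker_exchange_assoc, rightUnitor_inv_naturality_assoc]

theorem unitActLeft_naturality_assoc (z : 𝟙 a ⟶ 𝟙 a) {V W X : a ⟶ b} (f : V ⟶ W) (g : W ⟶ X) :
    unitActLeft z V ≫ f ≫ g = f ≫ unitActLeft z W ≫ g := by
  rw [← Category.assoc, unitActLeft_naturality, Category.assoc]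

theorem unitActRight_naturality_assoc {V W X : a ⟶ b} (f : V ⟶ W) (z : 𝟙 b ⟶ 𝟙 b) (g : W ⟶ X) :
    unitActRight V z ≫ f ≫ g = f ≫ unitActRight W z ≫ g := by
  rw [← Category.assoc, unitActRight_naturality, Category.assoc]

theorem unitActLeft_comp_right (z : 𝟙 a ⟶ 𝟙 a) (V : a ⟶ b) (W : b ⟶ c) :
    unitActLeft z (V ≫ W) = unitActLeft z V ▷ W := by
  simp [unitActLeft]

theorem unitActRight_comp_left (V : a ⟶ b) (W : b ⟶ c) (z : 𝟙 c ⟶ 𝟙 c) :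
    unitActRight (V ≫ W) z = V ◁ unitActRight W z := by
  simp [unitActRight]

theorem unitActRight_whiskerRight (V : a ⟶ b) (z : 𝟙 b ⟶ 𝟙 b) (W : b ⟶ c) :
    unitActRight V z ▷ W = V ◁ unitActLeft z W := by
  simp [unitActRight, unitActLeft]

@[simp]
theorem unitActLeft_one (z : 𝟙 a ⟶ 𝟙 a) : unitActLeft z (𝟙 a) = z := by
  simp [unitActLeft, unitors_equal, unitors_inv_equal]

@[simp]
theorem unitActRight_one (z : 𝟙 a ⟶ 𝟙 a) : unitActRight (𝟙 a) z = z := by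
  simp [unitActRight, unitors_equal, unitors_inv_equal]

theorem unit_end_comm (z z' : 𝟙 a ⟶ 𝟙 a) : z ≫ z' = z' ≫ z := by
  simpa using unitActLeft_naturality z z'

variable [PreadditiveBicategory C]

@[simp]
theorem PreadditiveBicategory.zero_whiskerRight {V W : a ⟶ b} (X : b ⟶ c) :
    (0 : V ⟶ W) ▷ X = 0 := by
  simpa using PreadditiveBicategory.add_whiskerRight (0 : V ⟶ W) 0 X

@[simp]
theorem PreadditiveBicategory.whiskerLeft_zero (X : a ⟶ b) {V W : b ⟶ c} :
    X ◁ (0 : V ⟶ W) = 0 := by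
  simpa using PreadditiveBicategory.whiskerLeft_add X (0 : V ⟶ W) 0

theorem PreadditiveBicategory.sum_whiskerRight {ι : Type*} (s : Finset ι)
    {V W : a ⟶ b} (f : ι → (V ⟶ W)) (X : b ⟶ c) :
    (∑ i ∈ s, f i) ▷ X = ∑ i ∈ s, f i ▷ X :=
  map_sum (AddMonoidHom.mk' (fun f : V ⟶ W => f ▷ X)
    fun _ _ => PreadditiveBicategory.add_whiskerRight _ _ _) f s

theorem PreadditiveBicategory.whiskerLeft_sum {ι : Type*} (s : Finset ι)
    (X : a ⟶ b) {V W : b ⟶ c} (f : ι → (V ⟶ W)) :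
    X ◁ (∑ i ∈ s, f i) = ∑ i ∈ s, X ◁ f i :=
  map_sum (AddMonoidHom.mk' (fun f : V ⟶ W => X ◁ f)
    fun _ _ => PreadditiveBicategory.whiskerLeft_add _ _ _) f s

theorem unitActLeft_add (z z' : 𝟙 a ⟶ 𝟙 a) (V : a ⟶ b) :
    unitActLeft (z + z') V = unitActLeft z V + unitActLeft z' V := by
  simp [unitActLeft, PreadditiveBicategory.add_whiskerRight]

theorem unitActRight_add (V : a ⟶ b) (z z' : 𝟙 b ⟶ 𝟙 b) :
    unitActRight V (z + z') = unitActRight V z + unitActRight V z' := by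
  simp [unitActRight, PreadditiveBicategory.whiskerLeft_add]

@[simp]
theorem unitActLeft_zero (V : a ⟶ b) : unitActLeft 0 V = 0 := by simp [unitActLeft]

@[simp]
theorem unitActRight_zero (V : a ⟶ b) : unitActRight V 0 = 0 := by simp [unitActRight]

theorem unitActLeft_sum {ι : Type*} (s : Finset ι) (z : ι → (𝟙 a ⟶ 𝟙 a)) (V : a ⟶ b) :
    unitActLeft (∑ i ∈ s, z i) V = ∑ i ∈ s, unitActLeft (z i) V := by
  simp [unitActLeft, PreadditiveBicategory.sum_whiskerRight, Preadditive.comp_sum,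
    Preadditive.sum_comp]

theorem unitActRight_sum {ι : Type*} (s : Finset ι) (V : a ⟶ b) (z : ι → (𝟙 b ⟶ 𝟙 b)) :
    unitActRight V (∑ i ∈ s, z i) = ∑ i ∈ s, unitActRight V (z i) := by
  simp [unitActRight, PreadditiveBicategory.whiskerLeft_sum, Preadditive.comp_sum,
    Preadditive.sum_comp]

/-- For an adjunction `U ⊣ W`, an endomorphism of `W` is determined by its composition with the
unit. -/
theorem CategoryTheory.Bicategory.Adjunction.eq_zero_of_unit_comp {U : a ⟶ b} {W : b ⟶ a}
    (adj : Bicategory.Adjunction U W) (x : W ⟶ W) (hx : adj.unit ≫ U ◁ x = 0) : x = 0 := by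
  have h1 := adj.right_triangle
  have h2 : 𝟙 W = (ρ_ W).inv ≫ W ◁ adj.unit ≫ (α_ W U W).inv ≫ adj.counit ▷ W ≫ (λ_ W).hom := by
    rw [← cancel_epi (ρ_ W).hom, ← cancel_mono (λ_ W).inv]
    simpa [rightZigzag, bicategoricalComp] using h1.symm
  calc x = 𝟙 W ≫ x := (Category.id_comp x).symm
    _ = (ρ_ W).inv ≫ W ◁ (adj.unit ≫ U ◁ x) ≫ (α_ W U W).inv ≫ adj.counit ▷ W ≫
        (λ_ W).hom := by
      rw [h2]
      simp only [Category.assoc, ← leftUnitor_naturality]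
      rw [← whisker_exchange_assoc]
      simp
    _ = 0 := by
      rw [hx]
      simp

/-- Joint nontriviality of two endomorphisms of 1-identities on `W` passes to the dual of `W`. -/
theorem unitActLeft_comp_unitActRight_ne_zero_symm {U : a ⟶ b} {W : b ⟶ a}
    (adj : Bicategory.Adjunction U W) (z : 𝟙 a ⟶ 𝟙 a) (z' : 𝟙 b ⟶ 𝟙 b)
    (h : unitActLeft z' W ≫ unitActRight W z ≠ 0) : unitActLeft z U ≫ unitActRight U z' ≠ 0 := by
  intro h0
  refine h (adj.eq_zero_of_unit_comp _ ?_)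
  have h1 : adj.unit ≫ U ◁ (unitActLeft z' W ≫ unitActRight W z) =
      adj.unit ≫ (unitActLeft z U ≫ unitActRight U z') ▷ W := by
    rw [whiskerLeft_comp, ← unitActRight_whiskerRight, ← unitActRight_comp_left,
      ← unitActRight_naturality, ← unitActRight_naturality_assoc, unitActRight_one,
      comp_whiskerRight, ← unitActLeft_comp_right, ← unitActLeft_naturality_assoc,
      unitActLeft_one]
  rw [h1, h0, PreadditiveBicategory.zero_whiskerRight, comp_zero]

end UnitAction

/-! ### Linear structures given by central elements -/

section Center

variable (C : Type u) [Bicategory.{w, v} C] [PreadditiveBicategory C]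

instance unitEndCommRing {C : Type u} [Bicategory.{w, v} C] [PreadditiveBicategory C] (a : C) :
    CommRing (End (𝟙 a)) :=
  { (inferInstance : Ring (End (𝟙 a))) with mul_comm := fun z z' => unit_end_comm z' z }

/-- The center of a 2-category: the families of endomorphisms of the 1-identities that act on
every 1-morphism in the same way from the left and from the right. -/
def bicategoryCenter : Subring (∀ a : C, End (𝟙 a)) where
  carrier := {z | ∀ (a b : C) (V : a ⟶ b), unitActLeft (z a) V = unitActRight V (z b)}
  mul_mem' {z z'} hz hz' a b V :=
    (unitActLeft_comp _ _ V).trans (by rw [hz, hz']; exact (unitActRight_comp V _ _).symm)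
  one_mem' a b V := (unitActLeft_id V).trans (unitActRight_id V).symm
  add_mem' {z z'} hz hz' a b V :=
    (unitActLeft_add _ _ V).trans (by rw [hz, hz']; exact (unitActRight_add V _ _).symm)
  zero_mem' a b V := (unitActLeft_zero V).trans (unitActRight_zero V).symm
  neg_mem' {z} hz a b V := by
    have h1 : unitActLeft (-z a) V = -unitActLeft (z a) V :=
      eq_neg_of_add_eq_zero_left (by rw [← unitActLeft_add, neg_add_cancel, unitActLeft_zero])
    have h2 : unitActRight V (-z b) = -unitActRight V (z b) :=
      eq_neg_of_add_eq_zero_left (by rw [← unitActRight_add, neg_add_cancel, unitActRight_zero])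
    exact h1.trans (by rw [hz, ← h2]; rfl)

variable {C}

/-- The linear structure on a 2-category given by a homomorphism to the center: a scalar acts on
2-morphisms through its action on 1-morphisms. -/
@[reducible]
def linearBicategoryOfCenter {k : Type*} [CommRing k] (φ : k →+* bicategoryCenter C) :
    LinearBicategory k C where
  homLinear a b :=
    { homModule V W :=
        { smul r f := unitActLeft ((φ r).1 a) V ≫ f
          one_smul f := by
            change unitActLeft ((φ 1).1 a) V ≫ f = f
            rw [map_one]
            exact (congrArg (· ≫ f) (unitActLeft_id V)).trans (Category.id_comp f)
          mul_smul r s f := by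
            change unitActLeft ((φ (r * s)).1 a) V ≫ f =
              unitActLeft ((φ r).1 a) V ≫ unitActLeft ((φ s).1 a) V ≫ f
            rw [mul_comm, map_mul, ← Category.assoc, ← unitActLeft_comp]
            rfl
          smul_zero r := comp_zero
          smul_add r f g := Preadditive.comp_add _ _ _ _ _ _
          add_smul r s f := by
            change unitActLeft ((φ (r + s)).1 a) V ≫ f =
              unitActLeft ((φ r).1 a) V ≫ f + unitActLeft ((φ s).1 a) V ≫ f
            rw [map_add, ← Preadditive.add_comp, ← unitActLeft_add]
            rfl
          zero_smul f := by
            change unitActLeft ((φ 0).1 a) V ≫ f = 0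
            rw [map_zero]
            exact (congrArg (· ≫ f) (unitActLeft_zero V)).trans zero_comp }
      smul_comp _ _ _ r f g := Category.assoc _ _ _
      comp_smul _ _ _ f r g := (unitActLeft_naturality_assoc _ f g).symm }
  whiskerLeft_smul {a b c} f g h r η := by
    change f ◁ (unitActLeft ((φ r).1 b) g ≫ η) = unitActLeft ((φ r).1 a) (f ≫ g) ≫ f ◁ η
    rw [whiskerLeft_comp, unitActLeft_comp_right, ← unitActRight_whiskerRight, (φ r).2]
  smul_whiskerRight {a b c} f g r η h := by
    change (unitActLeft ((φ r).1 a) f ≫ η) ▷ h = unitActLeft ((φ r).1 a) (f ≫ h) ≫ η ▷ h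
    rw [comp_whiskerRight, unitActLeft_comp_right]

end Center

/-! ### Projections to simple summands of 1-identities -/

section SimpleUnitProjection

variable {C : Type u} [Bicategory.{w, v} C] [PreadditiveBicategory C]

/-- The endomorphism `e` of the 1-identity of `a` is the idempotent that projects to a simple
direct summand. -/
def IsSimpleUnitProjection {a : C} (e : 𝟙 a ⟶ 𝟙 a) : Prop :=
  ∃ (S : a ⟶ a) (ι : S ⟶ 𝟙 a) (r : 𝟙 a ⟶ S), Simple S ∧ ι ≫ r = 𝟙 S ∧ r ≫ ι = e

/-- Two endomorphisms of 1-identities are linked if they jointly act on some 1-morphism in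
a nonzero way. -/
def UnitLinked {a b : C} (e : 𝟙 a ⟶ 𝟙 a) (e' : 𝟙 b ⟶ 𝟙 b) : Prop :=
  ∃ V : a ⟶ b, unitActLeft e V ≫ unitActRight V e' ≠ 0

theorem UnitLinked.symm (hrigid : IsRigidBicategory C) {a b : C} {e : 𝟙 a ⟶ 𝟙 a}
    {e' : 𝟙 b ⟶ 𝟙 b} (h : UnitLinked e e') : UnitLinked e' e := by
  obtain ⟨W, hW⟩ := h
  obtain ⟨-, U, ⟨adj⟩⟩ := hrigid _ _ W
  exact ⟨U, unitActLeft_comp_unitActRight_ne_zero_symm adj _ _ hW⟩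

namespace IsSimpleUnitProjection

variable {a : C} {e : 𝟙 a ⟶ 𝟙 a}

theorem idem (h : IsSimpleUnitProjection e) : e ≫ e = e := by
  obtain ⟨S, ι, r, -, hr, rfl⟩ := h
  simp [reassoc_of% hr]

theorem ne_zero (h : IsSimpleUnitProjection e) : e ≠ 0 := by
  obtain ⟨S, ι, r, _, hr, rfl⟩ := h
  intro h0
  apply id_nonzero S
  rw [← Category.id_comp (𝟙 S), ← hr, Category.assoc, reassoc_of% h0, zero_comp, comp_zero]

/-- The corner `e End(𝟙 a)` cut out by a simple summand is a field, by Schur's lemma. -/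
theorem exists_inverse (hss : IsSemisimpleBicategory C) (h : IsSimpleUnitProjection e)
    (z : 𝟙 a ⟶ 𝟙 a) (hz : e ≫ z ≠ 0) : ∃ w, (e ≫ z) ≫ w = e := by
  obtain ⟨S, ι, r, _, hr, rfl⟩ := h
  have h1 : (r ≫ ι) ≫ z = r ≫ (ι ≫ z ≫ r) ≫ ι := by
    have h2 : (r ≫ ι) ≫ (r ≫ ι) ≫ z = (r ≫ ι) ≫ z := by simp [reassoc_of% hr]
    rw [← h2, unit_end_comm (r ≫ ι) z]
    simp
  have := (hss a a).hasKernels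
  have h3 : IsIso (ι ≫ z ≫ r) := by
    rw [isIso_iff_nonzero]
    intro h4
    apply hz
    rw [h1, h4, zero_comp, comp_zero]
  refine ⟨r ≫ inv (ι ≫ z ≫ r) ≫ ι, ?_⟩
  rw [h1]
  simp only [Category.assoc, reassoc_of% hr]
  rw [← Category.assoc z, ← Category.assoc ι, IsIso.hom_inv_id_assoc]

end IsSimpleUnitProjection

/-- The 1-identities are sums of simple summands. -/
theorem IsSemisimpleBicategory.exists_sum_eq_id (hss : IsSemisimpleBicategory C) (a : C) :
    ∃ (J : Type) (_ : Fintype J) (e : J → (𝟙 a ⟶ 𝟙 a)),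
      (∀ j, IsSimpleUnitProjection (e j)) ∧ ∑ j, e j = 𝟙 (𝟙 a) := by
  obtain ⟨J, hJ, S, i, r, hS, hir, -, htot⟩ := (hss a a).isFiniteSumOfSimples (𝟙 a)
  exact ⟨J, hJ, fun j => r j ≫ i j, fun j => ⟨S j, i j, r j, hS j, hir j, rfl⟩, htot⟩

theorem SimpleUnitSummand.exists_retraction (hss : IsSemisimpleBicategory C)
    (x : SimpleUnitSummand C) : ∃ r, x.ι ≫ r = 𝟙 x.obj :=
  have := x.mono
  (hss _ _).isRegularCategory.exists_retraction x.ι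

theorem SimpleUnitSummand.Linked.unitLinked {x y : SimpleUnitSummand C} (h : x.Linked y)
    {r : 𝟙 x.pt ⟶ x.obj} {s : 𝟙 y.pt ⟶ y.obj} (hr : x.ι ≫ r = 𝟙 x.obj)
    (hs : y.ι ≫ s = 𝟙 y.obj) : UnitLinked (r ≫ x.ι) (s ≫ y.ι) := by
  obtain ⟨V, hV⟩ := h
  refine ⟨V, fun h0 => hV ?_⟩
  have := x.mono
  have := y.mono
  -- the projections act as the identity on the simple summands
  have hx : unitActRight x.obj (r ≫ x.ι) = 𝟙 _ := by
    rw [← cancel_mono x.ι, unitActRight_naturality, unitActRight_one, reassoc_of% hr]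
    simp
  have hy : unitActLeft (s ≫ y.ι) y.obj = 𝟙 _ := by
    rw [← cancel_mono y.ι, unitActLeft_naturality, unitActLeft_one, reassoc_of% hs]
    simp
  have h1 : x.obj ◁ unitActLeft (r ≫ x.ι) V ▷ y.obj = 𝟙 _ := by
    rw [← unitActLeft_comp_right, ← unitActRight_whiskerRight, hx, id_whiskerRight]
  have h2 : unitActRight V (s ≫ y.ι) ▷ y.obj = 𝟙 _ := by
    rw [unitActRight_whiskerRight, hy, whiskerLeft_id]
  rw [IsZero.iff_id_eq_zero]
  have h3 := congrArg (fun f => x.obj ◁ f ▷ y.obj) h0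
  simpa only [comp_whiskerRight, h2, Category.comp_id, h1,
    PreadditiveBicategory.zero_whiskerRight, PreadditiveBicategory.whiskerLeft_zero] using h3

/-- In a connected 2-category a property of endomorphisms of 1-identities that is inherited along
links holds for all projections to simple summands if it holds for one. -/
theorem IsSimpleUnitProjection.induction_of_connected (hss : IsSemisimpleBicategory C)
    (hconn : IsConnectedBicategory C) (hrigid : IsRigidBicategory C)
    {P : ∀ {a : C}, (𝟙 a ⟶ 𝟙 a) → Prop}
    (hP : ∀ {a b : C} (e : 𝟙 a ⟶ 𝟙 a) (e' : 𝟙 b ⟶ 𝟙 b), IsSimpleUnitProjection e →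
      IsSimpleUnitProjection e' → UnitLinked e e' → P e → P e')
    {a b : C} {e : 𝟙 a ⟶ 𝟙 a} {e' : 𝟙 b ⟶ 𝟙 b} (he : IsSimpleUnitProjection e)
    (he' : IsSimpleUnitProjection e') (h : P e) : P e' := by
  let Q (x : SimpleUnitSummand C) : Prop := ∃ r, x.ι ≫ r = 𝟙 x.obj ∧ P (r ≫ x.ι)
  have hQ' : ∀ x y : SimpleUnitSummand C, x.Linked y → ∀ r s, x.ι ≫ r = 𝟙 x.obj →
      y.ι ≫ s = 𝟙 y.obj → (P (r ≫ x.ι) ↔ P (s ≫ y.ι)) := fun x y h r s hr hs => by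
    have h1 := h.unitLinked hr hs
    have h2 := h1.symm hrigid
    have h3 : IsSimpleUnitProjection (r ≫ x.ι) := ⟨_, _, _, x.simple, hr, rfl⟩
    have h4 : IsSimpleUnitProjection (s ≫ y.ι) := ⟨_, _, _, y.simple, hs, rfl⟩
    exact ⟨hP _ _ h3 h4 h1, hP _ _ h4 h3 h2⟩
  have hQ : ∀ x y : SimpleUnitSummand C, Relation.EqvGen SimpleUnitSummand.Linked x y →
      (Q x ↔ Q y) := by
    intro x y h
    induction h with
    | rel x y h =>
      constructor
      · rintro ⟨r, hr, hPr⟩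
        obtain ⟨s, hs⟩ := y.exists_retraction hss
        exact ⟨s, hs, (hQ' x y h r s hr hs).1 hPr⟩
      · rintro ⟨s, hs, hPs⟩
        obtain ⟨r, hr⟩ := x.exists_retraction hss
        exact ⟨r, hr, (hQ' x y h r s hr hs).2 hPs⟩
    | refl x => rfl
    | symm x y _ ih => exact ih.symm
    | trans x y z _ _ ih ih' => exact ih.trans ih'
  have hmono : ∀ {a : C} {S : a ⟶ a} (ι : S ⟶ 𝟙 a) (r : 𝟙 a ⟶ S), ι ≫ r = 𝟙 S → Mono ι :=
    fun ι r hr => ⟨fun f g hfg => by simpa [hr] using hfg =≫ r⟩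
  obtain ⟨S, ι, r, hS, hr, rfl⟩ := he
  obtain ⟨S', ι', r', hS', hr', rfl⟩ := he'
  obtain ⟨s, hs, hPs⟩ := (hQ ⟨a, S, ι, hS, hmono ι r hr⟩ ⟨b, S', ι', hS', hmono ι' r' hr'⟩
    (hconn _ _)).1 ⟨r, hr, h⟩
  -- the projection to a summand does not depend on the retraction
  have h1 := unit_end_comm (r' ≫ ι') (s ≫ ι')
  simp only [Category.assoc, reassoc_of% hr', reassoc_of% hs] at h1
  rw [h1]
  exact hPs

end SimpleUnitProjection

/-! ### The center is a field -/

section CenterField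

variable {C : Type u} [Bicategory.{w, v} C] [PreadditiveBicategory C]

theorem bicategoryCenter.isField (hconn : IsConnectedBicategory C)
    (hss : IsSemisimpleBicategory C) (hrigid : IsRigidBicategory C) {a₀ : C}
    (h₀ : 𝟙 (𝟙 a₀) ≠ 0) : IsField (bicategoryCenter C) where
  exists_pair_ne := ⟨1, 0, fun h => h₀ (congrFun (congrArg Subtype.val h) a₀)⟩
  mul_comm z z' := Subtype.ext (funext fun a => unit_end_comm _ _)
  mul_inv_cancel {z} hz := by
    obtain ⟨z, hzc⟩ := z
    change ∀ (a b : C) (V : a ⟶ b), unitActLeft (z a) V = unitActRight V (z b) at hzc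
    replace hz : (z : ∀ a : C, 𝟙 a ⟶ 𝟙 a) ≠ fun a => 0 := fun h => hz (Subtype.ext h)
    obtain ⟨a, ha⟩ : ∃ a, (show 𝟙 a ⟶ 𝟙 a from z a) ≠ 0 := by
      by_contra! h
      exact hz (funext h)
    have hz' : ∀ {b : C} (e : 𝟙 b ⟶ 𝟙 b), IsSimpleUnitProjection e → e ≫ z b ≠ 0 := by
      obtain ⟨J, _, e, he, hsum⟩ := hss.exists_sum_eq_id a
      obtain ⟨j, hj⟩ : ∃ j, e j ≫ z a ≠ 0 := by
        by_contra! h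
        apply ha
        rw [← Category.id_comp (z a), ← hsum, Preadditive.sum_comp]
        exact Finset.sum_eq_zero fun j _ => h j
      refine fun e' he' => (he j).induction_of_connected hss hconn hrigid
        (P := fun {b} e => e ≫ z b ≠ 0) (fun {c d} x y hx hy hxy hxz hyz => ?_) he' hj
      obtain ⟨V, hV⟩ := hxy
      obtain ⟨w, hw⟩ := hx.exists_inverse hss _ hxz
      apply hV
      rw [← hw, unitActLeft_comp, unitActLeft_comp, hzc, Category.assoc, Category.assoc,
        unitActLeft_naturality w, ← Category.assoc (unitActRight V (z d)), ← unitActRight_comp,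
        unit_end_comm, hyz]
      simp
    have hinv : ∀ a : C, ∃ w : 𝟙 a ⟶ 𝟙 a, w ≫ z a = 𝟙 (𝟙 a) := fun a => by
      obtain ⟨J, _, e, he, hsum⟩ := hss.exists_sum_eq_id a
      choose w hw using fun j => (he j).exists_inverse hss _ (hz' _ (he j))
      refine ⟨∑ j, e j ≫ w j, ?_⟩
      rw [Preadditive.sum_comp, ← hsum]
      refine Finset.sum_congr rfl fun j _ => ?_
      rw [Category.assoc, unit_end_comm (w j), ← Category.assoc, hw]
    choose w hw using hinv
    refine ⟨⟨w, fun a b V => ?_⟩, Subtype.ext (funext fun a => hw a)⟩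
    have hw' : z b ≫ w b = 𝟙 (𝟙 b) := (unit_end_comm _ _).trans (hw b)
    calc unitActLeft (w a) V = unitActLeft (w a) V ≫ unitActRight V (z b ≫ w b) := by
          rw [hw', unitActRight_id, Category.comp_id]
      _ = unitActLeft (w a ≫ z a) V ≫ unitActRight V (w b) := by
          rw [unitActRight_comp, ← hzc, unitActLeft_comp, Category.assoc]
      _ = unitActRight V (w b) := by rw [hw, unitActLeft_id, Category.id_comp]

end CenterField

/-! ### Finite generation over the endomorphisms of 1-identities -/

section Finiteness

variable {C : Type u} [Bicategory.{w, v} C] [PreadditiveBicategory C]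

theorem exists_unit_generators (hss : IsSemisimpleBicategory C) {a : C} (X : a ⟶ a) :
    ∃ (J : Type) (_ : Fintype J) (g : J → (𝟙 a ⟶ X)), ∀ f : 𝟙 a ⟶ X,
      ∃ c : J → (𝟙 a ⟶ 𝟙 a), f = ∑ j, c j ≫ g j := by
  classical
  obtain ⟨J, _, S, i, r, hS, hir, -, htot⟩ := (hss a a).isFiniteSumOfSimples X
  -- `Hom (𝟙 a) (S j)` is generated by any nonzero element, which is a split epimorphism
  have key : ∀ j, ∃ g : 𝟙 a ⟶ S j, ∀ f : 𝟙 a ⟶ S j, ∃ c, f = c ≫ g := fun j => by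
    by_cases h : ∃ g : 𝟙 a ⟶ S j, g ≠ 0
    · obtain ⟨g, hg⟩ := h
      obtain ⟨s, hs⟩ := (hss a a).isRegularCategory g
      have := (hss a a).hasKernels
      have hS' := hS j
      have : IsIso (s ≫ g) := by
        rw [isIso_iff_nonzero]
        intro h0
        rw [h0, comp_zero] at hs
        exact hg hs.symm
      exact ⟨g, fun f => ⟨f ≫ inv (s ≫ g) ≫ s, by simp⟩⟩
    · push Not at h
      exact ⟨0, fun f => ⟨0, by simp [h f]⟩⟩
  choose g hg using key
  refine ⟨J, inferInstance, fun j => g j ≫ i j, fun f => ?_⟩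
  choose c hc using fun j => hg j (f ≫ r j)
  refine ⟨c, ?_⟩
  conv_lhs => rw [← Category.comp_id f, ← htot, Preadditive.comp_sum]
  refine Finset.sum_congr rfl fun j _ => ?_
  rw [← Category.assoc, hc, Category.assoc]

/-- By rigidity, `Hom V X` is finitely generated over the endomorphisms of the 1-identity of the
source: it is `Hom (𝟙 a) (X ⊗ V*)`. -/
theorem exists_hom_generators (hss : IsSemisimpleBicategory C) (hrigid : IsRigidBicategory C)
    {a b : C} (V X : a ⟶ b) : ∃ (J : Type) (_ : Fintype J) (g : J → (V ⟶ X)), ∀ f : V ⟶ X,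
      ∃ c : J → (𝟙 a ⟶ 𝟙 a), f = ∑ j, unitActLeft (c j) V ≫ g j := by
  obtain ⟨⟨W, ⟨adj⟩⟩, -⟩ := hrigid _ _ V
  obtain ⟨J, hJ, g, hg⟩ := exists_unit_generators hss (X ≫ W)
  let ψ : (𝟙 a ⟶ X ≫ W) →+ (V ⟶ X) :=
    AddMonoidHom.mk' (fun f => (λ_ V).inv ≫ adj.homEquiv₂.symm f) fun f f' => by
      simp [Bicategory.Adjunction.homEquiv₂, PreadditiveBicategory.add_whiskerRight]
  have hψ : ∀ z f, ψ (z ≫ f) = unitActLeft z V ≫ ψ f := fun z f => by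
    simp [ψ, Bicategory.Adjunction.homEquiv₂, unitActLeft]
  refine ⟨J, hJ, fun j => ψ (g j), fun f => ?_⟩
  obtain ⟨c, hc⟩ := hg (adj.homEquiv₂ ((λ_ V).hom ≫ f))
  refine ⟨c, ?_⟩
  have h1 : ψ (adj.homEquiv₂ ((λ_ V).hom ≫ f)) = f := by simp [ψ]
  rw [← h1, hc, map_sum]
  exact Finset.sum_congr rfl fun j _ => hψ _ _

/-- Finitely many 1-morphisms from `a` to `b` represent all simple ones. -/
theorem HasFinitelyManySimples.exists_representatives (hfin : HasFinitelyManySimples C) (a b : C) :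
    ∃ (J : Type) (_ : Fintype J) (R : J → (a ⟶ b)), ∀ V : a ⟶ b, Simple V →
      ∃ j, Nonempty (V ≅ R j) := by
  let q : Quotient (isIsomorphicSetoid (a ⟶ b)) →
    Σ p : C × C, Quotient (isIsomorphicSetoid (p.1 ⟶ p.2)) := fun x => ⟨(a, b), x⟩
  have hq : Function.Injective q := fun x y h => eq_of_heq (Sigma.mk.inj h).2
  have hT := hfin.preimage (f := q) hq.injOn
  obtain ⟨n, ⟨e⟩⟩ := hT.to_subtype.exists_equiv_fin
  refine ⟨Fin n, inferInstance, fun j => (e.symm j).1.out, fun V hV => ?_⟩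
  refine ⟨e ⟨Quotient.mk _ V, a, b, V, hV, rfl⟩, ?_⟩
  change Nonempty (V ≅ (e.symm (e _)).1.out)
  rw [Equiv.symm_apply_apply]
  exact ⟨(Quotient.exact (Quotient.out_eq (Quotient.mk (isIsomorphicSetoid (a ⟶ b)) V))).some.symm⟩

/-- A natural family of endomorphisms is determined by its values on simple objects. -/
theorem IsSemisimpleCategory.eq_zero_of_simple {A : Type*} [Category A] [Preadditive A]
    (h : IsSemisimpleCategory A) (t : ∀ X : A, X ⟶ X)
    (ht : ∀ {X Y : A} (f : X ⟶ Y), t X ≫ f = f ≫ t Y) (h0 : ∀ X : A, Simple X → t X = 0) (X : A) :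
    t X = 0 := by
  obtain ⟨J, _, S, i, r, hS, -, -, htot⟩ := h.isFiniteSumOfSimples X
  rw [← Category.comp_id (t X), ← htot, Preadditive.comp_sum]
  refine Finset.sum_eq_zero fun j _ => ?_
  rw [← Category.assoc, ht, h0 _ (hS j), comp_zero, zero_comp]

end Finiteness

/-! ### Linear independence over the center -/

section Independence

variable {C : Type u} [Bicategory.{w, v} C] [PreadditiveBicategory C]

/-- Coefficients `c` in the endomorphisms of the 1-identity of `d` are a relation between the
endomorphisms `x s`, `s ∈ S`, of the 1-identity of `b` if `∑ c s ⊗ x s` kills all 1-morphisms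
from `d` to `b`. -/
def IsUnitRelation {b : C} {ι : Type*} (S : Finset ι) (x : ι → (𝟙 b ⟶ 𝟙 b)) {d : C}
    (c : ι → (𝟙 d ⟶ 𝟙 d)) : Prop :=
  ∀ V : d ⟶ b, ∑ s ∈ S, unitActLeft (c s) V ≫ unitActRight V (x s) = 0

namespace IsUnitRelation

variable {b : C} {ι : Type*} {S : Finset ι} {x : ι → (𝟙 b ⟶ 𝟙 b)}

theorem mul {d : C} {c : ι → (𝟙 d ⟶ 𝟙 d)} (h : IsUnitRelation S x c) (z : 𝟙 d ⟶ 𝟙 d) :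
    IsUnitRelation S x fun s => z ≫ c s := fun V => by
  simp only [unitActLeft_comp, Category.assoc]
  rw [← Preadditive.comp_sum, h V, comp_zero]

/-- If endomorphisms `y s` of `W : d' ⟶ d` satisfy `∑ y s ⊗ x s = 0` on all `W ⊗ V`, then
their images under any map `End W ⟶ End (𝟙 d)` of the form `y ↦ η ≫ U ◁ y ≫ p` are a relation. -/
theorem of_whisker {d d' : C} {U : d ⟶ d'} {W : d' ⟶ d} (η : 𝟙 d ⟶ U ≫ W) (p : U ≫ W ⟶ 𝟙 d)
    (y : ι → (W ⟶ W))
    (hy : ∀ V : d ⟶ b, ∑ s ∈ S, y s ▷ V ≫ unitActRight (W ≫ V) (x s) = 0) :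
    IsUnitRelation S x fun s => η ≫ U ◁ y s ≫ p := fun V => by
  have h1 : ∀ s, unitActLeft (η ≫ U ◁ y s ≫ p) V ≫ unitActRight V (x s) =
      (λ_ V).inv ≫ η ▷ V ≫ (α_ _ _ _).hom ≫ (U ◁ (y s ▷ V ≫ unitActRight (W ≫ V) (x s))) ≫
        (α_ _ _ _).inv ≫ p ▷ V ≫ (λ_ V).hom := fun s => by
    rw [whiskerLeft_comp, ← unitActRight_comp_left, Category.assoc,
      unitActRight_naturality_assoc, unitActRight_naturality_assoc, unitActRight_naturality]
    simp [unitActLeft]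
  simp only [h1]
  simp only [← Preadditive.comp_sum, ← Preadditive.sum_comp]
  rw [← PreadditiveBicategory.whiskerLeft_sum, hy V]
  simp

/-- A relation for `d'` whose coefficient at `t` is the projection to a simple summand can be
transported along links. -/
theorem exists_of_unitLinked (hss : IsSemisimpleBicategory C) (hrigid : IsRigidBicategory C)
    {d d' : C} {e' : 𝟙 d' ⟶ 𝟙 d'} {e : 𝟙 d ⟶ 𝟙 d} (he : IsSimpleUnitProjection e)
    (hlink : UnitLinked e' e) {t : ι} {c : ι → (𝟙 d' ⟶ 𝟙 d')} (hc : IsUnitRelation S x c)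
    (ht : c t = e') : ∃ c' : ι → (𝟙 d ⟶ 𝟙 d), IsUnitRelation S x c' ∧ c' t = e ∧
      ∀ s, e ≫ c' s = c' s := by
  obtain ⟨W, hW⟩ := hlink
  obtain ⟨-, U, ⟨adj⟩⟩ := hrigid _ _ W
  -- a functional on `End W` that does not vanish on `e'`
  have hf : adj.unit ≫ U ◁ (unitActLeft e' W ≫ unitActRight W e) ≠ 0 := fun h0 =>
    hW (adj.eq_zero_of_unit_comp _ h0)
  have hfe : adj.unit ≫ U ◁ (unitActLeft e' W ≫ unitActRight W e) =
      e ≫ adj.unit ≫ U ◁ unitActLeft e' W := by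
    rw [whiskerLeft_comp, ← unitActRight_comp_left, ← Category.assoc,
      ← unitActRight_naturality, unitActRight_one]
  rw [hfe] at hf
  obtain ⟨p, hp⟩ : ∃ p : U ≫ W ⟶ 𝟙 d, (e ≫ adj.unit ≫ U ◁ unitActLeft e' W) ≫ p ≠ 0 := by
    by_contra! h
    exact hf ((hss d d).isRegularCategory.eq_zero_of_comp_eq_zero _ h)
  obtain ⟨w, hw⟩ := he.exists_inverse hss (adj.unit ≫ U ◁ unitActLeft e' W ≫ p)
    (by simpa using hp)
  have h1 : IsUnitRelation S x fun s => adj.unit ≫ U ◁ unitActLeft (c s) W ≫ p :=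
    of_whisker _ _ _ fun V => by
      simpa only [unitActLeft_comp_right] using hc (W ≫ V)
  refine ⟨_, h1.mul (e ≫ w), ?_, fun s => ?_⟩
  · simp only [ht]
    rw [Category.assoc, unit_end_comm w, ← Category.assoc, hw]
  · rw [Category.assoc, ← Category.assoc e e, he.idem]

end IsUnitRelation

/-- Every element of the center of a linear 2-category is a scalar. -/
def HasScalarCenter (k : Type*) [Field k] (C : Type u) [Bicategory.{w, v} C]
    [PreadditiveBicategory C] [LinearBicategory k C] : Prop :=
  ∀ z ∈ bicategoryCenter C, ∃ r : k, ∀ a : C, z a = r • 𝟙 (𝟙 a)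

variable {k : Type*} [Field k] [LinearBicategory k C]

/-- Endomorphisms of the 1-identity of `b` that are linearly independent over the center satisfy
no relation. The coefficients of a shortest relation, normalized so that one of them is the
projection to a simple summand, are transported to all other simple summands; being unique, they
fit together to a central element. -/
theorem IsUnitRelation.comp_eq_zero (hconn : IsConnectedBicategory C)
    (hss : IsSemisimpleBicategory C) (hrigid : IsRigidBicategory C)
    (hk : HasScalarCenter k C) {b : C} {ι : Type*} {x : ι → (𝟙 b ⟶ 𝟙 b)}
    (hx : LinearIndependent k x) (S : Finset ι) {d : C} {e : 𝟙 d ⟶ 𝟙 d}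
    (he : IsSimpleUnitProjection e) {c : ι → (𝟙 d ⟶ 𝟙 d)} (hc : IsUnitRelation S x c) :
    ∀ s ∈ S, e ≫ c s = 0 := by
  classical
  induction S using Finset.induction_on generalizing d with
  | empty => simp
  | insert t S ht ih =>
    by_cases hct : e ≫ c t = 0
    · intro s hs
      obtain rfl | hs := Finset.mem_insert.1 hs
      · exact hct
      · have h1 : IsUnitRelation S x fun s => e ≫ c s := fun V => by
          have := hc.mul e V
          rw [Finset.sum_insert ht] at this
          simpa [hct] using this
        have h2 := ih he h1 s hs
        rwa [← Category.assoc, he.idem] at h2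
    exfalso
    -- the normalized relations
    let P : ∀ {a : C}, (𝟙 a ⟶ 𝟙 a) → Prop := fun {a} e => ∃ c' : ι → (𝟙 a ⟶ 𝟙 a),
      IsUnitRelation (insert t S) x c' ∧ c' t = e ∧ ∀ s, e ≫ c' s = c' s
    have hPe : P e := by
      obtain ⟨w, hw⟩ := he.exists_inverse hss _ hct
      refine ⟨_, hc.mul (e ≫ w), ?_, fun s => ?_⟩
      · rw [Category.assoc, unit_end_comm w, ← Category.assoc, hw]
      · rw [Category.assoc, ← Category.assoc e e, he.idem]
    have hP : ∀ {a : C} (e' : 𝟙 a ⟶ 𝟙 a), IsSimpleUnitProjection e' → P e' := fun e' he' =>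
      he.induction_of_connected hss hconn hrigid (P := P)
        (fun f f' hf hf' hlink ⟨c', h1, h2, h3⟩ =>
          IsUnitRelation.exists_of_unitLinked hss hrigid hf' hlink h1 h2) he' hPe
    choose γ hγrel hγt hγe using @hP
    -- they are compatible, because their differences are shorter relations
    have hcompat : ∀ {a a' : C} (f : 𝟙 a ⟶ 𝟙 a) (f' : 𝟙 a' ⟶ 𝟙 a')
        (hf : IsSimpleUnitProjection f) (hf' : IsSimpleUnitProjection f') (W : a ⟶ a') (s : ι),
        s ∈ insert t S → unitActLeft (γ f hf s) W ≫ unitActRight W f' =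
          unitActLeft f W ≫ unitActRight W (γ f' hf' s) := by
      intro a a' f f' hf hf' W s hs
      let y (s : ι) : W ⟶ W := unitActLeft (γ f hf s) W ≫ unitActRight W f' -
          unitActLeft f W ≫ unitActRight W (γ f' hf' s)
      suffices hy : y s = 0 from sub_eq_zero.1 hy
      have hyt : y t = 0 := by simp only [y, hγt, sub_self]
      obtain rfl | hs := Finset.mem_insert.1 hs
      · exact hyt
      have hyrel : ∀ V : a' ⟶ b, ∑ s ∈ S, y s ▷ V ≫ unitActRight (W ≫ V) (x s) = 0 := by
        intro V
        have h1 : ∑ s ∈ insert t S, y s ▷ V ≫ unitActRight (W ≫ V) (x s) = 0 := by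
          have h2 : ∀ s, y s ▷ V ≫ unitActRight (W ≫ V) (x s) =
              (unitActRight W f' ▷ V) ≫
                (unitActLeft (γ f hf s) (W ≫ V) ≫ unitActRight (W ≫ V) (x s)) -
              (unitActLeft f W ▷ V) ≫
                W ◁ (unitActLeft (γ f' hf' s) V ≫ unitActRight V (x s)) := fun s => by
            have h3 : y s ▷ V = (unitActLeft (γ f hf s) W ≫ unitActRight W f') ▷ V -
                (unitActLeft f W ≫ unitActRight W (γ f' hf' s)) ▷ V :=
              map_sub (AddMonoidHom.mk' (fun g : W ⟶ W => g ▷ V)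
                fun _ _ => PreadditiveBicategory.add_whiskerRight _ _ _) _ _
            rw [h3, Preadditive.sub_comp, unitActLeft_naturality, comp_whiskerRight,
              comp_whiskerRight, ← unitActLeft_comp_right, whiskerLeft_comp,
              unitActRight_whiskerRight W (γ f' hf' s), ← unitActRight_comp_left]
            simp only [Category.assoc]
          simp only [h2]
          rw [Finset.sum_sub_distrib, ← Preadditive.comp_sum, ← Preadditive.comp_sum,
            ← PreadditiveBicategory.whiskerLeft_sum, hγrel f hf (W ≫ V), hγrel f' hf' V]
          simp
        rwa [Finset.sum_insert ht, hyt, PreadditiveBicategory.zero_whiskerRight, zero_comp,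
          zero_add] at h1
      have hyf : y s = y s ≫ unitActRight W f' := by
        simp only [y, Preadditive.sub_comp, Category.assoc, ← unitActRight_comp, hf'.idem]
        rw [unit_end_comm (γ f' hf' s), hγe]
      obtain ⟨-, U, ⟨adj⟩⟩ := hrigid _ _ W
      refine adj.eq_zero_of_unit_comp _ ?_
      refine (hss a' a').isRegularCategory.eq_zero_of_comp_eq_zero _ fun p => ?_
      have h1 := ih hf' (IsUnitRelation.of_whisker adj.unit p y hyrel) s hs
      rw [hyf, whiskerLeft_comp, ← unitActRight_comp_left, ← Category.assoc,
        ← unitActRight_naturality, unitActRight_one]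
      simpa using h1
    -- the central elements that they define
    choose J hJ q hq hsum using hss.exists_sum_eq_id
    let ζ (s : ι) (a : C) : 𝟙 a ⟶ 𝟙 a := ∑ j, γ (q a j) (hq a j) s
    have hζ : ∀ s ∈ insert t S, ∀ (a a' : C) (V : a ⟶ a'),
        unitActLeft (ζ s a) V = unitActRight V (ζ s a') := by
      intro s hs a a' V
      calc unitActLeft (ζ s a) V = unitActLeft (ζ s a) V ≫ unitActRight V (∑ j, q a' j) := by
            rw [hsum, unitActRight_id, Category.comp_id]
        _ = ∑ j, ∑ i, unitActLeft (q a i) V ≫ unitActRight V (γ (q a' j) (hq a' j) s) := by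
            rw [unitActRight_sum, Preadditive.comp_sum]
            refine Finset.sum_congr rfl fun j _ => ?_
            simp only [ζ]
            rw [unitActLeft_sum, Preadditive.sum_comp]
            exact Finset.sum_congr rfl fun i _ => hcompat _ _ _ _ _ _ hs
        _ = unitActLeft (∑ i, q a i) V ≫ unitActRight V (ζ s a') := by
            simp only [ζ]
            rw [unitActRight_sum, Preadditive.comp_sum]
            refine Finset.sum_congr rfl fun j _ => ?_
            rw [unitActLeft_sum, Preadditive.sum_comp]
        _ = unitActRight V (ζ s a') := by rw [hsum, unitActLeft_id, Category.id_comp]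
    have hr : ∀ s, ∃ r : k, s ∈ insert t S → ∀ a, ζ s a = r • 𝟙 (𝟙 a) := fun s => by
      by_cases hs : s ∈ insert t S
      · obtain ⟨r, hr⟩ := hk (ζ s) (hζ s hs)
        exact ⟨r, fun _ => hr⟩
      · exact ⟨0, fun h => absurd h hs⟩
    choose r hr using hr
    have hrel : ∑ s ∈ insert t S, r s • x s = 0 := by
      have h1 : ∀ s ∈ insert t S, r s • x s =
          ∑ j, unitActLeft (γ (q b j) (hq b j) s) (𝟙 b) ≫ unitActRight (𝟙 b) (x s) := by
        intro s hs
        have h2 : r s • x s = ζ s b ≫ x s := by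
          rw [hr s hs, Linear.smul_comp, Category.id_comp]
        rw [h2]
        simp only [unitActLeft_one, unitActRight_one, ζ]
        exact Preadditive.sum_comp _ _ _
      rw [Finset.sum_congr rfl h1, Finset.sum_comm]
      exact Finset.sum_eq_zero fun j _ => hγrel _ _ (𝟙 b)
    have hrt := linearIndependent_iff'.1 hx _ _ hrel t (Finset.mem_insert_self _ _)
    -- the coefficient at `t` is one
    have h1 : ζ t d = 𝟙 (𝟙 d) := by
      simp only [ζ, hγt]
      exact hsum d
    rw [hr t (Finset.mem_insert_self _ _) d, hrt, zero_smul] at h1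
    apply he.ne_zero
    rw [← Category.comp_id e, ← h1, comp_zero]

end Independence

/-! ### Finiteness over the center -/

section FiniteOverCenter

variable {C : Type u} [Bicategory.{w, v} C] [PreadditiveBicategory C]
variable {k : Type*} [Field k] [LinearBicategory k C]

theorem IsUnitRelation.eq_zero (hconn : IsConnectedBicategory C)
    (hss : IsSemisimpleBicategory C) (hrigid : IsRigidBicategory C)
    (hk : HasScalarCenter k C) {b : C} {ι : Type*} {x : ι → (𝟙 b ⟶ 𝟙 b)}
    (hx : LinearIndependent k x) (S : Finset ι) {c : ι → (𝟙 b ⟶ 𝟙 b)}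
    (hc : IsUnitRelation S x c) (s : ι) (hs : s ∈ S) : c s = 0 := by
  obtain ⟨J, _, e, he, hsum⟩ := hss.exists_sum_eq_id b
  rw [← Category.id_comp (c s), ← hsum, Preadditive.sum_comp]
  exact Finset.sum_eq_zero fun j _ => hc.comp_eq_zero hconn hss hrigid hk hx S (he j) s hs

/-- A relation only has to be checked on simple 1-morphisms. -/
theorem isUnitRelation_of_simple (hss : IsSemisimpleBicategory C) {b d : C} {ι : Type*}
    {S : Finset ι} {x : ι → (𝟙 b ⟶ 𝟙 b)} {c : ι → (𝟙 d ⟶ 𝟙 d)}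
    (h : ∀ V : d ⟶ b, Simple V → ∑ s ∈ S, unitActLeft (c s) V ≫ unitActRight V (x s) = 0) :
    IsUnitRelation S x c :=
  (hss d b).eq_zero_of_simple (fun V => ∑ s ∈ S, unitActLeft (c s) V ≫ unitActRight V (x s))
    (fun {V W} f => by
      simp only [Preadditive.sum_comp, Preadditive.comp_sum, Category.assoc,
        unitActRight_naturality, unitActLeft_naturality_assoc]) h

/-- The matrix of the right actions of linearly independent elements of `End(𝟙 b)`, expressed in
generators of the endomorphism modules of the finitely many simple 1-morphisms, has linearly
independent rows over the commutative ring `End(𝟙 b)`. So there are only finitely many rows. -/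
theorem finite_unit_end (hconn : IsConnectedBicategory C)
    (hss : IsSemisimpleBicategory C) (hrigid : IsRigidBicategory C)
    (hfin : HasFinitelyManySimples C) (hk : HasScalarCenter k C) (b : C) :
    Module.Finite k (𝟙 b ⟶ 𝟙 b) := by
  by_cases hb : 𝟙 (𝟙 b) = 0
  · have : Subsingleton (𝟙 b ⟶ 𝟙 b) := ⟨fun f g => by
      rw [← Category.comp_id f, hb, comp_zero, ← Category.comp_id g, hb, comp_zero]⟩
    infer_instance
  have : Nontrivial (End (𝟙 b)) := ⟨⟨𝟙 _, 0, hb⟩⟩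
  let x := Module.Basis.ofVectorSpace k (𝟙 b ⟶ 𝟙 b)
  obtain ⟨J, _, R, hR⟩ := hfin.exists_representatives b b
  choose I hI g hg using fun j => exists_hom_generators hss hrigid (R j) (R j)
  choose c hc using fun j => hg j
  -- the right actions of the basis elements in terms of the generators
  let m : Module.Basis.ofVectorSpaceIndex k (𝟙 b ⟶ 𝟙 b) → (Σ j, I j) → End (𝟙 b) :=
    fun s i => c i.1 (unitActRight (R i.1) (x s)) i.2
  have hm : LinearIndependent (End (𝟙 b)) m := by
    rw [linearIndependent_iff']
    intro S a ha s hs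
    refine IsUnitRelation.eq_zero hconn hss hrigid hk x.linearIndependent S (c := a) ?_ s hs
    refine isUnitRelation_of_simple hss fun V hV => ?_
    obtain ⟨j, ⟨f⟩⟩ := hR V hV
    have h1 : ∑ s ∈ S, unitActLeft (a s) (R j) ≫ unitActRight (R j) (x s) = 0 := by
      have h2 : ∀ s, unitActLeft (a s) (R j) ≫ unitActRight (R j) (x s) =
          ∑ i, unitActLeft (a s ≫ m s ⟨j, i⟩) (R j) ≫ g j i := fun s => by
        conv_lhs => rw [hc j (unitActRight (R j) (x s))]
        simp only [Preadditive.comp_sum, unitActLeft_comp, Category.assoc, m]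
      simp only [h2]
      rw [Finset.sum_comm]
      refine Finset.sum_eq_zero fun i _ => ?_
      have h3 : ∑ s ∈ S, a s ≫ m s ⟨j, i⟩ = 0 := by
        have h4 := congrFun ha ⟨j, i⟩
        rw [Finset.sum_apply] at h4
        refine Eq.trans (Finset.sum_congr rfl fun s _ => ?_) h4
        exact unit_end_comm _ _
      rw [← Preadditive.sum_comp, ← unitActLeft_sum, h3, unitActLeft_zero, zero_comp]
    rw [← cancel_mono f.hom, zero_comp, Preadditive.sum_comp]
    simp only [Category.assoc, unitActRight_naturality, unitActLeft_naturality_assoc]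
    rw [← Preadditive.comp_sum, h1, comp_zero]
  have := hm.finite
  exact Module.Finite.of_basis x

theorem finite_hom (hconn : IsConnectedBicategory C)
    (hss : IsSemisimpleBicategory C) (hrigid : IsRigidBicategory C)
    (hfin : HasFinitelyManySimples C) (hk : HasScalarCenter k C) {a b : C} (V W : a ⟶ b) :
    Module.Finite k (V ⟶ W) := by
  have := finite_unit_end hconn hss hrigid hfin hk a
  obtain ⟨J, _, g, hg⟩ := exists_hom_generators hss hrigid V W
  let f : (J → (𝟙 a ⟶ 𝟙 a)) →ₗ[k] (V ⟶ W) :=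
    { toFun c := ∑ j, unitActLeft (c j) V ≫ g j
      map_add' c c' := by simp [unitActLeft_add, Finset.sum_add_distrib]
      map_smul' r c := by
        simp [unitActLeft, LinearBicategory.smul_whiskerRight, Finset.smul_sum] }
  refine Module.Finite.of_surjective f fun h => ?_
  obtain ⟨c, hc⟩ := hg h
  exact ⟨c, hc.symm⟩

end FiniteOverCenter

/-! ### Separability over the center -/

section Separable

variable {C : Type u} [Bicategory.{w, v} C] [PreadditiveBicategory C]
variable {k : Type*} [Field k] [LinearBicategory k C]

variable (k) in
/-- The action from the left of the endomorphisms of a 1-identity. -/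
noncomputable def unitActLeftHom {a b : C} (V : a ⟶ b) : End (𝟙 a) →ₐ[k] End V :=
  AlgHom.ofLinearMap
    { toFun z := unitActLeft z V
      map_add' z z' := unitActLeft_add z z' V
      map_smul' r z := by
        change unitActLeft (r • (show 𝟙 a ⟶ 𝟙 a from z)) V = r • unitActLeft z V
        simp [unitActLeft, LinearBicategory.smul_whiskerRight] }
    (unitActLeft_id V) fun z z' => unitActLeft_comp z' z V

variable (k) in
/-- The action from the right of the endomorphisms of a 1-identity. -/
noncomputable def unitActRightHom {a b : C} (V : a ⟶ b) : End (𝟙 b) →ₐ[k] End V :=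
  AlgHom.ofLinearMap
    { toFun z := unitActRight V z
      map_add' z z' := unitActRight_add V z z'
      map_smul' r z := by
        change unitActRight V (r • (show 𝟙 b ⟶ 𝟙 b from z)) = r • unitActRight V z
        simp [unitActRight, LinearBicategory.whiskerLeft_smul] }
    (unitActRight_id V) fun z z' => unitActRight_comp V z' z

variable (k) in
/-- The action from both sides of the endomorphisms of 1-identities. -/
noncomputable def unitActHom {a b : C} (V : a ⟶ b) : End (𝟙 a) ⊗[k] End (𝟙 b) →ₐ[k] End V :=
  Algebra.TensorProduct.lift (unitActLeftHom k V) (unitActRightHom k V) fun z z' =>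
    (unitActLeft_naturality z (unitActRight V z')).symm

theorem unitActHom_tmul {a b : C} (V : a ⟶ b) (z : 𝟙 a ⟶ 𝟙 a) (z' : 𝟙 b ⟶ 𝟙 b) :
    unitActHom k V ((show End (𝟙 a) from z) ⊗ₜ[k] (show End (𝟙 b) from z')) =
      unitActLeft z V ≫ unitActRight V z' := by
  refine (Algebra.TensorProduct.lift_tmul ..).trans ?_
  exact (unitActLeft_naturality z (unitActRight V z')).symm

/-- The endomorphism ring of a 1-identity is unramified over the center: its tensor square acts
faithfully on the simple 1-morphisms, whose endomorphism rings are division rings, so that it is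
reduced, and in a reduced Artinian ring the kernel of the multiplication is idempotent. -/
theorem formallyUnramified_unit_end (hconn : IsConnectedBicategory C)
    (hss : IsSemisimpleBicategory C) (hrigid : IsRigidBicategory C)
    (hfin : HasFinitelyManySimples C) (hk : HasScalarCenter k C) (b : C) :
    Algebra.FormallyUnramified k (End (𝟙 b)) := by
  have hf : Module.Finite k (End (𝟙 b)) := finite_unit_end hconn hss hrigid hfin hk b
  have hred : IsReduced (End (𝟙 b) ⊗[k] End (𝟙 b)) := by
    refine ⟨fun y ⟨n, hn⟩ => ?_⟩
    have h1 : ∀ V : b ⟶ b, Simple V → unitActHom k V y = 0 := fun V hV => by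
      have := (hss b b).hasKernels
      have h2 : unitActHom k V y ^ n = 0 := by rw [← map_pow, hn, map_zero]
      by_contra h0
      have := (isIso_iff_nonzero (unitActHom k V y)).2 h0
      have h3 : IsUnit (unitActHom k V y) := (isUnit_iff_isIso _).2 this
      have h4 := h3.pow n
      rw [h2] at h4
      exact id_nonzero V (by simpa using (isUnit_zero_iff.1 h4).symm)
    let x := Module.finBasis k (End (𝟙 b))
    let c := (Algebra.TensorProduct.basis (End (𝟙 b)) x).repr y
    have hy : y = ∑ s, c s ⊗ₜ[k] x s := by
      rw [← (Algebra.TensorProduct.basis (End (𝟙 b)) x).sum_repr y]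
      refine Finset.sum_congr rfl fun s _ => ?_
      rw [Algebra.TensorProduct.basis_apply, TensorProduct.smul_tmul', smul_eq_mul, mul_one]
    have h2 : IsUnitRelation Finset.univ (fun s => x s) (fun s => c s) :=
      isUnitRelation_of_simple hss fun V hV => by
        have h3 := h1 V hV
        rw [hy, map_sum] at h3
        rw [← h3]
        exact Finset.sum_congr rfl fun s _ => (unitActHom_tmul V _ _).symm
    rw [hy]
    refine Finset.sum_eq_zero fun s _ => ?_
    have h3 : c s = 0 := IsUnitRelation.eq_zero hconn hss hrigid hk x.linearIndependent
      Finset.univ h2 s (Finset.mem_univ s)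
    rw [h3, TensorProduct.zero_tmul]
  have : IsArtinianRing (End (𝟙 b) ⊗[k] End (𝟙 b)) := IsArtinianRing.of_finite k _
  have : IsSemisimpleRing (End (𝟙 b) ⊗[k] End (𝟙 b)) :=
    IsArtinianRing.isSemisimpleRing_of_isReduced _
  constructor
  refine (Ideal.cotangent_subsingleton_iff _).2 ?_
  obtain ⟨e, he, h⟩ := IsSemisimpleRing.ideal_eq_span_idempotent
    (KaehlerDifferential.ideal k (End (𝟙 b)))
  rw [h]
  exact (Ideal.span_singleton_mul_span_singleton e e).trans (by rw [he.eq])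

end Separable

/-! ### The ground field -/

section GroundField

variable {C : Type u} [Bicategory.{w, v} C] [PreadditiveBicategory C]

/-- The center, or any field if `C` is zero, as a field in the universe of the 2-morphisms. -/
theorem exists_linear_hasScalarCenter (hconn : IsConnectedBicategory C)
    (hss : IsSemisimpleBicategory C) (hrigid : IsRigidBicategory C) :
    ∃ (k : Type w) (_ : Field k) (_ : LinearBicategory k C), HasScalarCenter k C := by
  by_cases h : ∃ a : C, 𝟙 (𝟙 a) ≠ 0
  · obtain ⟨a, ha⟩ := h
    have hfield := bicategoryCenter.isField hconn hss hrigid ha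
    let _ : Field (bicategoryCenter C) := hfield.toField
    have : Nontrivial (End (𝟙 a)) := ⟨⟨𝟙 _, 0, ha⟩⟩
    let ev : bicategoryCenter C →+* End (𝟙 a) :=
      (Pi.evalRingHom (fun a : C => End (𝟙 a)) a).comp (bicategoryCenter C).subtype
    have : Small.{w} (bicategoryCenter C) := small_of_injective ev.injective
    let φ : Shrink.{w} (bicategoryCenter C) ≃+* bicategoryCenter C := Shrink.ringEquiv _
    refine ⟨Shrink.{w} (bicategoryCenter C), inferInstance,
      linearBicategoryOfCenter φ.toRingHom, fun z hz => ⟨φ.symm ⟨z, hz⟩, fun a => ?_⟩⟩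
    change z a = unitActLeft ((φ (φ.symm ⟨z, hz⟩)).1 a) (𝟙 a) ≫ 𝟙 (𝟙 a)
    rw [RingEquiv.apply_symm_apply, Category.comp_id, unitActLeft_one]
  · push Not at h
    have h0 : ∀ {a : C} (f : 𝟙 a ⟶ 𝟙 a), f = 0 := fun {a} f => by
      rw [← Category.comp_id f, h a, comp_zero]
    -- the center is the zero ring
    let φ : ULift.{w} ℚ →+* bicategoryCenter C :=
      { toFun _ := 0
        map_one' := Subtype.ext (funext fun a => (h0 _).symm)
        map_mul' _ _ := (mul_zero _).symm
        map_zero' := rfl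
        map_add' _ _ := (add_zero _).symm }
    exact ⟨ULift.{w} ℚ, inferInstance, linearBicategoryOfCenter φ,
      fun z _ => ⟨0, fun a => (h0 (z a)).trans (h0 _).symm⟩⟩

end GroundField

/-! ### Unfolding along decompositions of the 1-identities -/

/-- Decompositions of all 1-identities of a 2-category into finitely many direct summands. -/
structure UnitDecomposition (D : Type u) [Bicategory.{w, v} D] [PreadditiveBicategory D] where
  /-- the number of summands -/
  num : D → ℕ
  /-- the summands -/
  obj (A : D) : Fin (num A) → (A ⟶ A)
  ι {A : D} (s : Fin (num A)) : obj A s ⟶ 𝟙 A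
  π {A : D} (s : Fin (num A)) : 𝟙 A ⟶ obj A s
  ι_π {A : D} (s : Fin (num A)) : ι s ≫ π s = 𝟙 _
  ι_π_ne {A : D} (s t : Fin (num A)) (h : s ≠ t) : ι s ≫ π t = 0
  total (A : D) : ∑ s : Fin (num A), π s ≫ ι s = 𝟙 (𝟙 A)

namespace UnitDecomposition

variable {D : Type u} [Bicategory.{w, v} D] [PreadditiveBicategory D]

attribute [simp] ι_π

@[simp]
theorem ι_π_assoc (F : UnitDecomposition D) {A : D} (s : Fin (F.num A)) {V : A ⟶ A}
    (f : F.obj A s ⟶ V) : F.ι s ≫ F.π s ≫ f = f := by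
  rw [← Category.assoc, ι_π, Category.id_comp]

/-- The 2-category whose objects are the chosen summands of the 1-identities of `D`, and whose
1-morphisms from `s` to `t` are those 1-morphisms of `D` that equal their own component from `s`
to `t`. -/
structure Unfolding (F : UnitDecomposition D) where
  pt : D
  idx : Fin (F.num pt)

variable (F : UnitDecomposition D)

/-- The projection to a summand of a 1-identity. -/
def proj {A : D} (s : Fin (F.num A)) : 𝟙 A ⟶ 𝟙 A := F.π s ≫ F.ι s

/-- The 1-morphisms of `D` that equal their own component from the summand `s` to the
summand `t`: both projections act on them as the identity. -/
def component {A B : D} (s : Fin (F.num A)) (t : Fin (F.num B)) : ObjectProperty (A ⟶ B) :=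
  fun V => unitActLeft (F.proj s) V = 𝟙 V ∧ unitActRight V (F.proj t) = 𝟙 V

variable {F}

theorem mono_ι {A : D} (s : Fin (F.num A)) : Mono (F.ι s) :=
  ⟨fun f g h => by simpa using h =≫ F.π s⟩

theorem component_obj {A : D} (s : Fin (F.num A)) : F.component s s (F.obj A s) := by
  have := mono_ι s
  constructor
  · rw [← cancel_mono (F.ι s), unitActLeft_naturality, unitActLeft_one]
    simp [proj]
  · rw [← cancel_mono (F.ι s), unitActRight_naturality, unitActRight_one]
    simp [proj]

theorem component_comp {A B B' : D} {s : Fin (F.num A)} {t : Fin (F.num B)} {r : Fin (F.num B')}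
    {V : A ⟶ B} {W : B ⟶ B'} (hV : F.component s t V) (hW : F.component t r W) :
    F.component s r (V ≫ W) := by
  constructor
  · rw [unitActLeft_comp_right, hV.1, id_whiskerRight]
  · rw [unitActRight_comp_left, hW.2, whiskerLeft_id]

theorem component_of_retract {A B : D} {s : Fin (F.num A)} {t : Fin (F.num B)} {V W : A ⟶ B}
    (i : W ⟶ V) (r : V ⟶ W) (h : i ≫ r = 𝟙 W) (hV : F.component s t V) : F.component s t W := by
  constructor
  · rw [← Category.comp_id (unitActLeft _ _), ← h, unitActLeft_naturality_assoc, hV.1,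
      Category.id_comp]
  · rw [← Category.comp_id (unitActRight _ _), ← h, unitActRight_naturality_assoc, hV.2,
      Category.id_comp]

/-- The left unitor of the unfolding: the inclusion of the summand followed by the left unitor
of `D`, which is invertible on the 1-morphisms that start at the summand. -/
def leftUnitorIso {A B : D} (s : Fin (F.num A)) {V : A ⟶ B} (h : unitActLeft (F.proj s) V = 𝟙 V) :
    F.obj A s ≫ V ≅ V where
  hom := F.ι s ▷ V ≫ (λ_ V).hom
  inv := (λ_ V).inv ≫ F.π s ▷ V
  hom_inv_id := by simp [← comp_whiskerRight]
  inv_hom_id := by simpa [unitActLeft, proj] using h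

/-- The right unitor of the unfolding. -/
def rightUnitorIso {A B : D} (t : Fin (F.num B)) {V : A ⟶ B}
    (h : unitActRight V (F.proj t) = 𝟙 V) : V ≫ F.obj B t ≅ V where
  hom := V ◁ F.ι t ≫ (ρ_ V).hom
  inv := (ρ_ V).inv ≫ V ◁ F.π t
  hom_inv_id := by simp [← whiskerLeft_comp]
  inv_hom_id := by simpa [unitActRight, proj] using h

namespace Unfolding

instance : Bicategory.{w, v} (Unfolding F) where
  Hom x y := (F.component x.idx y.idx).FullSubcategory
  id x := ⟨F.obj x.pt x.idx, component_obj x.idx⟩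
  comp V W := ⟨V.obj ≫ W.obj, component_comp V.property W.property⟩
  homCategory x y := inferInstanceAs (Category (F.component x.idx y.idx).FullSubcategory)
  whiskerLeft V _ _ η := ⟨V.obj ◁ η.hom⟩
  whiskerRight η W := ⟨η.hom ▷ W.obj⟩
  associator V W X := ObjectProperty.isoMk _ (α_ V.obj W.obj X.obj)
  leftUnitor {x _} V := ObjectProperty.isoMk _ (leftUnitorIso x.idx V.property.1)
  rightUnitor {_ y} V := ObjectProperty.isoMk _ (rightUnitorIso y.idx V.property.2)
  whiskerLeft_id V W := InducedCategory.hom_ext (whiskerLeft_id V.obj W.obj)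
  whiskerLeft_comp V _ _ _ η θ := InducedCategory.hom_ext (whiskerLeft_comp V.obj η.hom θ.hom)
  id_whiskerLeft {x _ _ _} η := InducedCategory.hom_ext <| by
    change F.obj x.pt x.idx ◁ η.hom = (F.ι x.idx ▷ _ ≫ (λ_ _).hom) ≫ η.hom ≫
      (λ_ _).inv ≫ F.π x.idx ▷ _
    simp only [Category.assoc]
    rw [← leftUnitor_naturality_assoc, Iso.hom_inv_id_assoc, ← whisker_exchange_assoc,
      ← comp_whiskerRight, ι_π, id_whiskerRight, Category.comp_id]
  comp_whiskerLeft V W _ _ η := InducedCategory.hom_ext (comp_whiskerLeft V.obj W.obj η.hom)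
  id_whiskerRight V W := InducedCategory.hom_ext (id_whiskerRight V.obj W.obj)
  comp_whiskerRight η θ W := InducedCategory.hom_ext (comp_whiskerRight η.hom θ.hom W.obj)
  whiskerRight_id {_ y _ _} η := InducedCategory.hom_ext <| by
    change η.hom ▷ F.obj y.pt y.idx = (_ ◁ F.ι y.idx ≫ (ρ_ _).hom) ≫ η.hom ≫
      (ρ_ _).inv ≫ _ ◁ F.π y.idx
    simp only [Category.assoc]
    rw [← rightUnitor_naturality_assoc, Iso.hom_inv_id_assoc, whisker_exchange_assoc,
      ← whiskerLeft_comp, ι_π, whiskerLeft_id, Category.comp_id]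
  whiskerRight_comp η V W := InducedCategory.hom_ext (whiskerRight_comp η.hom V.obj W.obj)
  whisker_assoc V _ _ η W := InducedCategory.hom_ext (whisker_assoc V.obj η.hom W.obj)
  whisker_exchange η θ := InducedCategory.hom_ext (whisker_exchange η.hom θ.hom)
  pentagon V W X Y := InducedCategory.hom_ext (pentagon V.obj W.obj X.obj Y.obj)
  triangle {_ y _} V W := InducedCategory.hom_ext <| by
    change (α_ V.obj (F.obj y.pt y.idx) W.obj).hom ≫ V.obj ◁ (F.ι y.idx ▷ _ ≫ (λ_ _).hom) =
      (V.obj ◁ F.ι y.idx ≫ (ρ_ _).hom) ▷ W.obj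
    simp

instance : PreadditiveBicategory (Unfolding F) where
  homPreadditive x y := inferInstanceAs (Preadditive (F.component x.idx y.idx).FullSubcategory)
  whiskerLeft_add V _ _ η θ :=
    InducedCategory.hom_ext (PreadditiveBicategory.whiskerLeft_add V.obj η.hom θ.hom)
  add_whiskerRight η θ W :=
    InducedCategory.hom_ext (PreadditiveBicategory.add_whiskerRight η.hom θ.hom W.obj)

instance {K : Type*} [CommRing K] [LinearBicategory K D] : LinearBicategory K (Unfolding F) where
  homLinear x y := inferInstanceAs (Linear K (F.component x.idx y.idx).FullSubcategory)
  whiskerLeft_smul V _ _ r η :=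
    InducedCategory.hom_ext (LinearBicategory.whiskerLeft_smul V.obj r η.hom)
  smul_whiskerRight r η W :=
    InducedCategory.hom_ext (LinearBicategory.smul_whiskerRight r η.hom W.obj)

end Unfolding

end UnitDecomposition

/-- In a von Neumann regular category, an object with scalar endomorphisms is simple. -/
theorem IsRegularCategory.isStronglySimple {A : Type*} [Category A] [Preadditive A]
    (h : IsRegularCategory A) {K : Type*} [Field K] [Linear K A] {X : A}
    (hb : Function.Bijective fun c : K => c • 𝟙 X) : IsStronglySimple K X := by
  refine ⟨h.simple_of_isIso (fun h0 => ?_) fun f hf => ?_, hb⟩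
  · exact one_ne_zero (hb.1 (show (1 : K) • 𝟙 X = (0 : K) • 𝟙 X by rw [h0, smul_zero, smul_zero]))
  · obtain ⟨c, rfl⟩ := hb.2 f
    have hc : c ≠ 0 := by
      rintro rfl
      exact hf (zero_smul _ _)
    exact ⟨c⁻¹ • 𝟙 _, by simp [hc], by simp [hc]⟩

/-! ### Semisimplicity of the unfolding and the folding -/

namespace UnitDecomposition

variable {D : Type u} [Bicategory.{w, v} D] [PreadditiveBicategory D] {F : UnitDecomposition D}

theorem component_of_total {A B : D} {s : Fin (F.num A)} {t : Fin (F.num B)} {J : Type*} [Fintype J]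
    {V : A ⟶ B} {S : J → (A ⟶ B)} (i : ∀ j, S j ⟶ V) (r : ∀ j, V ⟶ S j)
    (htot : ∑ j, r j ≫ i j = 𝟙 V) (hS : ∀ j, F.component s t (S j)) : F.component s t V := by
  constructor
  · rw [← Category.comp_id (unitActLeft _ _), ← htot, Preadditive.comp_sum]
    refine Finset.sum_congr rfl fun j _ => ?_
    rw [unitActLeft_naturality_assoc, (hS j).1, Category.id_comp]
  · rw [← Category.comp_id (unitActRight _ _), ← htot, Preadditive.comp_sum]
    refine Finset.sum_congr rfl fun j _ => ?_
    rw [unitActRight_naturality_assoc, (hS j).2, Category.id_comp]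

section Semisimple

variable {A B : D} (s : Fin (F.num A)) (t : Fin (F.num B))

theorem isRegularCategory_component (h : IsRegularCategory (A ⟶ B)) :
    IsRegularCategory (F.component s t).FullSubcategory := fun _ _ f => by
  obtain ⟨g, hg⟩ := h f.hom
  exact ⟨⟨g⟩, InducedCategory.hom_ext hg⟩

theorem isIdempotentComplete_component (h : IsIdempotentComplete (A ⟶ B)) :
    IsIdempotentComplete (F.component s t).FullSubcategory where
  idempotents_split V p hp := by
    obtain ⟨W, i, e, hie, hei⟩ := h.idempotents_split V.obj p.hom (congrArg (·.hom) hp)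
    exact ⟨⟨W, component_of_retract i e hie V.property⟩, ⟨i⟩, ⟨e⟩, InducedCategory.hom_ext hie,
      InducedCategory.hom_ext hei⟩

theorem hasFiniteBiproducts_component [HasFiniteBiproducts (A ⟶ B)] :
    HasFiniteBiproducts (F.component s t).FullSubcategory where
  out n :=
    { has_biproduct f := by
        let b : Bicone f :=
          { pt := ⟨⨁ fun j => (f j).obj, component_of_total
              (fun j => biproduct.ι (fun j => (f j).obj) j)
              (fun j => biproduct.π (fun j => (f j).obj) j) biproduct.total
              fun j => (f j).property⟩
            π j := ⟨biproduct.π (fun j => (f j).obj) j⟩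
            ι j := ⟨biproduct.ι (fun j => (f j).obj) j⟩
            ι_π j l := InducedCategory.hom_ext <| by
              by_cases h : j = l
              · subst h
                simp
              · simp [h, biproduct.ι_π_ne _ h] }
        refine hasBiproduct_of_total b ((F.component s t).ι.map_injective ?_)
        rw [Functor.map_sum]
        exact biproduct.total (f := fun j => (f j).obj) }

end Semisimple

variable {K : Type*} [Field K] [LinearBicategory K D]

theorem finite_hom_component (hfin : ∀ (A B : D) (V W : A ⟶ B), Module.Finite K (V ⟶ W)) {A B : D}
    {s : Fin (F.num A)} {t : Fin (F.num B)} (V W : (F.component s t).FullSubcategory) :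
    Module.Finite K (V ⟶ W) := by
  have := hfin A B V.obj W.obj
  exact Module.Finite.of_injective ((F.component s t).ι.mapLinearMap K)
    (F.component s t).ι.map_injective

namespace Unfolding

theorem isSemisimpleBicategory (h : IsSemisimpleBicategory D)
    (hidem : ∀ A B : D, IsIdempotentComplete (A ⟶ B))
    (hfin : ∀ (A B : D) (V W : A ⟶ B), Module.Finite K (V ⟶ W)) :
    IsSemisimpleBicategory (Unfolding F) := fun x y =>
  have hr := isRegularCategory_component x.idx y.idx (h x.pt y.pt).isRegularCategory
  have := isIdempotentComplete_component x.idx y.idx (hidem x.pt y.pt)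
  have := (h x.pt y.pt).hasFiniteBiproducts
  have := hasFiniteBiproducts_component x.idx y.idx
  hr.isSemisimpleCategory fun V => hr.isFiniteSumOfSimples K V fun W =>
    finite_hom_component hfin W W

theorem isStronglySimple_id (h : IsSemisimpleBicategory D)
    (hbij : ∀ (A : D) s, Function.Bijective fun c : K => c • 𝟙 (F.obj A s)) (x : Unfolding F) :
    IsStronglySimple K (𝟙 x) := by
  have hb : Function.Bijective fun c : K => c • 𝟙 (𝟙 x) := by
    constructor
    · intro c d hcd
      exact (hbij x.pt x.idx).1 (congrArg (·.hom) hcd)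
    · intro f
      obtain ⟨c, hc⟩ := (hbij x.pt x.idx).2 f.hom
      exact ⟨c, InducedCategory.hom_ext hc⟩
  exact (isRegularCategory_component x.idx x.idx
    (h x.pt x.pt).isRegularCategory).isStronglySimple hb

variable (K F) in
/-- A 2-category is a folded form of its unfolding. -/
def folding : Folding K (Unfolding F) D where
  num := F.num
  pt A s := ⟨A, s⟩
  bijective := ⟨fun ⟨_, _⟩ ⟨_, _⟩ h => by cases h; rfl, fun ⟨A, s⟩ => ⟨⟨A, s⟩, rfl⟩⟩
  map s t := (F.component s t).ι
  full s t := inferInstanceAs (F.component s t).ι.Full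
  faithful s t := inferInstanceAs (F.component s t).ι.Faithful
  additive s t := inferInstanceAs (F.component s t).ι.Additive
  linear s t := inferInstanceAs ((F.component s t).ι.Linear K)
  mapComp f g := Iso.refl _
  ι s := F.ι s
  mapComp_naturality_left η g := (Category.comp_id _).trans (Category.id_comp _).symm
  mapComp_naturality_right f _ _ η := (Category.comp_id _).trans (Category.id_comp _).symm
  map_associator f g h := by
    simp only [Iso.refl_hom, whiskerLeft_id, id_whiskerRight, Category.id_comp]
    erw [Category.comp_id]
    rfl
  map_leftUnitor f := (Category.id_comp _).symm
  map_rightUnitor f := (Category.id_comp _).symm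
  isColimit A := ⟨Cofan.IsColimit.mk _ (fun c => ∑ s, F.π s ≫ c.inj s)
    (fun c s => by
      rw [Preadditive.comp_sum, Finset.sum_eq_single s]
      · simp
      · intro t _ hts
        change F.ι s ≫ F.π t ≫ _ = 0
        rw [← Category.assoc, F.ι_π_ne s t hts.symm, zero_comp]
      · simp)
    (fun c m hm => by
      refine (Category.id_comp m).symm.trans ?_
      change 𝟙 (𝟙 A) ≫ m = _
      rw [← F.total A, Preadditive.sum_comp]
      exact Finset.sum_congr rfl fun s _ => by rw [← hm s, Category.assoc]; rfl)⟩
  mem_essImage {A B} s t V hs ht := by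
    refine ⟨⟨V, ?_, ?_⟩, ⟨Iso.refl _⟩⟩
    · have : IsIso (F.ι s ▷ V ≫ (λ_ V).hom) := hs
      rw [← cancel_epi (F.ι s ▷ V ≫ (λ_ V).hom)]
      simp only [unitActLeft, proj, Category.assoc, Iso.hom_inv_id_assoc, Category.comp_id]
      rw [← comp_whiskerRight_assoc, ι_π_assoc]
    · have : IsIso (V ◁ F.ι t ≫ (ρ_ V).hom) := ht
      rw [← cancel_epi (V ◁ F.ι t ≫ (ρ_ V).hom)]
      simp only [unitActRight, proj, Category.assoc, Iso.hom_inv_id_assoc, Category.comp_id]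
      rw [← whiskerLeft_comp_assoc, ι_π_assoc]

end Unfolding

end UnitDecomposition

/-! ### Scalar endomorphisms over a separably closed field -/

section SepClosed

variable {K : Type*} [Field K] [IsSepClosed K]

/-- A homomorphism from a finite unramified algebra over a separably closed field to a domain has
scalar values: its image is a finite separable field extension. -/
theorem exists_algebraMap_eq_of_formallyUnramified {T E : Type*} [CommRing T] [Algebra K T]
    [Module.Finite K T] [Algebra.FormallyUnramified K T] [Ring E] [IsDomain E] [Algebra K E]
    (φ : T →ₐ[K] E) (t : T) : ∃ c, algebraMap K E c = φ t := by
  have hp : (RingHom.ker φ).IsPrime := RingHom.ker_isPrime φ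
  have : IsArtinianRing T := IsArtinianRing.of_finite K T
  have hm : (RingHom.ker φ).IsMaximal := inferInstance
  let _ : Field (T ⧸ RingHom.ker φ) := Ideal.Quotient.field _
  have : Algebra.FormallyUnramified K (T ⧸ RingHom.ker φ) :=
    .of_surjective (Ideal.Quotient.mkₐ K _) Ideal.Quotient.mk_surjective
  have : Algebra.IsSeparable K (T ⧸ RingHom.ker φ) := Algebra.FormallyUnramified.isSeparable _ _
  obtain ⟨c, hc⟩ := IsSepClosed.algebraMap_surjective K (T ⧸ RingHom.ker φ) (Ideal.Quotient.mk _ t)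
  refine ⟨c, ?_⟩
  have h1 : algebraMap K T c - t ∈ RingHom.ker φ := Ideal.Quotient.eq.1 hc
  rw [RingHom.mem_ker, map_sub, sub_eq_zero, AlgHom.commutes] at h1
  exact h1

/-- A division algebra with center `K` over a separably closed field `K` is trivial by the
Jacobson–Noether theorem, since separable elements are scalar. -/
theorem exists_algebraMap_eq_of_isCentral {E : Type*} [DivisionRing E] [Algebra K E]
    [Algebra.IsAlgebraic K E] [Algebra.IsCentral K E] (x : E) : ∃ c, algebraMap K E c = x := by
  have h : (⊥ : Subalgebra K E) = ⊤ := by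
    by_contra h
    obtain ⟨y, hy, hsep⟩ := JacobsonNoether.exists_separable_and_not_isCentral' h
    have hirr := minpoly.irreducible (A := K) (Algebra.IsIntegral.isIntegral y)
    exact hy (Algebra.mem_bot.2 (minpoly.mem_range_of_degree_eq_one K y
      (IsSepClosed.degree_eq_one_of_irreducible K hirr hsep)))
  exact Algebra.mem_bot.1 (h ▸ Algebra.mem_top)

variable {A : Type*} [Category A] [Preadditive A] [Linear K A] [HasKernels A]

/-- A finite unramified algebra of central endomorphisms of an object acts on the simple summands
of this object by scalars. -/
theorem exists_smul_eq_of_formallyUnramified {V M : A} [Simple V] (i : V ⟶ M) (r : M ⟶ V)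
    (h : i ≫ r = 𝟙 V) {T : Type*} [CommRing T] [Algebra K T]
    [Module.Finite K T] [Algebra.FormallyUnramified K T] (σ : T →ₐ[K] End M)
    (hσ : ∀ t f, σ t * f = f * σ t) (t : T) :
    ∃ c : K, c • 𝟙 V = i ≫ σ t ≫ r := by
  let τ : T → (M ⟶ M) := σ
  have hτ : ∀ t (f : M ⟶ M), τ t ≫ f = f ≫ τ t := fun t f => (hσ t f).symm
  let φ : T →ₐ[K] End V := AlgHom.ofLinearMap
    { toFun t := i ≫ τ t ≫ r
      map_add' s t := by
        have h1 : τ (s + t) = τ s + τ t := map_add σ s t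
        rw [h1, Preadditive.add_comp, Preadditive.comp_add]
      map_smul' c t := by
        have h1 : τ (c • t) = c • τ t := map_smul σ c t
        rw [h1, Linear.smul_comp, Linear.comp_smul]
        rfl }
    (by
      have h1 : τ 1 = 𝟙 M := map_one σ
      change i ≫ τ 1 ≫ r = 𝟙 V
      rw [h1, Category.id_comp, h])
    (fun s t => by
      have h1 : τ (s * t) = τ t ≫ τ s := map_mul σ s t
      change i ≫ τ (s * t) ≫ r = (i ≫ τ t ≫ r) ≫ i ≫ τ s ≫ r
      have h2 : τ s ≫ r ≫ i = r ≫ i ≫ τ s := by rw [hτ, Category.assoc]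
      simp only [h1, Category.assoc]
      rw [← reassoc_of% h2, h, Category.comp_id])
  have : IsDomain (End V) := inferInstance
  exact exists_algebraMap_eq_of_formallyUnramified φ t

/-- A simple object with scalar center of its endomorphism ring is strongly simple. -/
theorem isStronglySimple_of_center {V : A} [hV : Simple V] [Module.Finite K (V ⟶ V)]
    (h : ∀ z : V ⟶ V, (∀ f : V ⟶ V, z ≫ f = f ≫ z) → ∃ c : K, c • 𝟙 V = z) :
    IsStronglySimple K V := by
  refine ⟨hV, fun c d hcd => ?_, fun f => ?_⟩
  · have h1 : (c - d) • 𝟙 V = 0 := by rw [sub_smul, sub_eq_zero]; exact hcd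
    by_contra hne
    have h2 := congrArg ((c - d)⁻¹ • ·) h1
    simp only [smul_smul, inv_mul_cancel₀ (sub_ne_zero.2 hne), one_smul, smul_zero] at h2
    exact id_nonzero V h2
  · have : Module.Finite K (End V) := ‹Module.Finite K (V ⟶ V)›
    have : Algebra.IsAlgebraic K (End V) := Algebra.IsAlgebraic.of_finite K (End V)
    have : Algebra.IsCentral K (End V) := ⟨fun z hz => Algebra.mem_bot.2
      (h z fun f => (Subalgebra.mem_center_iff.1 hz f))⟩
    exact exists_algebraMap_eq_of_isCentral (K := K) (E := End V) f

end SepClosed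

/-- Every central endomorphism `z` of a simple summand `V` of a semisimple object `M` extends to a
central endomorphism of `M`, by `z` on the summands isomorphic to `V` and by zero on the others. -/
theorem IsFiniteSumOfSimples.exists_central_extension {A : Type*} [Category A] [Preadditive A]
    [HasKernels A] {V M : A} [Simple V] (hM : IsFiniteSumOfSimples M) (i : V ⟶ M) (r : M ⟶ V)
    (h : i ≫ r = 𝟙 V) (z : V ⟶ V) (hz : ∀ f : V ⟶ V, z ≫ f = f ≫ z) :
    ∃ y : M ⟶ M, (∀ f : M ⟶ M, y ≫ f = f ≫ y) ∧ i ≫ y ≫ r = z := by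
  obtain ⟨J, _, S, j, p, hS, -, -, htot⟩ := hM
  have key : ∀ q, ∃ (a : M ⟶ V) (b : V ⟶ M), (∀ g : V ⟶ M, g ≫ a ≫ b = g ≫ p q ≫ j q) ∧
      ∀ g : M ⟶ V, a ≫ b ≫ g = p q ≫ j q ≫ g := fun q => by
    by_cases hq : Nonempty (S q ≅ V)
    · obtain ⟨e⟩ := hq
      exact ⟨p q ≫ e.hom, e.inv ≫ j q, by simp, by simp⟩
    · have := hS q
      -- all morphisms between `V` and the summand vanish by Schur's lemma
      refine ⟨0, 0, fun g => ?_, fun g => ?_⟩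
      · have h0 : g ≫ p q = 0 := by
          by_contra h0
          have := isIso_of_hom_simple h0
          exact hq ⟨(asIso (g ≫ p q)).symm⟩
        rw [reassoc_of% h0]
        simp
      · have h0 : j q ≫ g = 0 := by
          by_contra h0
          have := isIso_of_hom_simple h0
          exact hq ⟨asIso (j q ≫ g)⟩
        rw [h0]
        simp
  choose a b hab hba using key
  have hab' : ∀ g : V ⟶ M, ∑ q, g ≫ a q ≫ b q = g := fun g => by
    rw [Finset.sum_congr rfl fun q _ => hab q g, ← Preadditive.comp_sum, htot, Category.comp_id]
  have hba' : ∀ g : M ⟶ V, ∑ q, a q ≫ b q ≫ g = g := fun g => by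
    rw [Finset.sum_congr rfl fun q _ => hba q g]
    simp only [← Category.assoc]
    rw [← Preadditive.sum_comp, htot, Category.id_comp]
  let y : M ⟶ M := ∑ q, a q ≫ z ≫ b q
  have hy1 : ∀ g : V ⟶ M, g ≫ y = z ≫ g := fun g => by
    conv_rhs => rw [← hab' g, Preadditive.comp_sum]
    rw [Preadditive.comp_sum]
    exact Finset.sum_congr rfl fun q _ => by
      rw [← Category.assoc, ← Category.assoc, ← hz, Category.assoc, Category.assoc]
  have hy2 : ∀ g : M ⟶ V, y ≫ g = g ≫ z := fun g => by
    conv_rhs => rw [← hba' g, Preadditive.sum_comp]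
    rw [Preadditive.sum_comp]
    exact Finset.sum_congr rfl fun q _ => by
      rw [Category.assoc, Category.assoc, hz]
      simp only [Category.assoc]
  let e : M ⟶ M := ∑ q, a q ≫ b q
  have he1 : ∀ g : V ⟶ M, g ≫ e = g := fun g => by rw [Preadditive.comp_sum, hab']
  refine ⟨y, fun f => ?_, by rw [hy2, reassoc_of% h]⟩
  have h1 : y ≫ f ≫ e = y ≫ f := by
    rw [Preadditive.sum_comp, Preadditive.sum_comp]
    exact Finset.sum_congr rfl fun q _ => by
      rw [Category.assoc, Category.assoc, ← Category.assoc (b q), he1]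
      simp only [Category.assoc]
  have h2 : y ≫ f ≫ e = ∑ q, y ≫ (f ≫ a q) ≫ b q := by
    simp only [e, Preadditive.comp_sum, Category.assoc]
  rw [← h1, h2, Preadditive.comp_sum]
  refine Finset.sum_congr rfl fun q _ => ?_
  rw [← Category.assoc, hy2]
  simp only [Category.assoc]

/-! ### Endomorphism rings in the base change -/

/-- A version of `Algebra.FormallyUnramified.of_isSeparable` for a domain that is not given as
a field. -/
theorem formallyUnramified_of_isSeparable {k R : Type*} [Field k] [CommRing R] [IsDomain R]
    [Algebra k R] (h : Algebra.IsSeparable k R) : Algebra.FormallyUnramified k R := by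
  have : Algebra.IsIntegral k R := ⟨fun x => (h.isSeparable' x).isIntegral⟩
  let _ : Field R := (isField_of_isIntegral_of_isField' (Field.toIsField k)).toField
  exact @Algebra.FormallyUnramified.of_isSeparable k R _ _ _ h

theorem formallyUnramified_center_of_isSeparable {k R : Type*} [Field k] [Ring R] [IsDomain R]
    [Algebra k R] (h : Algebra.IsSeparable k (Subalgebra.center k R)) :
    Algebra.FormallyUnramified k (Subalgebra.center k R) := by
  have : IsDomain (Subalgebra.center k R) := inferInstance
  exact formallyUnramified_of_isSeparable (k := k) (R := Subalgebra.center k R) h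

namespace ScalarExtCategory

section Hom

variable (k K : Type w) [CommRing k] [CommRing K] [Algebra k K]
variable {A : Type v} [Category.{w} A] [Preadditive A] [Linear k A]

/-- An object of `A` as an object of the base change. -/
def incl (X : A) : Karoubi (ScalarExtCategory k K A) := (toKaroubi _).obj ⟨X⟩

variable {k K}

/-- The morphism of the base change given by an element of `K ⊗ Hom(X, Y)`. -/
def inclMap {X Y : A} (f : K ⊗[k] (X ⟶ Y)) : incl k K X ⟶ incl k K Y :=
  (toKaroubi (ScalarExtCategory k K A)).map (X := ⟨X⟩) (Y := ⟨Y⟩) f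

variable (k K)

/-- The endomorphism ring of an object `X` of `A`, taken in the base change, is `K ⊗ End X`. -/
noncomputable def inclEnd (X : A) : K ⊗[k] End X →ₐ[K] End (incl k K X) :=
  AlgHom.ofLinearMap
    { toFun f := inclMap f
      map_add' _ _ := rfl
      map_smul' _ _ := rfl }
    rfl fun f g => by
      refine (congrArg inclMap (comp_eq_mul g f)).symm.trans ?_
      exact (toKaroubi (ScalarExtCategory k K A)).map_comp (X := ⟨X⟩) (Y := ⟨X⟩) (Z := ⟨X⟩) g f

theorem inclEnd_bijective (X : A) : Function.Bijective (inclEnd k K X) :=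
  ⟨fun _ _ h => congrArg Karoubi.Hom.f h, fun f => ⟨f.f, Karoubi.hom_ext _ _ rfl⟩⟩

end Hom

variable {k K : Type w} [Field k] [Field K] [Algebra k K] [IsSepClosed K]
variable {A : Type v} [Category.{w} A] [Preadditive A] [Linear k A]

/-- A central endomorphism of an object `X` of `A` in the base change acts on the simple summands
of `X` by a scalar if the center of `End X` is unramified, as this endomorphism is an
element of `K ⊗ center (End X)`. -/
theorem exists_smul_eq_of_central [HasKernels (Karoubi (ScalarExtCategory k K A))] {X : A}
    [hfin : Module.Finite k (X ⟶ X)]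
    [Algebra.FormallyUnramified k (Subalgebra.center k (End X))]
    {V : Karoubi (ScalarExtCategory k K A)} [Simple V] (i : V ⟶ incl k K X) (r : incl k K X ⟶ V)
    (h : i ≫ r = 𝟙 V) (z : incl k K X ⟶ incl k K X) (hz : ∀ f : incl k K X ⟶ incl k K X,
      z ≫ f = f ≫ z) : ∃ c : K, c • 𝟙 V = i ≫ z ≫ r := by
  have : Module.Finite k (End X) := hfin
  have : Module.Finite k (Subalgebra.center k (End X)) :=
    inferInstanceAs (Module.Finite k (Subalgebra.toSubmodule (Subalgebra.center k (End X))))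
  let σ : K ⊗[k] Subalgebra.center k (End X) →ₐ[K] End (incl k K X) :=
    (inclEnd k K X).comp
      (Algebra.TensorProduct.map (AlgHom.id K K) (Subalgebra.center k (End X)).val)
  obtain ⟨x, hx⟩ := (inclEnd_bijective k K X).2 z
  have hxc : x ∈ Subalgebra.centralizer k
      (Algebra.TensorProduct.includeRight : End X →ₐ[k] K ⊗[k] End X).range := by
    rw [Subalgebra.mem_centralizer_iff]
    intro y _
    refine (inclEnd_bijective k K X).1 ?_
    rw [map_mul, map_mul, hx]
    exact hz _
  rw [Subalgebra.centralizer_range_includeRight_eq_center_tensorProduct] at hxc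
  obtain ⟨t, rfl⟩ := hxc
  have hcomm : ∀ t (g : K ⊗[k] End X),
      Algebra.TensorProduct.map (AlgHom.id K K) (Subalgebra.center k (End X)).val t * g =
        g * Algebra.TensorProduct.map (AlgHom.id K K) (Subalgebra.center k (End X)).val t := by
    intro t g
    induction t using TensorProduct.induction_on with
    | zero => rw [map_zero, zero_mul, mul_zero]
    | add x y hx hy => rw [map_add, add_mul, mul_add, hx, hy]
    | tmul c l =>
      induction g using TensorProduct.induction_on with
      | zero => rw [zero_mul, mul_zero]
      | add x y hx hy => rw [add_mul, mul_add, hx, hy]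
      | tmul d g =>
        rw [Algebra.TensorProduct.map_tmul, Algebra.TensorProduct.tmul_mul_tmul,
          Algebra.TensorProduct.tmul_mul_tmul]
        exact congrArg₂ _ (mul_comm _ _) (Subalgebra.mem_center_iff.1 l.2 g).symm
  have hσ : ∀ t f, σ t * f = f * σ t := fun t f => by
    obtain ⟨g, rfl⟩ := (inclEnd_bijective k K X).2 f
    change inclEnd k K X _ * _ = _ * inclEnd k K X _
    rw [← map_mul, ← map_mul]
    exact congrArg _ (hcomm t g)
  obtain ⟨c, hc⟩ := exists_smul_eq_of_formallyUnramified (K := K) i r h σ hσ t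
  refine ⟨c, hc.trans ?_⟩
  rw [← hx]
  rfl

/-- Every simple object `V` of the base change is a direct summand of a simple object of `A`, and
central endomorphisms of `V` extend to the latter. -/
theorem isStronglySimple_of_isSeparable_center (hA : IsSemisimpleCategory A)
    (hfin : ∀ X Y : A, Module.Finite k (X ⟶ Y))
    (hsep : ∀ X : A, Simple X → Algebra.IsSeparable k (Subalgebra.center k (End X)))
    (hB : IsSemisimpleCategory (Karoubi (ScalarExtCategory k K A)))
    {V : Karoubi (ScalarExtCategory k K A)} (hV : Simple V) : IsStronglySimple K V := by
  have := hB.hasKernels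
  have := hA.hasKernels
  have hfinV : Module.Finite K (V ⟶ V) :=
    have := hfin V.X.as V.X.as
    inferInstance
  -- a simple constituent of the underlying object of `V`
  obtain ⟨J, _, S, j, p, hS, -, -, htot⟩ := hA.isFiniteSumOfSimples V.X.as
  let F := baseChangeFunctor k K A ⋙ toKaroubi _
  let d : V ⟶ F.obj V.X.as := V.decompId_i
  have hd : d ≠ 0 := fun h0 => id_nonzero V <| by
    rw [Karoubi.decompId, show V.decompId_i = 0 from h0, zero_comp]
  obtain ⟨q, hq⟩ : ∃ q, d ≫ F.map (p q) ≠ 0 := by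
    by_contra! h0
    apply hd
    rw [← Category.comp_id d, ← F.map_id, ← htot, Functor.map_sum, Preadditive.comp_sum]
    exact Finset.sum_eq_zero fun q _ => by rw [F.map_comp, reassoc_of% h0 q, zero_comp]
  let i : V ⟶ incl k K (S q) := d ≫ F.map (p q)
  have hi : i ≠ 0 := hq
  have : Mono i := mono_of_nonzero_from_simple hi
  obtain ⟨r, hr⟩ := hB.isRegularCategory.exists_retraction i
  have := hS q
  refine isStronglySimple_of_center fun z hz => ?_
  obtain ⟨y, hy, rfl⟩ := (hB.isFiniteSumOfSimples (incl k K (S q))).exists_central_extension i r hr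
    z hz
  have := hfin (S q) (S q)
  have hdom : IsDomain (End (S q)) := inferInstance
  have : Algebra.FormallyUnramified k (Subalgebra.center k (End (S q))) :=
    formallyUnramified_center_of_isSeparable (hsep (S q) (hS q))
  exact exists_smul_eq_of_central i r hr y hy

end ScalarExtCategory

section BaseChange

variable {k K : Type w} [Field k] [Field K] [Algebra k K] [IsSepClosed K]
variable {C : Type u} [Bicategory.{w, v} C] [PreadditiveBicategory C] [LinearBicategory k C]

theorem isStronglySemisimpleBicategory_baseChange (h : IsSemisimpleBicategory C)
    (hfin : ∀ (a b : C) (V W : a ⟶ b), Module.Finite k (V ⟶ W))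
    (hsep : HasNoInseparableExtensions k C) (hD : IsSemisimpleBicategory (BaseChange k K C)) :
    IsStronglySemisimpleBicategory K (BaseChange k K C) :=
  ⟨hD, fun a b _ hV => ScalarExtCategory.isStronglySimple_of_isSeparable_center (k := k) (K := K)
    (h a.as.as b.as.as) (hfin _ _) (hsep _ _) (hD a b) hV⟩

/-- Simple summands of 1-identities of the base change have scalar endomorphisms. -/
theorem BaseChange.exists_smul_eq_of_unit_summand
    (hfin : ∀ (a b : C) (V W : a ⟶ b), Module.Finite k (V ⟶ W))
    (hunr : ∀ a : C, Algebra.FormallyUnramified k (End (𝟙 a)))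
    (hD : IsSemisimpleBicategory (BaseChange k K C)) (a : BaseChange k K C) {S : a ⟶ a}
    [hS : Simple S] (i : S ⟶ 𝟙 a) (r : 𝟙 a ⟶ S) (h : i ≫ r = 𝟙 S) (f : S ⟶ S) :
    ∃ c : K, c • 𝟙 S = f := by
  have := (hD a a).hasKernels
  have : HasKernels (Karoubi (ScalarExtCategory k K (a.as.as ⟶ a.as.as))) := this
  have := hfin _ _ (𝟙 a.as.as) (𝟙 a.as.as)
  have := hunr a.as.as
  have hcenter : Subalgebra.center k (End (𝟙 a.as.as)) = ⊤ := Subalgebra.center_eq_top _ _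
  let e : End (𝟙 a.as.as) ≃ₐ[k] Subalgebra.center k (End (𝟙 a.as.as)) :=
    Subalgebra.topEquiv.symm.trans (Subalgebra.equivOfEq _ _ hcenter.symm)
  have : Algebra.FormallyUnramified k (Subalgebra.center k (End (𝟙 a.as.as))) := .of_equiv e
  obtain ⟨c, hc⟩ := ScalarExtCategory.exists_smul_eq_of_central (k := k) (K := K)
    (A := a.as.as ⟶ a.as.as) (X := 𝟙 a.as.as) (V := S) i r h (r ≫ f ≫ i) fun g =>
      unit_end_comm (a := a) (r ≫ f ≫ i) g
  refine ⟨c, hc.trans ?_⟩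
  change i ≫ (r ≫ f ≫ i) ≫ r = f
  simp [reassoc_of% h, h]

end BaseChange

/-! ### The base change as a folded form -/

/-- The 1-identities of a semisimple 2-category decompose into simple objects. -/
theorem IsSemisimpleBicategory.exists_unitDecomposition {D : Type u} [Bicategory.{w, v} D]
    [PreadditiveBicategory D] (h : IsSemisimpleBicategory D) :
    ∃ F : UnitDecomposition D, ∀ A s, Simple (F.obj A s) := by
  have key : ∀ A : D, ∃ (n : ℕ) (S : Fin n → (A ⟶ A)) (i : ∀ s, S s ⟶ 𝟙 A) (r : ∀ s, 𝟙 A ⟶ S s),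
      (∀ s, Simple (S s)) ∧ (∀ s, i s ≫ r s = 𝟙 (S s)) ∧ (∀ s t, s ≠ t → i s ≫ r t = 0) ∧
        ∑ s, r s ≫ i s = 𝟙 (𝟙 A) := fun A => by
    obtain ⟨J, _, S, i, r, hS, hir, hir', htot⟩ := (h A A).isFiniteSumOfSimples (𝟙 A)
    let e := (Fintype.equivFin J).symm
    exact ⟨Fintype.card J, fun s => S (e s), fun s => i (e s), fun s => r (e s), fun s => hS _,
      fun s => hir _, fun s t hst => hir' _ _ (e.injective.ne hst),
      (Equiv.sum_comp e fun j => r j ≫ i j).trans htot⟩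
  choose n S i r hS hir hir' htot using key
  exact ⟨⟨n, S, fun {A} => i A, fun {A} => r A, fun {A} => hir A, fun {A} => hir' A, htot⟩, hS⟩

theorem isFoldedForm_baseChange {k K : Type w} [Field k] [Field K] [Algebra k K] [IsSepClosed K]
    {C : Type u} [Bicategory.{w, v} C] [PreadditiveBicategory C] [LinearBicategory k C]
    (hfin : ∀ (a b : C) (V W : a ⟶ b), Module.Finite k (V ⟶ W))
    (hunr : ∀ a : C, Algebra.FormallyUnramified k (End (𝟙 a)))
    (hD : IsSemisimpleBicategory (BaseChange k K C)) :
    ∃ (E : Type u) (_ : Bicategory.{w, max v w} E) (_ : PreadditiveBicategory E)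
      (_ : LinearBicategory K E),
      IsSemisimpleBicategory E ∧ (∀ x : E, IsStronglySimple K (𝟙 x)) ∧
        IsFoldedForm K (BaseChange k K C) E := by
  obtain ⟨F, hF⟩ := hD.exists_unitDecomposition
  refine ⟨F.Unfolding, inferInstance, inferInstance, inferInstance,
    UnitDecomposition.Unfolding.isSemisimpleBicategory (K := K) hD
      BaseChange.isIdempotentComplete fun A B V W => BaseChange.finite_hom hfin V W,
    UnitDecomposition.Unfolding.isStronglySimple_id hD fun A s => ?_,
    ⟨UnitDecomposition.Unfolding.folding F K⟩⟩
  have := hF A s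
  have hsc := BaseChange.exists_smul_eq_of_unit_summand hfin hunr hD A (F.ι s) (F.π s) (F.ι_π s)
  have := (hD A A).hasKernels
  have : Module.Finite K (F.obj A s ⟶ F.obj A s) := BaseChange.finite_hom hfin _ _
  exact (isStronglySimple_of_center (K := K) fun z _ => hsc z).2

theorem theorem1 (C : Type u) [Bicategory.{w, v} C] [PreadditiveBicategory C]
    (hconn : IsConnectedBicategory C) (hss : IsSemisimpleBicategory C)
    (hrigid : IsRigidBicategory C) (hfin : HasFinitelyManySimples C) :
    ∃ (k : Type w) (_ : Field k) (_ : LinearBicategory k C),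
      (∀ (a b : C) (V W : a ⟶ b), Module.Finite k (V ⟶ W)) ∧
      (∃ (E : Type u) (_ : Bicategory.{w, max v w} E) (_ : PreadditiveBicategory E)
        (_ : LinearBicategory (SeparableClosure k) E),
        IsSemisimpleBicategory E ∧
        (∀ x : E, IsStronglySimple (SeparableClosure k) (𝟙 x)) ∧
        IsFoldedForm (SeparableClosure k) (BaseChange k (SeparableClosure k) C) E) ∧
      (HasNoInseparableExtensions k C →
        IsStronglySemisimpleBicategory (SeparableClosure k)
          (BaseChange k (SeparableClosure k) C)) := by
  obtain ⟨k, _, _, hk⟩ := exists_linear_hasScalarCenter hconn hss hrigid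
  have hfin' : ∀ (a b : C) (V W : a ⟶ b), Module.Finite k (V ⟶ W) := fun a b V W =>
    finite_hom hconn hss hrigid hfin hk V W
  have hD : IsSemisimpleBicategory (BaseChange k (SeparableClosure k) C) := hss.baseChange hfin'
  exact ⟨k, _, _, hfin', isFoldedForm_baseChange hfin'
    (formallyUnramified_unit_end hconn hss hrigid hfin hk) hD,
    fun hsep => isStronglySemisimpleBicategory_baseChange hss hfin' hsep hD⟩
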